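/- **Setting.** Let $R$ be a monoid with unit group $W=G(R)$ and set of idempotents $E(R)$. $R$ is *factorisable* if $R=E(R)W=WE(R)$ and idempotents commute; then $E(R)$ is ordered by $e\le f\iff ef=e$. For $e\in E(R)$ put $W(e)=\{w\in W\mid we=ew\}$ and $W_\star(e)=\{w\in W\mid we=ew=e\}$. A *generalised Renner–Coxeter system* is a triple $(R,\Lambda,S)$ such that: 1. $R$ is a factorisable monoid; 2. $\Lambda\subseteq E(R)$ is closed under products and contains exactly one element of each orbit of $W$ acting on $E(R)$ by conjugation; 3. $(W,S)$ is a Coxeter system, with Coxeter matrix $(m_{s,t})$; 4. whenever $e_1\le e_2$ in $E(R)$, there are $w\in W$ and $f_1\le f_2$ in $\Lambda$ with $wf_iw^{-1}=e_i$ for $i=1,2$; 5. for every $e\in\Lambda$, $W(e)$ and $W_\star(e)$ are standard parabolic subgroups of $W$ (each is the subgroup $W_I$ generated by some $I\subseteq S$); 6. for $e\le f$ in $\Lambda$ one has $\lambda^\star(e)\subseteq\lambda^\star(f)$, where $\lambda^\star(e)=\{s\in S\mid se=es\ne e\}$. Put $\lambda_\star(e)=\{s\in S\mid se=es=e\}$,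 $\lambda(e)=S\cap W(e)$ (so that $W(e)=W_{\lambda(e)}$) and $\Lambda_\circ=\Lambda\setminus\{1\}$. On $W$, $\ell$ is the Coxeter length. For $r\in R$, $\ell(r)$ is the minimal number of letters from $S$ in a word on $S\cup\Lambda_\circ$ that represents $r$ (letters from $\Lambda_\circ$ have length $0$). Let $\mathrm{Red}(e,f)$ be the set of $w\in W$ that have minimal length in the double coset $W_{\lambda(e)}\,w\,W_{\lambda(f)}$. For $w\in\mathrm{Red}(e,f)$, $e\wedge_wf$ denotes the element $h\in\Lambda$ such that $w\in W(h)$ and $ewf=wh$. Let $q$ be an indeterminate and $V$ the free $\mathbb Z[q]$-module with basis $(T_r)_{r\in R}$. The *generic Hecke algebra* $\mathcal H(R)$ is $V$ with the unique structure of associative unital $\mathbb Z[q]$-algebra with unit $T_1$ such that for all $r\in R$, $s\in S$, $e\in\Lambda_\circ$: $$T_sT_r=\begin{cases}T_{sr}&\text{if }\ell(sr)=\ell(r)+1,\\ qT_r&\text{if }\ell(sr)=\ell(r),\\ (q-1)T_r+qT_{sr}&\text{if }\ell(sr)=\ell(r)-1,\end{cases}\qquad T_eT_r=q^{\ell(r)-\ell(er)}T_{er}.$$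 **Statement.** Let $(R,\Lambda,S)$ be a generalised Renner–Coxeter system, and fix for every $w\in W$ an arbitrary reduced word of $w$ on $S$. Then there is exactly one algebra structure on $V$ as above, so $\mathcal H(R)$ is well defined. For all $e,f\in\Lambda_\circ$ and $w\in\mathrm{Red}(e,f)$ the element $e\wedge_wf$ exists, is unique and lies in $\Lambda_\circ$. Finally, $\mathcal H(R)$ admits the following presentation as a $\mathbb Z[q]$-algebra: the generators are the $T_x$ with $x\in S\cup\Lambda_\circ$ (corresponding to the basis elements $T_x$ of $\mathcal H(R)$), and the defining relations are * (HEC1) $T_s^2=(q-1)T_s+q\cdot 1$ for $s\in S$; * (HEC2) $T_sT_tT_s\cdots=T_tT_sT_t\cdots$ ($m_{s,t}$ factors on each side) for $s\ne t$ in $S$ with $m_{s,t}<\infty$; * (HEC3) $T_sT_e=T_eT_s$ for $e\in\Lambda_\circ$, $s\in\lambda^\star(e)$; * (HEC4) $T_sT_e=T_eT_s=qT_e$ for $e\in\Lambda_\circ$, $s\in\lambda_\star(e)$; * (HEC5) $T_eT_wT_f=q^{\ell(w)}T_{e\wedge_wf}$ for $e,f\in\Lambda_\circ$, $w\in\mathrm{Red}(e,f)$,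 where $T_w=T_{s_1}\cdots T_{s_k}$ for the fixed reduced word $s_1\cdots s_k$ of $w$. -/

import Mathlib

open Polynomial

noncomputable section

/-- A monoid is factorisable if every element is the product of an idempotent and a unit, in either
order, and its idempotents commute (so that they form a lower semi-lattice, with
`e ≤ f` iff `e * f = e`). -/
structure IsFactorisableMonoid (R : Type*) [Monoid R] : Prop where
  exists_idempotent_mul_unit : ∀ r : R, ∃ (e : R) (u : Rˣ), IsIdempotentElem e ∧ r = e * u
  exists_unit_mul_idempotent : ∀ r : R, ∃ (u : Rˣ) (e : R), IsIdempotentElem e ∧ r = u * e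
  idempotents_commute : ∀ e f : R, IsIdempotentElem e → IsIdempotentElem f → e * f = f * e

/-- The subgroup `W(e)` of the units `w` with `w e = e w`. -/
def unitCentralizer {R : Type*} [Monoid R] (e : R) : Subgroup Rˣ where
  carrier := {w | (w : R) * e = e * w}
  one_mem' := by simp
  mul_mem' := by
    intro a b ha hb
    simp only [Set.mem_ofPred_eq, Units.val_mul] at *
    rw [mul_assoc, hb, ← mul_assoc, ha, mul_assoc]
  inv_mem' := by
    intro a ha
    simp only [Set.mem_ofPred_eq] at *
    rw [Units.inv_mul_eq_iff_eq_mul, ← mul_assoc, ha, mul_assoc, Units.mul_inv, mul_one]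

/-- The subgroup `W_⋆(e)` of the units `w` with `w e = e w = e`. -/
def unitStabilizer {R : Type*} [Monoid R] (e : R) : Subgroup Rˣ where
  carrier := {w | (w : R) * e = e ∧ e * w = e}
  one_mem' := by simp
  mul_mem' := by
    rintro a b ⟨ha, ha'⟩ ⟨hb, hb'⟩
    simp only [Set.mem_ofPred_eq, Units.val_mul]
    exact ⟨by rw [mul_assoc, hb, ha], by rw [← mul_assoc, ha', hb']⟩
  inv_mem' := by
    rintro a ⟨ha, ha'⟩
    simp only [Set.mem_ofPred_eq]
    exact ⟨by rw [Units.inv_mul_eq_iff_eq_mul, ha], by rw [Units.mul_inv_eq_iff_eq_mul, ha']⟩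

/-- The standard parabolic subgroup `W_I` generated by the simple reflections indexed by `I`. -/
def standardParabolic {B W : Type*} [Group W] {M : CoxeterMatrix B} (cs : CoxeterSystem M W)
    (I : Set B) : Subgroup W :=
  Subgroup.closure (cs.simple '' I)

/-- `w` has minimal length in the double coset `W_I w W_J`. -/
def IsDoubleReduced {B W : Type*} [Group W] {M : CoxeterMatrix B} (cs : CoxeterSystem M W)
    (I J : Set B) (w : W) : Prop :=
  ∀ a ∈ standardParabolic cs I, ∀ b ∈ standardParabolic cs J, cs.length w ≤ cs.length (a * w * b)

/-- `λ_⋆(e)`: the simple reflections `s` with `s e = e s = e`. Here and below simple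
reflections are given by their indices. -/
def lowerType {B R : Type*} [Monoid R] {M : CoxeterMatrix B} (cs : CoxeterSystem M Rˣ)
    (e : R) : Set B :=
  {i | (cs.simple i : R) * e = e ∧ e * (cs.simple i : R) = e}

/-- `λ^⋆(e)`: the simple reflections `s` with `s e = e s ≠ e`. -/
def upperType {B R : Type*} [Monoid R] {M : CoxeterMatrix B} (cs : CoxeterSystem M Rˣ)
    (e : R) : Set B :=
  {i | (cs.simple i : R) * e = e * (cs.simple i : R) ∧ e * (cs.simple i : R) ≠ e}

/-- The type `λ(e)`: the simple reflections that lie in `W(e)`. -/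
def typeMap {B R : Type*} [Monoid R] {M : CoxeterMatrix B} (cs : CoxeterSystem M Rˣ)
    (e : R) : Set B :=
  {i | cs.simple i ∈ unitCentralizer e}

/-- A generalised Renner-Coxeter system `(R, Λ, S)`. The set `S` is the set of simple reflections
of a Coxeter system on the group of units of `R`, with Coxeter matrix `M` (where the entry `0`
stands for `∞`). -/
structure RennerCoxeterSystem {B : Type*} (M : CoxeterMatrix B) (R : Type*) [Monoid R] where
  /-- the Coxeter system on the group of units -/
  cs : CoxeterSystem M Rˣ
  /-- the cross section lattice -/
  Λ : Set R
  factorisable : IsFactorisableMonoid R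
  isIdempotentElem : ∀ e ∈ Λ, IsIdempotentElem e
  transversal : ∀ e : R, IsIdempotentElem e →
    ∃! f : R, f ∈ Λ ∧ ∃ w : Rˣ, (w : R) * f * ((w⁻¹ : Rˣ) : R) = e
  mul_mem : ∀ e ∈ Λ, ∀ f ∈ Λ, e * f ∈ Λ
  conj_pair : ∀ e₁ e₂ : R, IsIdempotentElem e₁ → IsIdempotentElem e₂ → e₁ * e₂ = e₁ →
    ∃ (w : Rˣ) (f₁ f₂ : R), f₁ ∈ Λ ∧ f₂ ∈ Λ ∧ f₁ * f₂ = f₁ ∧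
      (w : R) * f₁ * ((w⁻¹ : Rˣ) : R) = e₁ ∧ (w : R) * f₂ * ((w⁻¹ : Rˣ) : R) = e₂
  centralizer_parabolic : ∀ e ∈ Λ, ∃ I : Set B, unitCentralizer e = standardParabolic cs I
  stabilizer_parabolic : ∀ e ∈ Λ, ∃ I : Set B, unitStabilizer e = standardParabolic cs I
  upperType_mono : ∀ e ∈ Λ, ∀ f ∈ Λ, e * f = e → upperType cs e ⊆ upperType cs f

namespace RennerCoxeterSystem

variable {B R : Type*} [Monoid R] {M : CoxeterMatrix B} (𝓡 : RennerCoxeterSystem M R)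

/-- `Λ∘ = Λ \ {1}`. -/
def LambdaCirc : Set R := 𝓡.Λ \ {1}

/-- The alphabet `S ∪ Λ∘`. -/
abbrev Letter : Type _ := B ⊕ 𝓡.LambdaCirc

/-- The element of `R` represented by a letter. -/
def letterVal : 𝓡.Letter → R
  | Sum.inl i => (𝓡.cs.simple i : R)
  | Sum.inr e => e

/-- The length of a letter: `1` on `S` and `0` on `Λ∘`. -/
def letterLength : 𝓡.Letter → ℕ
  | Sum.inl _ => 1
  | Sum.inr _ => 0

/-- The length of `r ∈ R`: the minimal length of a word on `S ∪ Λ∘` that represents `r`. -/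
def length (r : R) : ℕ :=
  sInf {n | ∃ ω : List 𝓡.Letter, (ω.map 𝓡.letterVal).prod = r ∧ (ω.map 𝓡.letterLength).sum = n}

/-- Every element of `R` is represented by a word on `S ∪ Λ∘`. -/
theorem exists_word (r : R) : ∃ ω : List 𝓡.Letter, (ω.map 𝓡.letterVal).prod = r := by
  have hu : ∀ u : Rˣ, ∃ ω : List 𝓡.Letter, (ω.map 𝓡.letterVal).prod = u := by
    intro u
    obtain ⟨ω, rfl⟩ := 𝓡.cs.wordProd_surjective u
    refine ⟨ω.map Sum.inl, ?_⟩
    induction ω with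
    | nil => simp
    | cons a l ih =>
      rw [List.map_cons, List.map_cons, List.prod_cons, ih, CoxeterSystem.wordProd_cons,
        Units.val_mul]
      rfl
  obtain ⟨e, u, he, rfl⟩ := 𝓡.factorisable.exists_idempotent_mul_unit r
  obtain ⟨f, ⟨hf, w, rfl⟩, -⟩ := 𝓡.transversal e he
  obtain ⟨a, ha⟩ := hu w
  obtain ⟨b, hb⟩ := hu (w⁻¹ : Rˣ)
  obtain ⟨c, hc⟩ := hu u
  by_cases h1 : f = 1
  · exact ⟨a ++ b ++ c, by simp [ha, hb, hc, h1]⟩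
  · exact ⟨a ++ [Sum.inr ⟨f, hf, h1⟩] ++ b ++ c, by simp [ha, hb, hc, letterVal, mul_assoc]⟩

/-- `ℓ(er) ≤ ℓ(r)` for `e ∈ Λ∘`. -/
theorem length_lambda_mul_le {e : R} (he : e ∈ 𝓡.LambdaCirc) (r : R) :
    𝓡.length (e * r) ≤ 𝓡.length r := by
  obtain ⟨ω, h⟩ := 𝓡.exists_word r
  obtain ⟨ω', h1, h2⟩ := Nat.sInf_mem (s := {n | ∃ ω : List 𝓡.Letter,
    (ω.map 𝓡.letterVal).prod = r ∧ (ω.map 𝓡.letterLength).sum = n}) ⟨_, ω, h, rfl⟩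
  refine Nat.sInf_le ⟨Sum.inr ⟨e, he⟩ :: ω', ?_, ?_⟩
  · simp [h1, letterVal]
  · simpa [letterLength, length] using h2

/-- `Red(e, f)`: the units of minimal length in their double coset `W(e) w W(f)`. -/
def Red (e f : R) : Set Rˣ :=
  {w | IsDoubleReduced 𝓡.cs (typeMap 𝓡.cs e) (typeMap 𝓡.cs f) w}

/-- `h` is the element `e ∧_w f` of `Λ`: the unit `w` lies in `W(h)` and `e w f = w h`. -/
def IsWedge (e : R) (w : Rˣ) (f h : R) : Prop :=
  h ∈ 𝓡.Λ ∧ w ∈ unitCentralizer h ∧ e * w * f = w * h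

/-- The basis element `T_r` of the free `ℤ[q]`-module on `R`. -/
def basisT (r : R) : R →₀ ℤ[X] := Finsupp.single r 1

/-- The bilinear product `μ` is a structure of associative `ℤ[q]`-algebra with unit `T_1` on the
free module with basis `(T_r)`, and left multiplication by the `T_x`, `x ∈ S ∪ Λ∘`, is given by the
defining formulas of the generic Hecke algebra. (In the last formula, `ℓ(er) ≤ ℓ(r)` by
`length_lambda_mul_le`.) -/
structure IsHeckeMul (μ : (R →₀ ℤ[X]) →ₗ[ℤ[X]] (R →₀ ℤ[X]) →ₗ[ℤ[X]] (R →₀ ℤ[X])) : Prop where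
  assoc : ∀ a b c, μ (μ a b) c = μ a (μ b c)
  one_left : ∀ a, μ (basisT 1) a = a
  one_right : ∀ a, μ a (basisT 1) = a
  simple_up : ∀ (i : B) (r : R), 𝓡.length (𝓡.cs.simple i * r) = 𝓡.length r + 1 →
    μ (basisT (𝓡.cs.simple i : R)) (basisT r) = basisT (𝓡.cs.simple i * r)
  simple_eq : ∀ (i : B) (r : R), 𝓡.length (𝓡.cs.simple i * r) = 𝓡.length r →
    μ (basisT (𝓡.cs.simple i : R)) (basisT r) = (X : ℤ[X]) • basisT r
  simple_down : ∀ (i : B) (r : R), 𝓡.length (𝓡.cs.simple i * r) + 1 = 𝓡.length r →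
    μ (basisT (𝓡.cs.simple i : R)) (basisT r) =
      (X - 1 : ℤ[X]) • basisT r + (X : ℤ[X]) • basisT (𝓡.cs.simple i * r)
  lambda_mul : ∀ e ∈ 𝓡.LambdaCirc, ∀ r : R,
    μ (basisT e) (basisT r) =
      (X ^ (𝓡.length r - 𝓡.length (e * r)) : ℤ[X]) • basisT (e * r)

/-- The algebra given by the product `μ`. When `μ` is the unique product with `IsHeckeMul`, this
is the generic Hecke algebra `H(R)`. -/
@[nolint unusedArguments]
def HeckeAlgebra {𝓡 : RennerCoxeterSystem M R}
    {μ : (R →₀ ℤ[X]) →ₗ[ℤ[X]] (R →₀ ℤ[X]) →ₗ[ℤ[X]] (R →₀ ℤ[X])}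
    (_ : 𝓡.IsHeckeMul μ) : Type _ := R →₀ ℤ[X]

namespace HeckeAlgebra

variable {𝓡}
variable {μ : (R →₀ ℤ[X]) →ₗ[ℤ[X]] (R →₀ ℤ[X]) →ₗ[ℤ[X]] (R →₀ ℤ[X])} (hμ : 𝓡.IsHeckeMul μ)

instance : AddCommGroup (HeckeAlgebra hμ) := inferInstanceAs (AddCommGroup (R →₀ ℤ[X]))

instance : Module ℤ[X] (HeckeAlgebra hμ) := inferInstanceAs (Module ℤ[X] (R →₀ ℤ[X]))

instance : Ring (HeckeAlgebra hμ) :=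
  { (inferInstance : AddCommGroup (HeckeAlgebra hμ)) with
    mul := fun a b => μ a b
    one := basisT 1
    mul_assoc := hμ.assoc
    one_mul := hμ.one_left
    mul_one := hμ.one_right
    left_distrib := fun a b c => (μ a).map_add b c
    right_distrib := fun a b c => μ.map_add₂ a b c
    zero_mul := fun a => μ.map_zero₂ a
    mul_zero := fun a => (μ a).map_zero }

instance : Algebra ℤ[X] (HeckeAlgebra hμ) :=
  Algebra.ofModule (fun c a b => μ.map_smul₂ c a b) (fun c a b => (μ a).map_smul c b)

/-- The basis element `T_r`, as an element of the algebra. -/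
def T (r : R) : HeckeAlgebra hμ := (basisT r : R →₀ ℤ[X])

end HeckeAlgebra

/-- The alternating product `a b a ⋯` with `m` factors. -/
def altProd {A : Type*} [Monoid A] : A → A → ℕ → A
  | _, _, 0 => 1
  | a, b, m + 1 => a * altProd b a m

/-- The generator `T_s` of the free algebra on `S ∪ Λ∘`. -/
def genS (i : B) : FreeAlgebra ℤ[X] 𝓡.Letter := FreeAlgebra.ι ℤ[X] (Sum.inl i)

/-- The generator `T_e` of the free algebra on `S ∪ Λ∘`. -/
def genΛ (e : 𝓡.LambdaCirc) : FreeAlgebra ℤ[X] 𝓡.Letter := FreeAlgebra.ι ℤ[X] (Sum.inr e)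

/-- The product `T_{s₁} ⋯ T_{s_k}` for a word `s₁ ⋯ s_k` on `S`. -/
def genWord (ω : List B) : FreeAlgebra ℤ[X] 𝓡.Letter := (ω.map 𝓡.genS).prod

/-- The defining relations; `word w` is the chosen reduced word of `w`, used to write `T_w`. -/
inductive HeckeRel (word : Rˣ → List B) :
    FreeAlgebra ℤ[X] 𝓡.Letter → FreeAlgebra ℤ[X] 𝓡.Letter → Prop
  | quadratic (i : B) :
      HeckeRel word (𝓡.genS i * 𝓡.genS i) ((X - 1 : ℤ[X]) • 𝓡.genS i + (X : ℤ[X]) • 1)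
  | braid (i j : B) (hij : i ≠ j) (hM : M i j ≠ 0) :
      HeckeRel word (altProd (𝓡.genS i) (𝓡.genS j) (M i j))
        (altProd (𝓡.genS j) (𝓡.genS i) (M i j))
  | upper (i : B) (e : 𝓡.LambdaCirc) (hi : i ∈ upperType 𝓡.cs (e : R)) :
      HeckeRel word (𝓡.genS i * 𝓡.genΛ e) (𝓡.genΛ e * 𝓡.genS i)
  | lower_left (i : B) (e : 𝓡.LambdaCirc) (hi : i ∈ lowerType 𝓡.cs (e : R)) :
      HeckeRel word (𝓡.genS i * 𝓡.genΛ e) ((X : ℤ[X]) • 𝓡.genΛ e)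
  | lower_right (i : B) (e : 𝓡.LambdaCirc) (hi : i ∈ lowerType 𝓡.cs (e : R)) :
      HeckeRel word (𝓡.genΛ e * 𝓡.genS i) ((X : ℤ[X]) • 𝓡.genΛ e)
  | wedge (e f h : 𝓡.LambdaCirc) (w : Rˣ) (hw : w ∈ 𝓡.Red (e : R) f)
      (hh : 𝓡.IsWedge (e : R) w f h) :
      HeckeRel word (𝓡.genΛ e * 𝓡.genWord (word w) * 𝓡.genΛ f)
        ((X ^ 𝓡.cs.length w : ℤ[X]) • 𝓡.genΛ h)

/-- The `ℤ[q]`-algebra given by the generators `T_x`, `x ∈ S ∪ Λ∘`, and the defining relations. -/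
abbrev PresentedHecke (word : Rˣ → List B) : Type _ := RingQuot (𝓡.HeckeRel word)

/-- The class of the generator `T_x` in the presented algebra. -/
def presentedGen (word : Rˣ → List B) (x : 𝓡.Letter) : 𝓡.PresentedHecke word :=
  RingQuot.mkAlgHom ℤ[X] (𝓡.HeckeRel word) (FreeAlgebra.ι ℤ[X] x)

end RennerCoxeterSystem

end

/-! The presented algebra is made to act on $V$: each letter acts by the operator `leftOp` that the
defining formulas prescribe. Evaluating this action at $T_1$ sends suitable normal-form elements of
the presented algebra to the basis $(T_r)$, and the relations show that these elements span. Hence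
evaluation at $T_1$ is a linear isomorphism (`presentedEquiv`). It carries the product over to $V$,
which gives existence and the presentation at once. Uniqueness holds because every $T_r$ arises from
$T_1$ by prescribed operators.

That the `leftOp` satisfy the relations is checked through operators `rightOp` of multiplication
from the right. Left and right operators commute (`commute_leftOp_rightOp`), and the right ones
produce all $T_r$ from $T_1$, so two operators that commute with them are equal once they agree on
$T_1$ (`eq_of_commute_rightOp`).

The commutation rests on the normal form $r=ugv$ with $g\in\Lambda$, $u$ shortest in $uW_\star(g)$
and $v$ shortest in $W(g)v$, for which $\ell(r)=\ell(u)+\ell(v)$ (`IsNormal.length_eq`). It yields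
the two critical facts on lengths, `RennerCoxeterSystem.simple_mul_eq_mul_simple` and
`length_mul_lambda_le_of_length_lt`. Behind them stand the factorisation of $W(g)$ into two
commuting parts (`simple_commute`, `exists_mul_of_mem_unitCentralizer`) and `wedge_spec`: for
$w\in\mathrm{Red}(e,f)$ the product $ewf$ lies in $\Lambda$ and is fixed by $w$.

From Coxeter theory one needs the exchange property, Deodhar's lemma with the resulting double coset
decompositions, and Matsumoto's theorem (`prod_map_eq_of_isReduced`), which frees $T_w$ from the
chosen reduced word. -/

namespace CoxeterSystem

/-! ### Inversion parity and the exchange property -/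

variable {B W : Type*} [Group W] {M : CoxeterMatrix B} (cs : CoxeterSystem M W)

open Classical in
/-- The action of a simple reflection on `W × ℤ/2` by conjugation, changing the sign exactly at the
simple reflection itself. -/
noncomputable def signedConj (i : B) : Function.End (W × ZMod 2) := fun p =>
  (cs.simple i * p.1 * cs.simple i, p.2 + if p.1 = cs.simple i then 1 else 0)

-- The letter applied last meets $wtw^{-1}$, and this is $s_i$ exactly when $t=w^{-1}s_iw$, the
-- reflection which that letter adds to the right inversion sequence.
open Classical in
theorem prod_signedConj (ω : List B) (t : W) (ε : ZMod 2) :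
    (ω.map cs.signedConj).prod (t, ε) =
      (cs.wordProd ω * t * (cs.wordProd ω)⁻¹, ε + ((cs.rightInvSeq ω).count t : ℕ)) := by
  induction ω with
  | nil => simp [Function.End.one_def]
  | cons i ω ih =>
    rw [List.map_cons, List.prod_cons]
    change cs.signedConj i ((ω.map cs.signedConj).prod (t, ε)) = _
    rw [ih]
    simp only [signedConj, rightInvSeq, List.count_cons, wordProd_cons, mul_inv_rev, inv_simple,
      Prod.mk.injEq]
    refine ⟨by simp only [mul_assoc], ?_⟩
    have : (cs.wordProd ω * t * (cs.wordProd ω)⁻¹ = cs.simple i) ↔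
        ((cs.wordProd ω)⁻¹ * cs.simple i * cs.wordProd ω = t) := by
      rw [mul_inv_eq_iff_eq_mul, mul_assoc, inv_mul_eq_iff_eq_mul, eq_comm]
    simp only [this, beq_iff_eq]
    push_cast
    split_ifs <;> simp [add_assoc]

/-- Because $(s_is_j)^m=1$, the second half of this sequence repeats the first. So the sign changes
cancel and `signedConj` respects the Coxeter relations. -/
theorem even_count_leftInvSeq_alternatingWord [DecidableEq W] (i j : B) (t : W) :
    Even ((cs.leftInvSeq (alternatingWord i j (2 * M i j))).count t) := by
  set l := cs.leftInvSeq (alternatingWord i j (2 * M i j)) with hl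
  have hlen : l.length = 2 * M i j := by simp [hl]
  have h : l.take (M i j) = l.drop (M i j) := by
    apply List.ext_getElem
    · simp [hlen]; omega
    · intro k h1 h2
      simp only [List.length_take, List.length_drop, hlen] at h1 h2
      simp only [List.getElem_take, List.getElem_drop, hl]
      rw [cs.getElem_leftInvSeq_alternatingWord i j _ k (by omega),
        cs.getElem_leftInvSeq_alternatingWord i j _ (M i j + k) (by omega),
        prod_alternatingWord_eq_mul_pow, prod_alternatingWord_eq_mul_pow]
      have e1 : (2 * k + 1) / 2 = k := by omega
      have e2 : (2 * (M i j + k) + 1) / 2 = M i j + k := by omega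
      rw [e1, e2, pow_add, simple_mul_simple_pow']
      simp
  rw [← List.take_append_drop (M i j) l, List.count_append, h]
  exact ⟨_, rfl⟩

theorem prod_map_reverse_alternatingWord {G : Type*} [Monoid G] (f : B → G) (i j : B) (p : ℕ) :
    ((alternatingWord i j (2 * p)).reverse.map f).prod = (f j * f i) ^ p := by
  induction p with
  | zero => simp [alternatingWord]
  | succ p ih =>
    rw [show 2 * (p + 1) = 2 * p + 1 + 1 by ring, alternatingWord_succ, alternatingWord_succ,
      pow_succ', ← ih]
    simp [mul_assoc]

theorem isLiftable_signedConj : M.IsLiftable cs.signedConj := by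
  classical
  intro j i
  rw [M.symmetric, ← prod_map_reverse_alternatingWord]
  funext ⟨t, ε⟩
  rw [prod_signedConj, rightInvSeq_reverse, List.count_reverse]
  have h := cs.even_count_leftInvSeq_alternatingWord i j t
  have h2 : cs.wordProd (alternatingWord i j (2 * M i j)).reverse = 1 := by
    have := prod_map_reverse_alternatingWord cs.simple i j (M i j)
    rw [wordProd, this, simple_mul_simple_pow']
  rw [h2, (ZMod.natCast_eq_zero_iff_even).2 h]
  simp [Function.End.one_def]

-- As `signedConj` extends to $W$, its second coordinate depends only on the group element and not
-- on the word.
open Classical in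
theorem count_rightInvSeq_eq {ω ω' : List B} (h : cs.wordProd ω = cs.wordProd ω') (t : W) :
    (((cs.rightInvSeq ω).count t : ℕ) : ZMod 2) = ((cs.rightInvSeq ω').count t : ℕ) := by
  have key : ∀ ω : List B,
      (ω.map cs.signedConj).prod = cs.lift ⟨_, cs.isLiftable_signedConj⟩ (cs.wordProd ω) := by
    intro ω
    rw [wordProd, map_list_prod, List.map_map]
    congr 2
    funext i
    simp
  have h1 := congrFun ((key ω).trans ((congrArg _ h).trans (key ω').symm)) (t, 0)
  rw [prod_signedConj, prod_signedConj] at h1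
  simpa using congrArg Prod.snd h1

/-- The exchange property, for right multiplication. -/
theorem exchange_right {ω : List B} {i : B}
    (h : cs.length (cs.wordProd ω * cs.simple i) < cs.length (cs.wordProd ω)) :
    ∃ j < ω.length, cs.wordProd ω * cs.simple i = cs.wordProd (ω.eraseIdx j) := by
  classical
  obtain ⟨ν, hν, hν'⟩ := cs.exists_isReduced (cs.wordProd ω * cs.simple i)
  have hw : cs.wordProd ω = cs.wordProd (ν ++ [i]) := by
    rw [wordProd_append, ← hν']; simp
  have hred : cs.IsReduced (ν ++ [i]) := by
    rw [IsReduced, ← hw]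
    rcases cs.length_mul_simple (cs.wordProd ω) i with h1 | h1
    · omega
    · rw [← h1, hν', hν.eq]; simp
  -- $s_i$ occurs exactly once for the reduced word $\nu i$, hence an odd number of times for
  -- $\omega$; a position where it occurs is the letter to delete.
  have hmem : cs.simple i ∈ cs.rightInvSeq (ν ++ [i]) := by
    rw [← List.concat_eq_append, rightInvSeq_concat]; simp
  have hc : (cs.rightInvSeq (ν ++ [i])).count (cs.simple i) = 1 :=
    List.count_eq_one_of_mem hred.nodup_rightInvSeq hmem
  have h2 := cs.count_rightInvSeq_eq hw (cs.simple i)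
  rw [hc] at h2
  have h3 : cs.simple i ∈ cs.rightInvSeq ω := by
    by_contra h4
    rw [List.count_eq_zero_of_not_mem h4] at h2
    simp at h2
  obtain ⟨j, hj, hj'⟩ := List.mem_iff_getElem.1 h3
  refine ⟨j, by simpa using hj, ?_⟩
  rw [← wordProd_mul_getD_rightInvSeq, List.getD_eq_getElem _ _ hj, hj']

/-- The exchange property, for left multiplication. -/
theorem exchange_left {ω : List B} {i : B}
    (h : cs.length (cs.simple i * cs.wordProd ω) < cs.length (cs.wordProd ω)) :
    ∃ j < ω.length, cs.simple i * cs.wordProd ω = cs.wordProd (ω.eraseIdx j) := by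
  have h' : cs.length (cs.wordProd ω.reverse * cs.simple i) < cs.length (cs.wordProd ω.reverse) := by
    rw [← cs.length_inv, ← cs.length_inv (cs.wordProd ω.reverse)]
    simpa using h
  obtain ⟨j, hj, hj'⟩ := cs.exchange_right h'
  rw [List.length_reverse] at hj
  refine ⟨ω.length - 1 - j, by omega, ?_⟩
  have := congrArg (·⁻¹) hj'
  simp only [wordProd_reverse, mul_inv_rev, inv_simple, inv_inv] at this
  rw [this, ← wordProd_reverse]
  congr 1
  rw [List.eraseIdx_eq_take_drop_succ, List.eraseIdx_eq_take_drop_succ, List.reverse_append,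
    List.drop_reverse, List.take_reverse, List.reverse_reverse, List.reverse_reverse]
  congr 2 <;> omega

/-- If `s w` and `w t` have the same length and `s w t` has the length of `w`, then
`s w = w t`. -/
theorem simple_mul_eq_mul_simple {w : W} {i j : B}
    (h : cs.length (cs.simple i * w) = cs.length (w * cs.simple j))
    (h' : cs.length (cs.simple i * w * cs.simple j) = cs.length w) :
    cs.simple i * w = w * cs.simple j := by
  have main : ∀ w : W, cs.length (cs.simple i * w) = cs.length w + 1 →
      cs.length (w * cs.simple j) = cs.length w + 1 →
      cs.length (cs.simple i * w * cs.simple j) = cs.length w →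
      cs.simple i * w = w * cs.simple j := by
    intro w h1 h2 h3
    obtain ⟨ω, hω, rfl⟩ := cs.exists_isReduced w
    rw [← wordProd_cons] at h1 h3
    obtain ⟨k, hk, hk'⟩ := cs.exchange_right (ω := i :: ω) (i := j) (by omega)
    -- The deleted letter must be the initial $s_i$: a deletion inside $\omega$ would write $ws_j$
    -- with at most $\ell(w)$ letters.
    rcases k with _ | k
    · rw [List.eraseIdx_cons_zero, wordProd_cons] at hk'
      nth_rewrite 2 [← hk']
      simp
    · exfalso
      rw [List.eraseIdx_cons_succ, wordProd_cons, wordProd_cons, mul_assoc, mul_right_inj] at hk'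
      have := cs.length_wordProd_le (ω.eraseIdx k)
      have h4 := List.length_eraseIdx_le ω k
      rw [← hk', h2, hω.eq] at this
      omega
  rcases cs.length_simple_mul w i with h1 | h1
  · exact main w h1 (h ▸ h1) h'
  -- If $s_i$ shortens $w$, the ascending case applies to $s_iw$.
  · have := main (cs.simple i * w) (by simpa using h1.symm) (by omega) (by simp; omega)
    simp only [simple_mul_simple_cancel_left] at this
    nth_rewrite 2 [this]
    simp

end CoxeterSystem

/-! ### Standard parabolic subgroups and minimal coset representatives -/

namespace CoxeterSystem

variable {B W : Type*} [Group W] {M : CoxeterMatrix B} (cs : CoxeterSystem M W)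

theorem IsReduced.tail {cs : CoxeterSystem M W} {i : B} {ω : List B} (h : cs.IsReduced (i :: ω)) :
    cs.IsReduced ω := by
  simpa using h.drop 1

theorem IsReduced.append_left {cs : CoxeterSystem M W} {ω ν : List B}
    (h : cs.IsReduced (ω ++ ν)) : cs.IsReduced ω := by
  simpa using h.take ω.length

theorem isReduced_cons_iff {i : B} {ω : List B} (h : cs.IsReduced ω) :
    cs.IsReduced (i :: ω) ↔ cs.length (cs.simple i * cs.wordProd ω) = cs.length (cs.wordProd ω) + 1 := by
  rw [IsReduced, wordProd_cons, List.length_cons, h.eq]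

theorem IsReduced.append {cs : CoxeterSystem M W} {ω ν : List B}
    (hω : cs.IsReduced ω) (hν : cs.IsReduced ν)
    (h : cs.length (cs.wordProd ω * cs.wordProd ν) =
      cs.length (cs.wordProd ω) + cs.length (cs.wordProd ν)) : cs.IsReduced (ω ++ ν) := by
  rw [IsReduced, wordProd_append, h, hω.eq, hν.eq, List.length_append]

/-- Exchange only deletes letters, so reducing a word on $I$ never leaves $I$. -/
theorem exists_isReduced_forall_mem {I : Set B} (ω : List B) (h : ∀ i ∈ ω, i ∈ I) :
    ∃ ν, cs.IsReduced ν ∧ (∀ i ∈ ν, i ∈ I) ∧ cs.wordProd ν = cs.wordProd ω := by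
  induction ω with
  | nil => exact ⟨[], by simp [IsReduced], by simp, rfl⟩
  | cons i ω ih =>
    obtain ⟨ν, hν, hI, hp⟩ := ih fun j hj => h j (List.mem_cons_of_mem _ hj)
    have hi := h i List.mem_cons_self
    rcases cs.length_simple_mul (cs.wordProd ν) i with h1 | h1
    · refine ⟨i :: ν, (cs.isReduced_cons_iff hν).2 h1, ?_, by simp [wordProd_cons, hp]⟩
      intro j hj
      rcases List.mem_cons.1 hj with rfl | hj
      exacts [hi, hI j hj]
    · obtain ⟨k, hk, hk'⟩ := cs.exchange_left (ω := ν) (i := i) (by omega)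
      refine ⟨ν.eraseIdx k, ?_, fun j hj => hI j (List.mem_of_mem_eraseIdx hj), ?_⟩
      · have := List.length_eraseIdx_add_one hk
        rw [IsReduced, ← hk']
        rw [hν.eq] at h1
        omega
      · rw [← hk', wordProd_cons, hp]

end CoxeterSystem

open CoxeterSystem

section Parabolic

variable {B W : Type*} [Group W] {M : CoxeterMatrix B} (cs : CoxeterSystem M W) {I J : Set B}

theorem simple_mem_standardParabolic {i : B} (hi : i ∈ I) :
    cs.simple i ∈ standardParabolic cs I :=
  Subgroup.subset_closure ⟨i, hi, rfl⟩

theorem wordProd_mem_standardParabolic {ω : List B} (h : ∀ i ∈ ω, i ∈ I) :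
    cs.wordProd ω ∈ standardParabolic cs I := by
  refine Subgroup.list_prod_mem _ fun x hx => ?_
  obtain ⟨i, hi, rfl⟩ := List.mem_map.1 hx
  exact simple_mem_standardParabolic cs (h i hi)

theorem exists_isReduced_of_mem_standardParabolic {w : W} (hw : w ∈ standardParabolic cs I) :
    ∃ ω, cs.IsReduced ω ∧ (∀ i ∈ ω, i ∈ I) ∧ cs.wordProd ω = w := by
  suffices ∃ ω, (∀ i ∈ ω, i ∈ I) ∧ cs.wordProd ω = w by
    obtain ⟨ω, h, rfl⟩ := this
    exact cs.exists_isReduced_forall_mem ω h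
  induction hw using Subgroup.closure_induction with
  | mem x hx =>
    obtain ⟨i, hi, rfl⟩ := hx
    exact ⟨[i], by simpa using hi, by simp⟩
  | one => exact ⟨[], by simp, by simp⟩
  | mul x y _ _ hx hy =>
    obtain ⟨ω, h, rfl⟩ := hx
    obtain ⟨ν, h', rfl⟩ := hy
    refine ⟨ω ++ ν, fun i hi => ?_, by rw [wordProd_append]⟩
    rcases List.mem_append.1 hi with hi | hi
    exacts [h i hi, h' i hi]
  | inv x _ hx =>
    obtain ⟨ω, h, rfl⟩ := hx
    exact ⟨ω.reverse, by simpa using h, by simp⟩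

/-- `x` has no right descent in `I`. -/
def IsRightMin (I : Set B) (x : W) : Prop := ∀ i ∈ I, cs.length (x * cs.simple i) = cs.length x + 1

/-- `x` has no left descent in `I`. -/
def IsLeftMin (I : Set B) (x : W) : Prop := ∀ i ∈ I, cs.length (cs.simple i * x) = cs.length x + 1

variable {cs}

theorem isRightMin_inv {x : W} : IsRightMin cs I x⁻¹ ↔ IsLeftMin cs I x := by
  refine forall₂_congr fun i _ => ?_
  rw [← cs.length_inv (x⁻¹ * _), cs.length_inv x]
  simp

theorem isLeftMin_inv {x : W} : IsLeftMin cs I x⁻¹ ↔ IsRightMin cs I x := by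
  rw [← isRightMin_inv, inv_inv]

theorem isRightMin_one : IsRightMin cs I 1 := fun i _ => by simp

theorem isLeftMin_one : IsLeftMin cs I 1 := fun i _ => by simp

theorem IsRightMin.mono (h : J ⊆ I) {x : W} (hx : IsRightMin cs I x) : IsRightMin cs J x :=
  fun i hi => hx i (h hi)

/-- A shortest element of a coset `x W_I` has lengths that add up with those of `W_I`. -/
theorem length_mul_of_forall_le {x : W}
    (hx : ∀ y ∈ standardParabolic cs I, cs.length x ≤ cs.length (x * y))
    {y : W} (hy : y ∈ standardParabolic cs I) :
    cs.length (x * y) = cs.length x + cs.length y := by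
  obtain ⟨ω, hω, hI, rfl⟩ := exists_isReduced_of_mem_standardParabolic cs hy
  clear hy
  induction ω using List.reverseRecOn with
  | nil => simp
  | append_singleton ω i ih =>
    have hω' := hω.append_left
    have hI' : ∀ j ∈ ω, j ∈ I := fun j hj => hI j (by simp [hj])
    have ih := ih hω' hI'
    rw [hω'.eq] at ih
    rw [hω.eq, wordProd_append, wordProd_singleton, ← mul_assoc, List.length_append,
      List.length_singleton, ← add_assoc, ← ih]
    rcases cs.length_mul_simple (x * cs.wordProd ω) i with h | h
    · exact h
    exfalso
    obtain ⟨ν, hν, rfl⟩ := cs.exists_isReduced x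
    rw [← wordProd_append] at h
    obtain ⟨k, hk, hk'⟩ := cs.exchange_right (ω := ν ++ ω) (i := i) (by omega)
    -- A deletion in the word of $x$ gives an element of $xW_I$ shorter than $x$; a deletion in
    -- $\omega$ contradicts that $\omega$ followed by $i$ is reduced.
    by_cases hkν : k < ν.length
    · rw [List.eraseIdx_append_of_lt_length hkν, wordProd_append, wordProd_append] at hk'
      have hmem : cs.wordProd ω * cs.simple i * (cs.wordProd ω)⁻¹ ∈ standardParabolic cs I := by
        have h1 := wordProd_mem_standardParabolic cs hI'
        exact mul_mem (mul_mem h1 (simple_mem_standardParabolic cs (hI i (by simp)))) (inv_mem h1)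
      have := hx _ hmem
      rw [← mul_assoc, ← mul_assoc, hk', mul_inv_cancel_right, hν.eq] at this
      have h2 := cs.length_wordProd_le (ν.eraseIdx k)
      have h3 := List.length_eraseIdx_add_one hkν
      omega
    · push Not at hkν
      rw [List.length_append] at hk
      rw [List.eraseIdx_append_of_length_le hkν, wordProd_append, wordProd_append, mul_assoc,
        mul_right_inj] at hk'
      have h1 := hω.eq
      rw [wordProd_append, wordProd_singleton, hk', List.length_append] at h1
      have h2 := cs.length_wordProd_le (ω.eraseIdx (k - ν.length))
      have h3 := List.length_eraseIdx_le ω (k - ν.length)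
      simp only [List.length_singleton] at h1
      omega

theorem exists_mul_forall_le (I : Set B) (w : W) :
    ∃ x y : W, (∀ z ∈ standardParabolic cs I, cs.length x ≤ cs.length (x * z)) ∧
      y ∈ standardParabolic cs I ∧ w = x * y := by
  let s : Set ℕ := {n | ∃ y ∈ standardParabolic cs I, cs.length (w * y) = n}
  obtain ⟨y, hy, h⟩ := Nat.sInf_mem (s := s) ⟨_, 1, one_mem _, rfl⟩
  refine ⟨w * y, y⁻¹, fun z hz => ?_, inv_mem hy, by simp⟩
  rw [h, mul_assoc]
  exact Nat.sInf_le ⟨_, mul_mem hy hz, rfl⟩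

theorem isRightMin_of_forall_le {x : W}
    (hx : ∀ y ∈ standardParabolic cs I, cs.length x ≤ cs.length (x * y)) : IsRightMin cs I x :=
  fun i hi => by
    rw [length_mul_of_forall_le hx (simple_mem_standardParabolic cs hi), length_simple]

theorem exists_rightDescent_of_mem_standardParabolic {y : W} (hy : y ∈ standardParabolic cs I)
    (h : y ≠ 1) : ∃ i ∈ I, cs.length (y * cs.simple i) + 1 = cs.length y := by
  obtain ⟨ω, hω, hI, rfl⟩ := exists_isReduced_of_mem_standardParabolic cs hy
  induction ω using List.reverseRecOn with
  | nil => simp at h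
  | append_singleton ω i _ =>
    refine ⟨i, hI i (by simp), ?_⟩
    rw [hω.eq, wordProd_append]
    simp [hω.append_left.eq]

/-- Local minimality is global: if $x=x'y$ with $x'$ shortest in the coset and $1\ne y\in W_I$, then
a right descent of $y$ is one of $x$. -/
theorem IsRightMin.forall_le {x : W} (hx : IsRightMin cs I x) :
    ∀ y ∈ standardParabolic cs I, cs.length x ≤ cs.length (x * y) := by
  obtain ⟨x', y, hx', hy, rfl⟩ := exists_mul_forall_le (cs := cs) I x
  by_cases h : y = 1
  · simpa [h] using hx'
  exfalso
  obtain ⟨i, hi, h'⟩ := exists_rightDescent_of_mem_standardParabolic hy h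
  have h1 := hx i hi
  rw [mul_assoc, length_mul_of_forall_le hx' hy,
    length_mul_of_forall_le hx' (mul_mem hy (simple_mem_standardParabolic cs hi))] at h1
  omega

theorem IsRightMin.length_mul {x y : W} (hx : IsRightMin cs I x)
    (hy : y ∈ standardParabolic cs I) : cs.length (x * y) = cs.length x + cs.length y :=
  length_mul_of_forall_le hx.forall_le hy

theorem IsLeftMin.length_mul {x y : W} (hx : IsLeftMin cs I x)
    (hy : y ∈ standardParabolic cs I) : cs.length (y * x) = cs.length y + cs.length x := by
  have := (isRightMin_inv.2 hx).length_mul (inv_mem hy)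
  rw [← mul_inv_rev, cs.length_inv, cs.length_inv, cs.length_inv] at this
  omega

variable (cs) in
theorem exists_isRightMin_mul (I : Set B) (w : W) :
    ∃ x y : W, IsRightMin cs I x ∧ y ∈ standardParabolic cs I ∧ w = x * y := by
  obtain ⟨x, y, hx, hy, h⟩ := exists_mul_forall_le (cs := cs) I w
  exact ⟨x, y, isRightMin_of_forall_le hx, hy, h⟩

variable (cs) in
theorem exists_mul_isLeftMin (I : Set B) (w : W) :
    ∃ x y : W, IsLeftMin cs I x ∧ y ∈ standardParabolic cs I ∧ w = y * x := by
  obtain ⟨x, y, hx, hy, h⟩ := exists_isRightMin_mul cs I w⁻¹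
  exact ⟨x⁻¹, y⁻¹, isLeftMin_inv.2 hx, inv_mem hy, by rw [← mul_inv_rev, ← h, inv_inv]⟩

theorem IsRightMin.eq_one {y : W} (h : IsRightMin cs I y) (hy : y ∈ standardParabolic cs I) :
    y = 1 := by
  by_contra h'
  obtain ⟨i, hi, h1⟩ := exists_rightDescent_of_mem_standardParabolic hy h'
  have := h i hi
  omega

/-- If `x`, `x'` in the same coset have no right descent in `I`, they are equal. -/
theorem IsRightMin.eq_of_mul_mem {x x' : W} (h : IsRightMin cs I x) (h' : IsRightMin cs I x')
    (hm : x⁻¹ * x' ∈ standardParabolic cs I) : x = x' := by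
  have h1 := h.length_mul hm
  have h2 := h'.length_mul (inv_mem hm)
  rw [cs.length_inv] at h2
  simp only [mul_inv_rev, inv_inv, mul_inv_cancel_left] at h1 h2
  have : x⁻¹ * x' = 1 := cs.length_eq_zero_iff.1 (by omega)
  exact (inv_mul_eq_one.1 this)

theorem IsLeftMin.eq_of_mul_mem {x x' : W} (h : IsLeftMin cs I x) (h' : IsLeftMin cs I x')
    (hm : x' * x⁻¹ ∈ standardParabolic cs I) : x = x' := by
  rw [← inv_inj]
  refine (isRightMin_inv.2 h).eq_of_mul_mem (isRightMin_inv.2 h') ?_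
  simpa using inv_mem hm

/-- Deodhar's lemma. -/
theorem IsRightMin.simple_mul {x : W} (hx : IsRightMin cs I x) (i : B) :
    IsRightMin cs I (cs.simple i * x) ∨ ∃ t ∈ I, cs.simple i * x = x * cs.simple t := by
  by_contra! h
  obtain ⟨h1, h2⟩ := h
  simp only [IsRightMin, not_forall] at h1
  obtain ⟨t, ht, h1⟩ := h1
  -- Here $t$ lengthens $x$ and shortens $sx$. As each multiplication changes the length by one,
  -- only $\ell(sx)=\ell(xt)$ and $\ell(sxt)=\ell(x)$ remain possible.
  refine h2 t ht (cs.simple_mul_eq_mul_simple ?_ ?_)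
  all_goals
    have h3 := hx t ht
    have h4 := cs.length_mul_simple (cs.simple i * x) t
    have h5 := cs.length_simple_mul x i
    have h6 := cs.length_simple_mul (x * cs.simple t) i
    rw [← mul_assoc] at h6
    omega

theorem IsLeftMin.mul_simple {x : W} (hx : IsLeftMin cs I x) (i : B) :
    IsLeftMin cs I (x * cs.simple i) ∨ ∃ t ∈ I, x * cs.simple i = cs.simple t * x := by
  rcases (isRightMin_inv.2 hx).simple_mul i with h | ⟨t, ht, h⟩
  · left
    rw [← isRightMin_inv]
    simpa using h
  · right
    refine ⟨t, ht, ?_⟩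
    have := congrArg (·⁻¹) h
    simpa using this

/-- The letters of $a$ are put in front of $w$ one by one: by Deodhar's lemma each either keeps the
representative minimal or passes through it and becomes a letter of $J$. -/
theorem exists_mul_isRightMin_mul {w : W} (hr : IsRightMin cs J w) {a : W}
    (ha : a ∈ standardParabolic cs I) :
    ∃ a' ∈ standardParabolic cs I, ∃ b' ∈ standardParabolic cs J,
      IsRightMin cs J (a' * w) ∧ a * w = a' * w * b' := by
  obtain ⟨ω, -, hI, rfl⟩ := exists_isReduced_of_mem_standardParabolic cs ha
  clear ha
  induction ω with
  | nil => exact ⟨1, one_mem _, 1, one_mem _, by simpa using hr, by simp⟩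
  | cons i ω ih =>
    obtain ⟨a, ha, b, hb, h1, h2⟩ := ih fun j hj => hI j (List.mem_cons_of_mem _ hj)
    have hi := simple_mem_standardParabolic cs (hI i List.mem_cons_self)
    rw [wordProd_cons, mul_assoc, h2]
    rcases h1.simple_mul i with h | ⟨t, ht, h⟩
    · exact ⟨cs.simple i * a, mul_mem hi ha, b, hb, by simpa [mul_assoc] using h,
        by simp [mul_assoc]⟩
    · refine ⟨a, ha, cs.simple t * b, mul_mem (simple_mem_standardParabolic cs ht) hb, h1, ?_⟩
      rw [← mul_assoc, h, mul_assoc, mul_assoc]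

/-- Elements of a double coset `W_I w W_J` with `w` without left descents in `I` and right descents
in `J` have a decomposition `a w b` such that the lengths add up. -/
theorem exists_double_decomposition {w : W} (hl : IsLeftMin cs I w) (hr : IsRightMin cs J w)
    {a b : W} (ha : a ∈ standardParabolic cs I) (hb : b ∈ standardParabolic cs J) :
    ∃ a' ∈ standardParabolic cs I, ∃ b' ∈ standardParabolic cs J,
      a * w * b = a' * w * b' ∧
        cs.length (a' * w * b') = cs.length a' + cs.length w + cs.length b' := by
  obtain ⟨a', ha', c, hc, h1, h2⟩ := exists_mul_isRightMin_mul hr ha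
  refine ⟨a', ha', c * b, mul_mem hc hb, by rw [h2]; simp [mul_assoc], ?_⟩
  rw [h1.length_mul (mul_mem hc hb), hl.length_mul ha']

theorem IsDoubleReduced.isLeftMin {w : W} (h : IsDoubleReduced cs I J w) : IsLeftMin cs I w := by
  intro i hi
  have := h _ (simple_mem_standardParabolic cs hi) 1 (one_mem _)
  have h2 := cs.length_simple_mul w i
  rw [mul_one] at this
  omega

theorem IsDoubleReduced.isRightMin {w : W} (h : IsDoubleReduced cs I J w) : IsRightMin cs J w := by
  intro i hi
  have := h 1 (one_mem _) _ (simple_mem_standardParabolic cs hi)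
  have h2 := cs.length_mul_simple w i
  rw [one_mul] at this
  omega

variable (cs) in
theorem exists_isDoubleReduced (I J : Set B) (u : W) :
    ∃ a ∈ standardParabolic cs I, ∃ w, IsDoubleReduced cs I J w ∧
      ∃ b ∈ standardParabolic cs J, u = a * w * b ∧
        cs.length u = cs.length a + cs.length w + cs.length b := by
  let s : Set ℕ := {n | ∃ a ∈ standardParabolic cs I, ∃ b ∈ standardParabolic cs J,
    cs.length (a * u * b) = n}
  obtain ⟨a, ha, b, hb, h⟩ := Nat.sInf_mem (s := s) ⟨_, 1, one_mem _, 1, one_mem _, rfl⟩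
  have hw : IsDoubleReduced cs I J (a * u * b) := fun a' ha' b' hb' => by
    rw [h]
    refine Nat.sInf_le ⟨a' * a, mul_mem ha' ha, b * b', mul_mem hb hb', ?_⟩
    simp [mul_assoc]
  obtain ⟨a', ha', b', hb', h1, h2⟩ := exists_double_decomposition hw.isLeftMin hw.isRightMin
    (inv_mem ha) (inv_mem hb)
  have h3 : u = a' * (a * u * b) * b' := by rw [← h1]; group
  exact ⟨a', ha', _, hw, b', hb', h3, by rw [← h2, ← h3]⟩

end Parabolic

/-! ### The reflection representation and the order of $s_is_j$ -/

namespace CoxeterSystem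

variable {B W : Type*} [Group W] {M : CoxeterMatrix B} (cs : CoxeterSystem M W)

section Geometric

variable (M)

/-- The linear form of the reflection representation attached to a simple reflection. -/
noncomputable def simpleCoroot (i : B) : Module.Dual ℝ (B →₀ ℝ) :=
  -- For $m_{i,j}=\infty$, encoded as `M i j = 0`, division by zero gives $\cos 0=1$, hence the
  -- required coefficient $-2$.
  Finsupp.linearCombination ℝ fun j => -2 * Real.cos (Real.pi / M i j)

theorem simpleCoroot_single (i j : B) :
    simpleCoroot M i (Finsupp.single j 1) = -2 * Real.cos (Real.pi / M i j) := by
  simp [simpleCoroot]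

theorem simpleCoroot_self (i : B) : simpleCoroot M i (Finsupp.single i 1) = 2 := by
  simp [simpleCoroot_single]

/-- The action of a simple reflection in the reflection representation. -/
noncomputable def geometricReflection (i : B) : (B →₀ ℝ) ≃ₗ[ℝ] (B →₀ ℝ) :=
  Module.reflection (simpleCoroot_self M i)

theorem sin_two_pi_div_pos {m : ℕ} (hm : 3 ≤ m) : 0 < Real.sin (2 * Real.pi / m) := by
  have h3 : (3 : ℝ) ≤ m := by exact_mod_cast hm
  have := Real.pi_pos
  refine Real.sin_pos_of_pos_of_lt_pi (by positivity) ?_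
  rw [div_lt_iff₀ (by linarith)]
  nlinarith

theorem eval_S_mul_sin (m : ℕ) (n : ℤ) :
    (Chebyshev.S ℝ n).eval (2 * Real.cos (2 * Real.pi / m)) * Real.sin (2 * Real.pi / m) =
      Real.sin ((n + 1) * (2 * Real.pi / m)) :=
  Chebyshev.S_two_mul_real_cos _ _

theorem simpleCoroot_mul_sub_two (i j : B) :
    simpleCoroot M j (Finsupp.single i 1) * simpleCoroot M i (Finsupp.single j 1) - 2 =
      2 * Real.cos (2 * Real.pi / M i j) := by
  rw [simpleCoroot_single, simpleCoroot_single, M.symmetric j i, mul_div_assoc, Real.cos_two_mul]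
  ring

/-- Powers of a product of two reflections are given by Chebyshev polynomials $S_n$ at
$2\cos\theta$, $\theta=2\pi/m$, where $S_n\sin\theta=\sin((n+1)\theta)$. -/
theorem geometricReflection_pow (i j : B) :
    (geometricReflection M i * geometricReflection M j) ^ M i j = 1 := by
  ext1 z
  by_cases hij : i = j
  · subst hij
    simpa [geometricReflection] using Module.involutive_reflection (simpleCoroot_self M i) z
  have key := Module.reflection_mul_reflection_pow_apply (simpleCoroot_self M i)
    (simpleCoroot_self M j) (M i j) z (2 * Real.cos (2 * Real.pi / M i j))
    (by rw [← simpleCoroot_mul_sub_two, mul_comm])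
  rw [geometricReflection, geometricReflection, key, LinearEquiv.coe_one, id]
  -- For $m\le2$ one has $\sin\theta=0$ and the sine formula says nothing.
  rcases Nat.lt_or_ge (M i j) 3 with hm | hm
  · have hcases : M i j = 0 ∨ M i j = 1 ∨ M i j = 2 := by omega
    rcases hcases with h | h | h
    · simp [h]
    · exact absurd h (M.off_diagonal i j hij)
    · have e1 : (((2 : ℕ) : ℤ) - 1) / 2 = 0 := by norm_num
      have e2 : (((2 : ℕ) : ℤ) - 3) / 2 = -1 := by norm_num
      have e3 : ((2 : ℕ) : ℤ) / 2 = 1 := by norm_num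
      have e4 : (((2 : ℕ) : ℤ) - 2) / 2 = 0 := by norm_num
      simp only [h, simpleCoroot_single, M.symmetric j i, e1, e2, e3, e4]
      simp only [Nat.cast_ofNat, Real.cos_pi_div_two, Chebyshev.S_zero, Chebyshev.S_neg_one,
        Chebyshev.S_one, eval_X, eval_one, eval_zero]
      rw [mul_div_cancel_left₀ _ (two_ne_zero' ℝ), Real.cos_pi]
      module
  · have hs := (sin_two_pi_div_pos hm).ne'
    have hm0 : (M i j : ℝ) ≠ 0 := by
      have : M i j ≠ 0 := by omega
      exact_mod_cast this
    -- If $m=2k$, then $k\theta=\pi$ and $S_{k-1}=0$; if $m=2k+1$, then $(k+1)\theta=2\pi-k\theta$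
    -- and $S_k+S_{k-1}=0$.
    obtain ⟨k, hk | hk⟩ := Nat.even_or_odd' (M i j)
    · have e1 : ((M i j : ℤ) - 2) / 2 = k - 1 := by omega
      have e2 : ((M i j : ℤ) - 1) / 2 = k - 1 := by omega
      have h0 : (Chebyshev.S ℝ (k - 1)).eval (2 * Real.cos (2 * Real.pi / M i j)) = 0 := by
        refine (mul_eq_zero.1 ?_).resolve_right hs
        rw [eval_S_mul_sin]
        have : ((((k : ℤ) - 1 : ℤ) : ℝ) + 1) * (2 * Real.pi / M i j) = Real.pi := by
          have : (M i j : ℝ) = 2 * k := by exact_mod_cast hk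
          rw [this] at hm0 ⊢
          push_cast
          rw [sub_add_cancel, mul_div_mul_left _ _ two_ne_zero,
            mul_div_cancel₀ _ (by simpa using hm0)]
        rw [this, Real.sin_pi]
      rw [e1, e2, h0]
      simp
    · have e1 : ((M i j : ℤ) - 1) / 2 = k := by omega
      have e2 : ((M i j : ℤ) - 3) / 2 = k - 1 := by omega
      have e3 : (M i j : ℤ) / 2 = k := by omega
      have e4 : ((M i j : ℤ) - 2) / 2 = k - 1 := by omega
      have h0 : (Chebyshev.S ℝ k).eval (2 * Real.cos (2 * Real.pi / M i j)) +
          (Chebyshev.S ℝ (k - 1)).eval (2 * Real.cos (2 * Real.pi / M i j)) = 0 := by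
        refine (mul_eq_zero.1 ?_).resolve_right hs
        rw [add_mul, eval_S_mul_sin, eval_S_mul_sin]
        have : (((k : ℤ) : ℝ) + 1) * (2 * Real.pi / M i j) =
            2 * Real.pi - (((k : ℤ) - 1 : ℤ) + 1) * (2 * Real.pi / M i j) := by
          have : (M i j : ℝ) = 2 * k + 1 := by exact_mod_cast hk
          rw [this] at hm0 ⊢
          push_cast
          field_simp
          ring
        rw [this, Real.sin_two_pi_sub]
        ring
      rw [e1, e2, e3, e4, h0]
      simp

end Geometric

/-- The simple root $\alpha_i$ detects the order: were the power trivial, its two coordinates would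
give $S_k+S_{k-1}=1$ and $S_{k-1}\cos(\pi/m)=0$. -/
theorem mul_pow_ne_one {i j : B} (hij : i ≠ j) {k : ℕ} (hk : 0 < k)
    (hkM : M i j = 0 ∨ k < M i j) : (cs.simple i * cs.simple j) ^ k ≠ 1 := by
  intro h
  have hlift : M.IsLiftable (geometricReflection M) := geometricReflection_pow M
  have h1 := congrArg (cs.lift ⟨_, hlift⟩) h
  rw [map_pow, map_mul, lift_apply_simple, lift_apply_simple, map_one] at h1
  have key := Module.reflection_mul_reflection_pow_apply_self (simpleCoroot_self M i)
    (simpleCoroot_self M j) k (2 * Real.cos (2 * Real.pi / M i j))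
    (by rw [← simpleCoroot_mul_sub_two, mul_comm])
  change ((geometricReflection M i * geometricReflection M j) ^ k) _ = _ at key
  rw [h1, simpleCoroot_single, LinearEquiv.coe_one, id] at key
  have ci := congrArg (fun v : B →₀ ℝ => v i) key
  have cj := congrArg (fun v : B →₀ ℝ => v j) key
  simp only [Finsupp.coe_add, Finsupp.coe_smul, Pi.add_apply, Pi.smul_apply, Finsupp.single_eq_same,
    Finsupp.single_eq_of_ne hij, Finsupp.single_eq_of_ne hij.symm, smul_eq_mul, mul_one, mul_zero,
    add_zero, zero_add, zero_eq_mul, neg_eq_zero, simpleCoroot_single, M.symmetric j i] at ci cj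
  rcases hkM with h0 | hkM
  · have hk' : (k : ℝ) ≠ 0 := by exact_mod_cast hk.ne'
    simp [h0, Chebyshev.S_eval_two, hk'] at cj
  rcases Nat.lt_or_ge (M i j) 3 with hm | hm
  · have hm2 : M i j = 2 := by omega
    have hk1 : k = 1 := by omega
    subst hk1
    rw [hm2] at ci
    simp only [Nat.cast_ofNat, Nat.cast_one, sub_self, Chebyshev.S_zero, Chebyshev.S_one, eval_X,
      eval_one] at ci
    rw [mul_div_cancel_left₀ _ (two_ne_zero' ℝ), Real.cos_pi] at ci
    norm_num at ci
  · have hs := sin_two_pi_div_pos hm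
    have hpi := Real.pi_pos
    have h3 : (3 : ℝ) ≤ M i j := by exact_mod_cast hm
    have hkR : (k : ℝ) < M i j := by exact_mod_cast hkM
    have hk0 : (0 : ℝ) < k := by exact_mod_cast hk
    have hc : 0 < Real.cos (Real.pi / M i j) := by
      apply Real.cos_pos_of_mem_Ioo
      constructor
      · have : 0 < Real.pi / M i j := by positivity
        linarith
      · rw [div_lt_div_iff₀ (by linarith) (by norm_num)]
        nlinarith
    have hz := cj.resolve_right (by simp [hc.ne'])
    rw [hz, add_zero] at ci
    have e1 := eval_S_mul_sin (M i j) k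
    have e2 := eval_S_mul_sin (M i j) (k - 1)
    rw [hz, zero_mul] at e2
    rw [← ci, one_mul, add_mul, one_mul, Real.sin_add] at e1
    push_cast at e1 e2
    rw [sub_add_cancel] at e2
    rw [← e2, zero_mul, zero_add] at e1
    -- From $\sin(k\theta)=0$ and $\sin((k+1)\theta)=\sin\theta$; this is absurd since
    -- $0<k\theta<2\pi$.
    have hcos : Real.cos (k * (2 * Real.pi / M i j)) = 1 := by nlinarith
    have hpos : 0 < k * (2 * Real.pi / M i j) := by positivity
    rw [Real.cos_eq_one_iff_of_lt_of_lt (by linarith)] at hcos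
    · linarith
    · rw [← mul_div_assoc, div_lt_iff₀ (by linarith)]
      nlinarith

/-! ### Alternating words and Matsumoto's theorem -/

/-- The word of length `m` that alternates between `i` and `j`, starting with `i`. -/
def altWord : B → B → ℕ → List B
  | _, _, 0 => []
  | i, j, m + 1 => i :: altWord j i m

theorem prod_map_altWord {A : Type*} [Monoid A] (f : B → A) (i j : B) (m : ℕ) :
    ((altWord i j m).map f).prod = RennerCoxeterSystem.altProd (f i) (f j) m := by
  induction m generalizing i j with
  | zero => rfl
  | succ m ih => rw [altWord, List.map_cons, List.prod_cons, ih]; rfl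

theorem length_altWord (i j : B) (m : ℕ) : (altWord i j m).length = m := by
  induction m generalizing i j with
  | zero => rfl
  | succ m ih => rw [altWord, List.length_cons, ih]

theorem exists_altWord_add (i j : B) (m n : ℕ) :
    ∃ ν, altWord i j (m + n) = altWord i j m ++ ν := by
  induction m generalizing i j with
  | zero => exact ⟨_, rfl⟩
  | succ m ih =>
    obtain ⟨ν, h⟩ := ih j i
    exact ⟨ν, by rw [Nat.succ_add, altWord, h]; rfl⟩

/-- Used in both directions: it gives the braid relation, and it turns an equality of alternating
products into a trivial power of $s_is_j$. -/
theorem wordProd_altWord_mul_inv (i j : B) (m : ℕ) :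
    cs.wordProd (altWord i j m) * (cs.wordProd (altWord j i m))⁻¹ =
      (cs.simple i * cs.simple j) ^ m := by
  induction m generalizing i j with
  | zero => simp [altWord]
  | succ m ih =>
    rw [altWord, altWord, wordProd_cons, wordProd_cons, mul_inv_rev, inv_simple, ← mul_assoc,
      mul_assoc (cs.simple i), ih]
    have : ∀ m, cs.simple i * (cs.simple j * cs.simple i) ^ m * cs.simple j =
        (cs.simple i * cs.simple j) ^ (m + 1) := by
      intro m
      induction m with
      | zero => simp
      | succ m ih => rw [pow_succ (cs.simple i * _), ← ih, pow_succ]; simp only [mul_assoc]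
    exact this m

theorem wordProd_altWord_braid (i j : B) :
    cs.wordProd (altWord i j (M i j)) = cs.wordProd (altWord j i (M i j)) := by
  rw [← mul_inv_eq_one, wordProd_altWord_mul_inv, simple_mul_simple_pow]

theorem isReduced_eq_altWord {i j : B} {ω : List B} (h : cs.IsReduced (i :: ω))
    (hI : ∀ k ∈ ω, k ∈ ({i, j} : Set B)) : i :: ω = altWord i j (ω.length + 1) := by
  induction ω generalizing i j with
  | nil => rfl
  | cons k ω ih =>
    have hk : k = j := by
      rcases hI k List.mem_cons_self with rfl | hk
      · exfalso
        have h1 := h.eq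
        rw [wordProd_cons, wordProd_cons, simple_mul_simple_cancel_left] at h1
        have := cs.length_wordProd_le ω
        simp only [List.length_cons] at h1
        omega
      · exact hk
    subst hk
    rw [altWord, List.length_cons,
      ih h.tail fun l hl => Set.pair_comm i k ▸ hI l (List.mem_cons_of_mem _ hl)]

theorem exists_altWord_of_descent {i j : B} {y : W} (hy : y ∈ standardParabolic cs {i, j})
    (h : cs.length (cs.simple i * y) + 1 = cs.length y) :
    y = cs.wordProd (altWord i j (cs.length y)) := by
  obtain ⟨ω, hω, hI, hω'⟩ := exists_isReduced_of_mem_standardParabolic cs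
    (mul_mem (simple_mem_standardParabolic cs (i := i) (by simp)) hy)
  have hp : cs.wordProd (i :: ω) = y := by
    rw [wordProd_cons, hω', simple_mul_simple_cancel_left]
  have hlen : cs.length y = ω.length + 1 := by rw [← h, ← hω', hω.eq]
  rw [hlen, ← isReduced_eq_altWord cs _ hI, hp]
  rw [IsReduced, hp, hlen, List.length_cons]

/-- An element with two left descents has reduced words starting with the two sides of a braid
relation. -/
theorem exists_braid_of_descents {i j : B} (hij : i ≠ j) {w : W}
    (hi : cs.length (cs.simple i * w) + 1 = cs.length w)
    (hj : cs.length (cs.simple j * w) + 1 = cs.length w) :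
    M i j ≠ 0 ∧ ∃ ν, cs.wordProd (altWord i j (M i j) ++ ν) = w ∧
      cs.IsReduced (altWord i j (M i j) ++ ν) := by
  obtain ⟨x, y, hx, hy, rfl⟩ := exists_mul_isLeftMin cs {i, j} w
  have hlen : ∀ k ∈ ({i, j} : Set B), cs.length (cs.simple k * (y * x)) + 1 = cs.length (y * x) →
      cs.length (cs.simple k * y) + 1 = cs.length y := by
    intro k hk h
    rw [← mul_assoc, hx.length_mul hy, hx.length_mul
      (mul_mem (simple_mem_standardParabolic cs hk) hy)] at h
    omega
  have hi' := hlen i (by simp) hi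
  have h1 := cs.exists_altWord_of_descent hy hi'
  have h2 := cs.exists_altWord_of_descent (Set.pair_comm i j ▸ hy) (hlen j (by simp) hj)
  -- $y$ is the alternating product of length $\ell(y)$ starting with either letter, so the order of
  -- $s_is_j$ forces $m_{i,j}\le\ell(y)$.
  have h3 : (cs.simple i * cs.simple j) ^ cs.length y = 1 := by
    rw [← wordProd_altWord_mul_inv, ← h1, ← h2, mul_inv_cancel]
  have h4 : M i j ≠ 0 ∧ M i j ≤ cs.length y := by
    by_contra h
    exact cs.mul_pow_ne_one hij (by omega) (by omega) h3
  refine ⟨h4.1, ?_⟩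
  obtain ⟨n, hn⟩ := Nat.exists_eq_add_of_le h4.2
  obtain ⟨ν, hν⟩ := exists_altWord_add i j (M i j) n
  obtain ⟨ξ, hξ, rfl⟩ := cs.exists_isReduced x
  have hp : cs.wordProd (altWord i j (M i j) ++ (ν ++ ξ)) = y * cs.wordProd ξ := by
    rw [← List.append_assoc, ← hν, ← hn, wordProd_append, ← h1]
  refine ⟨ν ++ ξ, hp, ?_⟩
  rw [IsReduced, hp, hx.length_mul hy, hξ.eq, ← List.append_assoc, ← hν, ← hn, List.length_append,
    length_altWord]

/-- Matsumoto's theorem: a map to a monoid that satisfies the braid relations has the same product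
along all reduced words of an element. -/
theorem prod_map_eq_of_isReduced {A : Type*} [Monoid A] {f : B → A}
    (hf : ∀ i j, i ≠ j → M i j ≠ 0 → RennerCoxeterSystem.altProd (f i) (f j) (M i j) =
      RennerCoxeterSystem.altProd (f j) (f i) (M i j))
    {ω ω' : List B} (hω : cs.IsReduced ω) (hω' : cs.IsReduced ω')
    (h : cs.wordProd ω = cs.wordProd ω') : (ω.map f).prod = (ω'.map f).prod := by
  induction hn : ω.length generalizing ω ω' with
  | zero =>
    have : ω'.length = 0 := by rw [← hω'.eq, ← h, hω.eq, hn]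
    rw [List.eq_nil_of_length_eq_zero hn, List.eq_nil_of_length_eq_zero this]
  | succ n ih =>
    have hn' : ω'.length = n + 1 := by rw [← hω'.eq, ← h, hω.eq, hn]
    obtain ⟨i, ω, rfl⟩ := List.exists_cons_of_length_eq_add_one hn
    obtain ⟨j, ω', rfl⟩ := List.exists_cons_of_length_eq_add_one hn'
    have same : ∀ {i : B} {ω ω' : List B}, cs.IsReduced (i :: ω) → cs.IsReduced (i :: ω') →
        cs.wordProd (i :: ω) = cs.wordProd (i :: ω') → (i :: ω).length = n + 1 →
        ((i :: ω).map f).prod = ((i :: ω').map f).prod := by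
      intro i ω ω' h1 h2 h3 h4
      rw [wordProd_cons, wordProd_cons, mul_right_inj] at h3
      simp only [List.map_cons, List.prod_cons]
      rw [ih h1.tail h2.tail h3 (by simpa using h4)]
    by_cases hij : i = j
    · subst hij
      exact same hω hω' h hn
    · have hd : ∀ {i : B} {ω : List B}, cs.IsReduced (i :: ω) →
          cs.length (cs.simple i * cs.wordProd (i :: ω)) + 1 = cs.length (cs.wordProd (i :: ω)) := by
        intro i ω h
        rw [h.eq, wordProd_cons, simple_mul_simple_cancel_left, h.tail.eq, List.length_cons]
      -- The two words are joined through the sides of a braid relation followed by a common $\nu$;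
      -- the outer comparisons then share their first letter, so induction applies.
      obtain ⟨hM, ν, hν, hν'⟩ := cs.exists_braid_of_descents hij (hd hω) (h ▸ hd hω')
      have hp : cs.wordProd (altWord j i (M i j) ++ ν) = cs.wordProd (j :: ω') := by
        rw [← h, ← hν, wordProd_append, wordProd_append, wordProd_altWord_braid]
      have hred : cs.IsReduced (altWord j i (M i j) ++ ν) := by
        rw [IsReduced, hp, hω'.eq, hn', ← hn, ← hω.eq, ← hν, hν'.eq]
        simp [length_altWord]
      obtain ⟨m, hm⟩ := Nat.exists_eq_succ_of_ne_zero hM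
      have e1 : (altWord i j (M i j) ++ ν).length = n + 1 := by rw [← hν'.eq, hν, hω.eq, hn]
      have step : ((altWord i j (M i j) ++ ν).map f).prod =
          ((altWord j i (M i j) ++ ν).map f).prod := by
        rw [List.map_append, List.map_append, List.prod_append, List.prod_append, prod_map_altWord,
          prod_map_altWord, hf i j hij hM]
      have e2 : ∀ a b, altWord a b (M i j) ++ ν = a :: (altWord b a m ++ ν) := fun a b => by
        rw [hm]; rfl
      rw [e2] at hν hν' hp hred
      rw [e2, e2] at step
      rw [same hω hν' hν.symm hn, step]
      refine same hred hω' hp ?_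
      rw [← hn', ← hω'.eq, ← hp, hred.eq]

end CoxeterSystem

/-! ### Factors of elements of a parabolic subgroup -/

section Parabolic

variable {B W : Type*} [Group W] {M : CoxeterMatrix B} (cs : CoxeterSystem M W) {I J : Set B}

theorem standardParabolic_mono (h : I ⊆ J) : standardParabolic cs I ≤ standardParabolic cs J :=
  Subgroup.closure_mono (Set.image_mono h)

/-- The first letter is a left descent, so exchange in a word on $I$ writes it as a quotient of two
products on $I$; then pass to the tail. -/
theorem simple_mem_of_isReduced {ω : List B} (hω : cs.IsReduced ω)
    (h : cs.wordProd ω ∈ standardParabolic cs I) :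
    ∀ i ∈ ω, cs.simple i ∈ standardParabolic cs I := by
  induction ω with
  | nil => simp
  | cons i ω ih =>
    have hi : cs.simple i ∈ standardParabolic cs I := by
      obtain ⟨ν, -, hI, hν'⟩ := exists_isReduced_of_mem_standardParabolic cs h
      obtain ⟨k, hk, hk'⟩ := cs.exchange_left (ω := ν) (i := i) (by
        rw [hν', hω.eq, wordProd_cons, simple_mul_simple_cancel_left, hω.tail.eq]
        simp)
      rw [eq_mul_inv_of_mul_eq hk']
      exact mul_mem (wordProd_mem_standardParabolic cs fun j hj =>
        hI j (List.mem_of_mem_eraseIdx hj)) (inv_mem (wordProd_mem_standardParabolic cs hI))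
    intro j hj
    rcases List.mem_cons.1 hj with rfl | hj
    · exact hi
    · refine ih hω.tail ?_ j hj
      simpa [wordProd_cons] using mul_mem hi h

/-- Factors of an element of `W_I` with additive lengths lie in `W_I`. -/
theorem mem_standardParabolic_of_length_add {x y : W} (h : x * y ∈ standardParabolic cs I)
    (hl : cs.length (x * y) = cs.length x + cs.length y) :
    x ∈ standardParabolic cs I ∧ y ∈ standardParabolic cs I := by
  obtain ⟨ω, hω, rfl⟩ := cs.exists_isReduced x
  obtain ⟨ν, hν, rfl⟩ := cs.exists_isReduced y
  have key := simple_mem_of_isReduced cs (hω.append hν hl) (by rwa [wordProd_append])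
  constructor <;>
  · refine Subgroup.list_prod_mem _ fun x hx => ?_
    obtain ⟨i, hi, rfl⟩ := List.mem_map.1 hx
    exact key i (by simp [hi])

end Parabolic

/-! ### Idempotents and units of a factorisable monoid -/

section Monoid

variable {R : Type*} [Monoid R]

theorem IsIdempotentElem.units_conj {e : R} (he : IsIdempotentElem e) (u : Rˣ) :
    IsIdempotentElem ((u : R) * e * ((u⁻¹ : Rˣ) : R)) := by
  rw [IsIdempotentElem]
  simp only [mul_assoc, Units.inv_mul_cancel_left]
  rw [← mul_assoc e, he.eq]

/-- $e\in fR$ gives $fe=e$, and symmetrically $ef=f$; now $e$ and $f$ commute. -/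
theorem IsFactorisableMonoid.eq_of_mul_unit_eq (hR : IsFactorisableMonoid R) {e f : R}
    (he : IsIdempotentElem e) (hf : IsIdempotentElem f) {u v : Rˣ} (h : e * u = f * v) :
    e = f := by
  have h1 : f * e = e := by
    have : e = f * (v * ((u⁻¹ : Rˣ) : R)) := by
      rw [← mul_assoc, ← h, mul_assoc, Units.mul_inv, mul_one]
    rw [this, ← mul_assoc, hf.eq]
  have h2 : e * f = f := by
    have : f = e * (u * ((v⁻¹ : Rˣ) : R)) := by
      rw [← mul_assoc, h, mul_assoc, Units.mul_inv, mul_one]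
    rw [this, ← mul_assoc, he.eq]
  rw [← h1, ← hR.idempotents_commute e f he hf, h2]

theorem IsFactorisableMonoid.isIdempotentElem_mul (hR : IsFactorisableMonoid R) {e f : R}
    (he : IsIdempotentElem e) (hf : IsIdempotentElem f) : IsIdempotentElem (e * f) := by
  rw [IsIdempotentElem, mul_assoc, ← mul_assoc f, hR.idempotents_commute f e hf he, mul_assoc e f,
    hf.eq, ← mul_assoc, he.eq]

/-- The idempotents $e$ and $u^{-1}eu$ commute; together with $eu=e$ this reads $u^{-1}e=e$. -/
theorem IsFactorisableMonoid.mem_unitStabilizer (hR : IsFactorisableMonoid R) {e : R}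
    (he : IsIdempotentElem e) {u : Rˣ} (h : e * u = e) : u ∈ unitStabilizer e := by
  refine ⟨?_, h⟩
  have h1 : (u : R) * e * ((u⁻¹ : Rˣ) : R) = e :=
    hR.eq_of_mul_unit_eq (u := u) (v := u) (he.units_conj u) he (by
      have h3 : e * ((u⁻¹ : Rˣ) : R) = e := by
        nth_rewrite 1 [← h]; rw [mul_assoc, Units.mul_inv, mul_one]
      have h2 : ((u⁻¹ : Rˣ) : R) * e * u * e = ((u⁻¹ : Rˣ) : R) * e := by
        rw [mul_assoc (((u⁻¹ : Rˣ) : R)), h, mul_assoc, he.eq]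
      have h4 := hR.idempotents_commute _ e (by simpa using he.units_conj u⁻¹) he
      rw [h2, mul_assoc _ e, h, ← mul_assoc, h3, he.eq] at h4
      rw [mul_assoc, Units.inv_mul, mul_one, h, ← Units.eq_inv_mul_iff_mul_eq, h4])
  have h3 : e * ((u⁻¹ : Rˣ) : R) = e := by
    nth_rewrite 1 [← h]; rw [mul_assoc, Units.mul_inv, mul_one]
  rwa [mul_assoc, h3] at h1

theorem mem_unitCentralizer_iff {e : R} {u : Rˣ} :
    u ∈ unitCentralizer e ↔ (u : R) * e = e * u := Iff.rfl

theorem mem_unitCentralizer_of_conj {e : R} {u : Rˣ}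
    (h : (u : R) * e * ((u⁻¹ : Rˣ) : R) = e) : u ∈ unitCentralizer e := by
  rwa [Units.mul_inv_eq_iff_eq_mul] at h

theorem unitStabilizer_le_unitCentralizer (e : R) : unitStabilizer e ≤ unitCentralizer e :=
  fun _ h => h.1.trans h.2.symm

end Monoid

/-! ### The structure of $W(e)$ and the element $e\wedge_wf$ -/

namespace RennerCoxeterSystem

variable {B R : Type*} [Monoid R] {M : CoxeterMatrix B} (𝓡 : RennerCoxeterSystem M R)
variable {e f g : R}

theorem unitCentralizer_eq (he : e ∈ 𝓡.Λ) :
    unitCentralizer e = standardParabolic 𝓡.cs (typeMap 𝓡.cs e) := by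
  obtain ⟨I, hI⟩ := 𝓡.centralizer_parabolic e he
  apply le_antisymm
  · rw [hI]
    refine standardParabolic_mono _ fun i hi => ?_
    change 𝓡.cs.simple i ∈ unitCentralizer e
    rw [hI]
    exact simple_mem_standardParabolic _ hi
  · refine (Subgroup.closure_le _).2 ?_
    rintro _ ⟨i, hi, rfl⟩
    exact hi

theorem unitStabilizer_eq (he : e ∈ 𝓡.Λ) :
    unitStabilizer e = standardParabolic 𝓡.cs (lowerType 𝓡.cs e) := by
  obtain ⟨I, hI⟩ := 𝓡.stabilizer_parabolic e he
  apply le_antisymm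
  · rw [hI]
    refine standardParabolic_mono _ fun i hi => ?_
    change 𝓡.cs.simple i ∈ unitStabilizer e
    rw [hI]
    exact simple_mem_standardParabolic _ hi
  · refine (Subgroup.closure_le _).2 ?_
    rintro _ ⟨i, hi, rfl⟩
    exact hi

theorem upperType_subset_typeMap (e : R) : upperType 𝓡.cs e ⊆ typeMap 𝓡.cs e := fun _ h => h.1

theorem lowerType_subset_typeMap (e : R) : lowerType 𝓡.cs e ⊆ typeMap 𝓡.cs e :=
  fun _ h => h.1.trans h.2.symm

theorem mem_upperType_or_mem_lowerType {i : B} (h : i ∈ typeMap 𝓡.cs e) :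
    i ∈ upperType 𝓡.cs e ∨ i ∈ lowerType 𝓡.cs e := by
  by_cases h' : e * (𝓡.cs.simple i : R) = e
  · exact Or.inr ⟨Eq.trans h h', h'⟩
  · exact Or.inl ⟨h, h'⟩

theorem simple_notMem_of_mem_upperType {j : B} (hj : j ∈ upperType 𝓡.cs e) :
    𝓡.cs.simple j ∉ unitStabilizer e := fun h => hj.2 h.2

theorem isLeftMin_of_mem_upperType {j : B} (hj : j ∈ upperType 𝓡.cs e) :
    IsLeftMin 𝓡.cs (lowerType 𝓡.cs e) (𝓡.cs.simple j) := by
  intro k hk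
  rcases 𝓡.cs.length_simple_mul (𝓡.cs.simple j) k with h | h
  · exact h
  · rw [length_simple, Nat.add_eq_right, length_eq_zero_iff, mul_eq_one_iff_eq_inv,
      inv_simple] at h
    exact absurd (h ▸ hk) (𝓡.simple_notMem_of_mem_upperType hj)

/-- The simple reflections in `λ_⋆(e)` commute with those in `λ^⋆(e)`. -/
theorem simple_commute (he : e ∈ 𝓡.Λ) {i j : B} (hi : i ∈ lowerType 𝓡.cs e)
    (hj : j ∈ upperType 𝓡.cs e) : Commute (𝓡.cs.simple i) (𝓡.cs.simple j) := by
  set s := 𝓡.cs.simple with hs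
  have hy : s j * s i * s j ∈ unitStabilizer e := by
    have h1 : (s j : R) * e = e * s j := hj.1
    have h2 : (s i : R) * e = e := hi.1
    have h3 : e * (s i : R) = e := hi.2
    have h4 : (s j : R) * s j = 1 := by rw [← Units.val_mul, hs, simple_mul_simple_self]; rfl
    constructor
    · rw [Units.val_mul, Units.val_mul, mul_assoc, h1, ← mul_assoc, mul_assoc (s j : R), h2, h1,
        mul_assoc, h4, mul_one]
    · rw [Units.val_mul, Units.val_mul, ← mul_assoc, ← mul_assoc, ← h1, mul_assoc (s j : R), h3,
        h1, mul_assoc, h4, mul_one]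
  have hne : s j * s i * s j ≠ 1 := by
    intro h
    rw [mul_eq_one_iff_eq_inv, hs, inv_simple, mul_eq_left] at h
    have := 𝓡.cs.length_simple i
    rw [h, length_one] at this
    omega
  rw [𝓡.unitStabilizer_eq he] at hy
  have hmin := 𝓡.isLeftMin_of_mem_upperType hj
  have hmin' : IsRightMin 𝓡.cs (lowerType 𝓡.cs e) (s j) := by
    rw [hs, ← inv_simple, isRightMin_inv]; exact hmin
  -- $s_j$ is minimal modulo $W_\star(e)$, so $s_js_is_j\in W_\star(e)$ has length
  -- $\ell(s_is_j)-1=1$. Exchange makes it $s_j$ or $s_i$, and $s_j\notin W_\star(e)$.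
  have h1 := hmin'.length_mul hy
  have h2 := hmin i hi
  have h3 : s j * (s j * s i * s j) = s i * s j := by simp [hs, mul_assoc]
  rw [h3, h2, length_simple] at h1
  obtain ⟨k, hk⟩ := 𝓡.cs.length_eq_one_iff.1 (show 𝓡.cs.length (s j * s i * s j) = 1 by omega)
  rw [hk] at hy h3
  have hp : 𝓡.cs.wordProd [i, j] = s i * s j := by simp [wordProd_cons, hs]
  obtain ⟨m, hm, hm'⟩ := 𝓡.cs.exchange_left (ω := [i, j]) (i := j) (by
    rw [hp, ← hs, ← mul_assoc, hk, h2, length_simple, length_simple]; omega)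
  rw [hp, ← hs, ← mul_assoc, hk] at hm'
  have hm2 : m = 0 ∨ m = 1 := by simp at hm; omega
  rcases hm2 with rfl | rfl
  · simp only [List.eraseIdx_cons_zero, wordProd_singleton] at hm'
    rw [hm', ← 𝓡.unitStabilizer_eq he] at hy
    exact absurd hy (𝓡.simple_notMem_of_mem_upperType hj)
  · simp only [List.eraseIdx_cons_succ, List.eraseIdx_cons_zero, wordProd_singleton] at hm'
    rw [hm'] at h3
    exact h3.symm

theorem commute_of_mem (he : e ∈ 𝓡.Λ) {x y : Rˣ}
    (hx : x ∈ standardParabolic 𝓡.cs (lowerType 𝓡.cs e))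
    (hy : y ∈ standardParabolic 𝓡.cs (upperType 𝓡.cs e)) : Commute x y := by
  induction hx using Subgroup.closure_induction with
  | mem x hx =>
    obtain ⟨i, hi, rfl⟩ := hx
    induction hy using Subgroup.closure_induction with
    | mem y hy =>
      obtain ⟨j, hj, rfl⟩ := hy
      exact 𝓡.simple_commute he hi hj
    | one => exact Commute.one_right _
    | mul _ _ _ _ h1 h2 => exact h1.mul_right h2
    | inv _ _ h => exact h.inv_right
  | one => exact Commute.one_left _
  | mul _ _ _ _ h1 h2 => exact h1.mul_left h2
  | inv _ _ h => exact h.inv_left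

/-- Every generator of $W(e)$ lies in one of two commuting subgroups, so products can be sorted. -/
theorem exists_mul_of_mem_unitCentralizer (he : e ∈ 𝓡.Λ) {c : Rˣ} (hc : c ∈ unitCentralizer e) :
    ∃ x ∈ standardParabolic 𝓡.cs (lowerType 𝓡.cs e),
      ∃ y ∈ standardParabolic 𝓡.cs (upperType 𝓡.cs e), c = x * y := by
  rw [𝓡.unitCentralizer_eq he] at hc
  induction hc using Subgroup.closure_induction with
  | mem _ h =>
    obtain ⟨i, hi, rfl⟩ := h
    rcases 𝓡.mem_upperType_or_mem_lowerType hi with hi | hi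
    · exact ⟨1, one_mem _, _, simple_mem_standardParabolic _ hi, by simp⟩
    · exact ⟨_, simple_mem_standardParabolic _ hi, 1, one_mem _, by simp⟩
  | one => exact ⟨1, one_mem _, 1, one_mem _, by simp⟩
  | mul _ _ _ _ h1 h2 =>
    obtain ⟨x, hx, y, hy, rfl⟩ := h1
    obtain ⟨x', hx', y', hy', rfl⟩ := h2
    refine ⟨x * x', MulMemClass.mul_mem hx hx', y * y', MulMemClass.mul_mem hy hy', ?_⟩
    have := (𝓡.commute_of_mem he hx' hy).eq
    simp only [mul_assoc]
    rw [← mul_assoc y, ← this, mul_assoc]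
  | inv _ _ h =>
    obtain ⟨x, hx, y, hy, rfl⟩ := h
    refine ⟨x⁻¹, inv_mem hx, y⁻¹, inv_mem hy, ?_⟩
    rw [← mul_inv_rev, ((𝓡.commute_of_mem he hx hy)).eq]

theorem eq_of_conj (he : e ∈ 𝓡.Λ) (hf : f ∈ 𝓡.Λ) {u v : Rˣ}
    (h : (u : R) * e * ((u⁻¹ : Rˣ) : R) = (v : R) * f * ((v⁻¹ : Rˣ) : R)) : e = f :=
  (𝓡.transversal _ ((𝓡.isIdempotentElem e he).units_conj u)).unique ⟨he, u, rfl⟩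
    ⟨hf, v, h.symm⟩

theorem one_mem_Λ : (1 : R) ∈ 𝓡.Λ := by
  obtain ⟨f, ⟨hf, w, hw⟩, -⟩ := 𝓡.transversal 1 IsIdempotentElem.one
  rw [Units.mul_inv_eq_iff_eq_mul, one_mul, ← Units.eq_inv_mul_iff_mul_eq, Units.inv_mul] at hw
  exact hw ▸ hf

/-- The element `e ∧_w f` is `e w f`, it lies below `e` and `f`, and it is fixed by `w`. -/
theorem wedge_spec (he : e ∈ 𝓡.Λ) (hf : f ∈ 𝓡.Λ) {w : Rˣ} (hw : w ∈ 𝓡.Red e f) :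
    e * w * f ∈ 𝓡.Λ ∧ w ∈ unitStabilizer (e * w * f) ∧ e * w * f * e = e * w * f ∧
      e * w * f * f = e * w * f := by
  have he' := 𝓡.isIdempotentElem e he
  have hf' := 𝓡.isIdempotentElem f hf
  -- Applied to $pf\le f$ and $pf\le p$, `conj_pair` gives one $h\in\Lambda$ (`g₁` below) such that
  -- $v$ conjugates $(h,f)$ to $(pf,f)$ and $u$ conjugates $(h,e)$ to $(pf,p)$. Hence $v\in W(f)$,
  -- $wu\in W(e)$ and $u^{-1}v\in W(h)$.
  set p : R := ((w⁻¹ : Rˣ) : R) * e * w with hp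
  have hp' : IsIdempotentElem p := by simpa [hp] using he'.units_conj w⁻¹
  have hpf := 𝓡.factorisable.isIdempotentElem_mul hp' hf'
  obtain ⟨v, h, f₂, hh, hf₂, hle, hv, hv₂⟩ := 𝓡.conj_pair (p * f) f hpf hf' (by
    rw [mul_assoc, hf'.eq])
  obtain rfl : f₂ = f := 𝓡.eq_of_conj hf₂ hf (u := v) (v := 1) (by simpa using hv₂)
  obtain ⟨u, g₁, g₂, hg₁, hg₂, hge, hu, hu₂⟩ := 𝓡.conj_pair (p * f₂) p hpf hp' (by
    rw [𝓡.factorisable.idempotents_commute _ _ hp' hf', mul_assoc, hp'.eq])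
  obtain rfl : g₁ = h := 𝓡.eq_of_conj hg₁ hh (hu.trans hv.symm)
  obtain rfl : g₂ = e := 𝓡.eq_of_conj hg₂ he (u := u) (v := w⁻¹) (by simpa using hu₂)
  have hh' := 𝓡.isIdempotentElem g₁ hh
  have hwu : w * u ∈ unitCentralizer g₂ := by
    apply mem_unitCentralizer_of_conj
    calc ((w * u : Rˣ) : R) * g₂ * (((w * u)⁻¹ : Rˣ) : R)
        = w * ((u : R) * g₂ * ((u⁻¹ : Rˣ) : R)) * ((w⁻¹ : Rˣ) : R) := by
          simp [mul_assoc]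
      _ = g₂ := by rw [hu₂, hp]; simp [mul_assoc]
  have hk : u⁻¹ * v ∈ unitCentralizer g₁ := by
    apply mem_unitCentralizer_of_conj
    calc ((u⁻¹ * v : Rˣ) : R) * g₁ * (((u⁻¹ * v)⁻¹ : Rˣ) : R)
        = ((u⁻¹ : Rˣ) : R) * ((v : R) * g₁ * ((v⁻¹ : Rˣ) : R)) * u := by
          simp [mul_assoc]
      _ = g₁ := by rw [hv, ← hu]; simp [mul_assoc]
  obtain ⟨x, hx, y, hy, hxy⟩ := 𝓡.exists_mul_of_mem_unitCentralizer hh hk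
  -- Since $h\le e$, `upperType_mono` lets $W(e)$ absorb the factor $y$ with letters in
  -- $\lambda^\star(h)$.
  have hy' : y ∈ unitCentralizer g₂ := by
    rw [𝓡.unitCentralizer_eq he]
    exact standardParabolic_mono _ ((𝓡.upperType_mono _ hh _ he hge).trans
      (𝓡.upperType_subset_typeMap _)) hy
  have hdecomp : x = (w * u * y)⁻¹ * w * v := by
    have h1 := (𝓡.commute_of_mem hh hx hy).eq
    rw [h1] at hxy
    rw [eq_inv_mul_of_mul_eq hxy.symm]
    group
  -- Thus $x\in W_\star(h)$ lies in $W(e)wW(f)$. In a length-additive decomposition of $x$ every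
  -- factor, in particular $w$, lies in the parabolic subgroup $W_\star(h)$.
  obtain ⟨a', -, b', -, h1, h2⟩ := exists_double_decomposition (cs := 𝓡.cs)
    (IsDoubleReduced.isLeftMin hw) (IsDoubleReduced.isRightMin hw)
    (𝓡.unitCentralizer_eq he ▸ inv_mem (MulMemClass.mul_mem hwu hy'))
    (𝓡.unitCentralizer_eq hf ▸ mem_unitCentralizer_of_conj hv₂)
  rw [← hdecomp] at h1
  have hws : w ∈ unitStabilizer g₁ := by
    rw [𝓡.unitStabilizer_eq hh]
    have h3 := 𝓡.cs.length_mul_le a' w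
    have h4 := 𝓡.cs.length_mul_le (a' * w) b'
    have h5 := (mem_standardParabolic_of_length_add 𝓡.cs (h1 ▸ hx) (by omega)).1
    exact (mem_standardParabolic_of_length_add 𝓡.cs h5 (by omega)).2
  have hle' : g₁ * (p * f₂) = g₁ := by
    have h3 : g₁ * ((w⁻¹ : Rˣ) : R) = g₁ := (inv_mem hws).2
    have h4 : g₁ * (w : R) = g₁ := hws.2
    rw [hp, ← mul_assoc, ← mul_assoc, ← mul_assoc, h3, hge, h4, hle]
  -- $h\le pf$ are conjugate to each other; conjugating both at once into $\Lambda$ shows that they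
  -- are equal.
  have hfin : p * f₂ = g₁ := by
    obtain ⟨z, k₁, k₂, hk₁, hk₂, -, hz₁, hz₂⟩ := 𝓡.conj_pair g₁ (p * f₂) hh' hpf hle'
    obtain rfl : k₁ = g₁ := 𝓡.eq_of_conj hk₁ hh (u := z) (v := 1) (by simpa using hz₁)
    obtain rfl : k₂ = k₁ := 𝓡.eq_of_conj hk₂ hh (hz₂.trans hv.symm)
    exact hz₂.symm.trans hz₁
  have key : g₂ * w * f₂ = g₁ := by
    have h3 : (w : R) * g₁ = g₁ := hws.1
    rw [← hfin, hp] at h3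
    rw [← hfin, hp, ← h3]
    simp [mul_assoc]
  rw [key]
  exact ⟨hh, hws, hge, hle⟩

theorem isWedge_iff (he : e ∈ 𝓡.Λ) (hf : f ∈ 𝓡.Λ) {w : Rˣ} (hw : w ∈ 𝓡.Red e f) {h : R} :
    𝓡.IsWedge e w f h ↔ h = e * w * f := by
  obtain ⟨h1, h2, -, -⟩ := 𝓡.wedge_spec he hf hw
  have h3 : (w : R) * (e * w * f) = e * w * f := h2.1
  constructor
  · rintro ⟨-, -, h'⟩
    rw [← h3, Units.mul_right_inj] at h'
    exact h'.symm
  · rintro rfl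
    exact ⟨h1, unitStabilizer_le_unitCentralizer _ h2, h3.symm⟩

theorem wedge_mem_LambdaCirc (he : e ∈ 𝓡.LambdaCirc) (hf : f ∈ 𝓡.Λ) {w : Rˣ}
    (hw : w ∈ 𝓡.Red e f) : e * w * f ∈ 𝓡.LambdaCirc := by
  obtain ⟨h1, -, h3, -⟩ := 𝓡.wedge_spec he.1 hf hw
  refine ⟨h1, fun h => he.2 ?_⟩
  rw [Set.mem_singleton_iff] at h ⊢
  rwa [h, one_mul] at h3

theorem existsUnique_wedge (he : e ∈ 𝓡.LambdaCirc) (hf : f ∈ 𝓡.LambdaCirc) {w : Rˣ}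
    (hw : w ∈ 𝓡.Red e f) : ∃! h : R, h ∈ 𝓡.LambdaCirc ∧ 𝓡.IsWedge e w f h :=
  ⟨e * w * f, ⟨𝓡.wedge_mem_LambdaCirc he hf.1 hw, (𝓡.isWedge_iff he.1 hf.1 hw).2 rfl⟩,
    fun _ h => (𝓡.isWedge_iff he.1 hf.1 hw).1 h.2⟩

end RennerCoxeterSystem

/-! ### Length and normal form in $R$ -/

namespace RennerCoxeterSystem

variable {B R : Type*} [Monoid R] {M : CoxeterMatrix B} (𝓡 : RennerCoxeterSystem M R)
variable {e f g : R}

section Length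

theorem length_le (ω : List 𝓡.Letter) :
    𝓡.length (ω.map 𝓡.letterVal).prod ≤ (ω.map 𝓡.letterLength).sum :=
  Nat.sInf_le ⟨ω, rfl, rfl⟩

theorem exists_minimal_word (r : R) : ∃ ω : List 𝓡.Letter,
    (ω.map 𝓡.letterVal).prod = r ∧ (ω.map 𝓡.letterLength).sum = 𝓡.length r := by
  obtain ⟨ω, h⟩ := 𝓡.exists_word r
  exact Nat.sInf_mem (s := {n | ∃ ω : List 𝓡.Letter,
    (ω.map 𝓡.letterVal).prod = r ∧ (ω.map 𝓡.letterLength).sum = n}) ⟨_, ω, h, rfl⟩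

theorem length_mul_le (r r' : R) : 𝓡.length (r * r') ≤ 𝓡.length r + 𝓡.length r' := by
  obtain ⟨ω, rfl, h⟩ := 𝓡.exists_minimal_word r
  obtain ⟨ω', rfl, h'⟩ := 𝓡.exists_minimal_word r'
  have := 𝓡.length_le (ω ++ ω')
  rw [List.map_append, List.prod_append, List.map_append, List.sum_append, h, h'] at this
  exact this

theorem length_letterVal_le (x : 𝓡.Letter) : 𝓡.length (𝓡.letterVal x) ≤ 𝓡.letterLength x := by
  simpa using 𝓡.length_le [x]

theorem length_one : 𝓡.length 1 = 0 := by
  simpa using 𝓡.length_le []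

theorem length_of_mem_Λ (hg : g ∈ 𝓡.Λ) : 𝓡.length g = 0 := by
  by_cases h : g = 1
  · rw [h, 𝓡.length_one]
  · exact Nat.le_zero.1 (𝓡.length_letterVal_le (Sum.inr ⟨g, hg, h⟩))

theorem length_units_le (u : Rˣ) : 𝓡.length (u : R) ≤ 𝓡.cs.length u := by
  obtain ⟨ω, hω, rfl⟩ := 𝓡.cs.exists_isReduced u
  rw [hω.eq]
  clear hω
  induction ω with
  | nil => simp [𝓡.length_one]
  | cons i ω ih =>
    rw [wordProd_cons, Units.val_mul, List.length_cons, add_comm]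
    exact (𝓡.length_mul_le _ _).trans (add_le_add (𝓡.length_letterVal_le (Sum.inl i)) ih)

theorem length_triple_le (u : Rˣ) (hg : g ∈ 𝓡.Λ) (v : Rˣ) :
    𝓡.length (u * g * v) ≤ 𝓡.cs.length u + 𝓡.cs.length v := by
  have h1 := 𝓡.length_mul_le (u * g) v
  have h2 := 𝓡.length_mul_le u g
  have h3 := 𝓡.length_units_le u
  have h4 := 𝓡.length_units_le v
  have h5 := 𝓡.length_of_mem_Λ hg
  omega

/-- In $u=awb$ with $w\in\mathrm{Red}(e,g)$ the factor $a$ passes $e$, the factor $b$ passes $g$,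
and $w$ disappears into $ewg\in\Lambda$. -/
theorem exists_triple_lambda_mul (he : e ∈ 𝓡.Λ) (hg : g ∈ 𝓡.Λ) (u v : Rˣ) :
    ∃ (u' : Rˣ) (g' : R) (v' : Rˣ), g' ∈ 𝓡.Λ ∧ e * (u * g * v) = u' * g' * v' ∧
      𝓡.cs.length u' + 𝓡.cs.length v' ≤ 𝓡.cs.length u + 𝓡.cs.length v := by
  obtain ⟨a, ha, w, hw, b, hb, rfl, hl⟩ :=
    exists_isDoubleReduced 𝓡.cs (typeMap 𝓡.cs e) (typeMap 𝓡.cs g) u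
  rw [← 𝓡.unitCentralizer_eq he, mem_unitCentralizer_iff] at ha
  rw [← 𝓡.unitCentralizer_eq hg, mem_unitCentralizer_iff] at hb
  refine ⟨a, e * w * g, b * v, (𝓡.wedge_spec he hg hw).1, ?_, ?_⟩
  · simp only [Units.val_mul, mul_assoc]
    rw [← mul_assoc (b : R), hb, ← mul_assoc e, ← ha]
    simp only [mul_assoc]
  · have := 𝓡.cs.length_mul_le b v
    omega

theorem exists_triple_of_word (ω : List 𝓡.Letter) :
    ∃ (u : Rˣ) (g : R) (v : Rˣ), g ∈ 𝓡.Λ ∧ (ω.map 𝓡.letterVal).prod = u * g * v ∧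
      𝓡.cs.length u + 𝓡.cs.length v ≤ (ω.map 𝓡.letterLength).sum := by
  induction ω with
  | nil => exact ⟨1, 1, 1, 𝓡.one_mem_Λ, by simp, by simp⟩
  | cons x ω ih =>
    obtain ⟨u, g, v, hg, h, hl⟩ := ih
    rw [List.map_cons, List.prod_cons, h, List.map_cons, List.sum_cons]
    rcases x with i | e
    · refine ⟨𝓡.cs.simple i * u, g, v, hg, by simp [letterVal, mul_assoc], ?_⟩
      have := 𝓡.cs.length_mul_le (𝓡.cs.simple i) u
      rw [length_simple] at this
      simp only [letterLength]
      omega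
    · obtain ⟨u', g', v', hg', h', hl'⟩ := 𝓡.exists_triple_lambda_mul e.2.1 hg u v
      exact ⟨u', g', v', hg', h', by simp only [letterLength]; omega⟩

/-- The length of `r` is the minimum of `ℓ(u) + ℓ(v)` over `r = u g v` with `g ∈ Λ`. -/
theorem exists_triple_length_eq (r : R) :
    ∃ (u : Rˣ) (g : R) (v : Rˣ), g ∈ 𝓡.Λ ∧ r = u * g * v ∧
      𝓡.cs.length u + 𝓡.cs.length v = 𝓡.length r := by
  obtain ⟨ω, rfl, hω⟩ := 𝓡.exists_minimal_word r
  obtain ⟨u, g, v, hg, h, hl⟩ := 𝓡.exists_triple_of_word ω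
  have := 𝓡.length_triple_le u hg v
  rw [← h] at this
  exact ⟨u, g, v, hg, h, by omega⟩

end Length

section NormalForm

/-- The product determines the idempotent $ugu^{-1}$, hence $g$ by transversality; the rest measures
the freedom in $u$ and $v$. -/
theorem triple_eq {g' : R} (hg : g ∈ 𝓡.Λ) (hg' : g' ∈ 𝓡.Λ) {u v u' v' : Rˣ}
    (h : (u : R) * g * v = u' * g' * v') :
    g = g' ∧ u⁻¹ * u' ∈ unitCentralizer g ∧ u⁻¹ * u' * (v' * v⁻¹) ∈ unitStabilizer g := by
  have hgi := 𝓡.isIdempotentElem g hg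
  have h1 : (u : R) * g * ((u⁻¹ : Rˣ) : R) = u' * g' * ((u'⁻¹ : Rˣ) : R) :=
    𝓡.factorisable.eq_of_mul_unit_eq (u := u * v) (v := u' * v') (hgi.units_conj u)
      ((𝓡.isIdempotentElem g' hg').units_conj u') (by simpa [mul_assoc] using h)
  obtain rfl := 𝓡.eq_of_conj hg hg' h1
  have h2 : u⁻¹ * u' ∈ unitCentralizer g := by
    apply mem_unitCentralizer_of_conj
    calc ((u⁻¹ * u' : Rˣ) : R) * g * (((u⁻¹ * u')⁻¹ : Rˣ) : R)
        = ((u⁻¹ : Rˣ) : R) * (u' * g * ((u'⁻¹ : Rˣ) : R)) * u := by simp [mul_assoc]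
      _ = g := by rw [← h1]; simp [mul_assoc]
  refine ⟨rfl, h2, 𝓡.factorisable.mem_unitStabilizer hgi ?_⟩
  rw [Units.val_mul, ← mul_assoc, ← mem_unitCentralizer_iff.1 h2]
  calc ((u⁻¹ * u' : Rˣ) : R) * g * ((v' * v⁻¹ : Rˣ) : R)
      = ((u⁻¹ : Rˣ) : R) * (u' * g * v') * ((v⁻¹ : Rˣ) : R) := by simp [mul_assoc]
    _ = g := by rw [← h]; simp [mul_assoc]

/-- The triple `(u, g, v)` is the normal form of `u g v`. -/
structure IsNormal (u : Rˣ) (g : R) (v : Rˣ) : Prop where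
  mem : g ∈ 𝓡.Λ
  right : IsRightMin 𝓡.cs (lowerType 𝓡.cs g) u
  left : IsLeftMin 𝓡.cs (typeMap 𝓡.cs g) v

variable {𝓡}

/-- Compare with a shortest triple $xgy$: for $d=yv^{-1}\in W(g)$ one has $\ell(y)=\ell(d)+\ell(v)$,
while $xd\in uW_\star(g)$ gives $\ell(u)\le\ell(x)+\ell(d)$. -/
theorem IsNormal.length_eq {u v : Rˣ} (h : 𝓡.IsNormal u g v) :
    𝓡.length (u * g * v) = 𝓡.cs.length u + 𝓡.cs.length v := by
  refine le_antisymm (𝓡.length_triple_le u h.mem v) ?_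
  obtain ⟨x, g', y, hg', hr, hl⟩ := 𝓡.exists_triple_length_eq (u * g * v)
  obtain ⟨rfl, hc, hcd⟩ := 𝓡.triple_eq h.mem hg' hr
  have hd : y * v⁻¹ ∈ unitCentralizer g := by
    have := MulMemClass.mul_mem (inv_mem hc) (unitStabilizer_le_unitCentralizer _ hcd)
    simpa [mul_assoc] using this
  rw [𝓡.unitCentralizer_eq h.mem] at hd
  rw [𝓡.unitStabilizer_eq h.mem] at hcd
  have h1 := h.left.length_mul hd
  have h2 := h.right.length_mul hcd
  rw [inv_mul_cancel_right] at h1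
  have h3 : u * (u⁻¹ * x * (y * v⁻¹)) = x * (y * v⁻¹) := by group
  rw [h3] at h2
  have h4 := 𝓡.cs.length_mul_le x (y * v⁻¹)
  omega

theorem IsNormal.unique {g' : R} {u v u' v' : Rˣ} (h : 𝓡.IsNormal u g v)
    (h' : 𝓡.IsNormal u' g' v') (heq : (u : R) * g * v = u' * g' * v') :
    u = u' ∧ g = g' ∧ v = v' := by
  obtain ⟨rfl, hc, hcd⟩ := 𝓡.triple_eq h.mem h'.mem heq
  have hd : v' * v⁻¹ ∈ unitCentralizer g := by
    have := MulMemClass.mul_mem (inv_mem hc) (unitStabilizer_le_unitCentralizer _ hcd)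
    simpa [mul_assoc] using this
  rw [𝓡.unitCentralizer_eq h.mem] at hd
  obtain rfl := h.left.eq_of_mul_mem h'.left hd
  rw [mul_inv_cancel, mul_one, 𝓡.unitStabilizer_eq h.mem] at hcd
  exact ⟨h.right.eq_of_mul_mem h'.right hcd, rfl, rfl⟩

variable (𝓡)

/-- The $W(g)$-part of $v$ passes $g$ to the left; then $g$ absorbs the $W_\star(g)$-part of the
unit on its left. -/
theorem exists_isNormal (r : R) : ∃ u g v, 𝓡.IsNormal u g v ∧ r = u * g * v := by
  obtain ⟨u, g, v, hg, rfl, -⟩ := 𝓡.exists_triple_length_eq r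
  obtain ⟨d, c, hd, hc, rfl⟩ := exists_mul_isLeftMin 𝓡.cs (typeMap 𝓡.cs g) v
  obtain ⟨x, y, hx, hy, hxy⟩ := exists_isRightMin_mul 𝓡.cs (lowerType 𝓡.cs g) (u * c)
  rw [← 𝓡.unitCentralizer_eq hg, mem_unitCentralizer_iff] at hc
  rw [← 𝓡.unitStabilizer_eq hg] at hy
  refine ⟨x, g, d, ⟨hg, hx, hd⟩, ?_⟩
  have h1 : (u : R) * c = x * y := by exact_mod_cast congrArg Units.val hxy
  have h2 : (y : R) * g = g := hy.1
  rw [Units.val_mul, ← mul_assoc, mul_assoc (u : R), ← hc, ← mul_assoc, h1, mul_assoc (x : R), h2]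

variable {𝓡}

theorem IsNormal.simple_mul {u v : Rˣ} (h : 𝓡.IsNormal u g v) (i : B) :
    𝓡.IsNormal (𝓡.cs.simple i * u) g v ∨
      (𝓡.cs.simple i : R) * (u * g * v) = u * g * v := by
  rcases h.right.simple_mul i with h1 | ⟨t, ht, h1⟩
  · exact Or.inl ⟨h.mem, h1, h.left⟩
  · right
    have h2 : (𝓡.cs.simple i : R) * u = u * 𝓡.cs.simple t := by
      exact_mod_cast congrArg Units.val h1
    have h3 : (𝓡.cs.simple t : R) * g = g := ht.1
    rw [← mul_assoc, ← mul_assoc, h2, mul_assoc (u : R), h3]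

/-- By Deodhar's lemma the letter either joins $v$ or reaches $g$, which absorbs it or lets it pass
according to its type. -/
theorem IsNormal.mul_simple {u v : Rˣ} (h : 𝓡.IsNormal u g v) (j : B) :
    𝓡.IsNormal u g (v * 𝓡.cs.simple j) ∨
      (∃ t ∈ upperType 𝓡.cs g, v * 𝓡.cs.simple j = 𝓡.cs.simple t * v) ∨
      (u * g * v : R) * 𝓡.cs.simple j = u * g * v := by
  rcases h.left.mul_simple j with h1 | ⟨t, ht, h1⟩
  · exact Or.inl ⟨h.mem, h.right, h1⟩
  · rcases 𝓡.mem_upperType_or_mem_lowerType ht with ht | ht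
    · exact Or.inr (Or.inl ⟨t, ht, h1⟩)
    · right; right
      have h2 : (v : R) * 𝓡.cs.simple j = 𝓡.cs.simple t * v := by
        exact_mod_cast congrArg Units.val h1
      have h3 : g * (𝓡.cs.simple t : R) = g := ht.2
      rw [mul_assoc, h2, ← mul_assoc, mul_assoc (u : R), h3]

variable (𝓡)

/-- A right descent in $\lambda_\star(g)$ would be a simple reflection of $W_{\lambda^\star(g)}$,
hence one from $\lambda^\star(g)$, and these do not fix $g$. -/
theorem isRightMin_of_mem_upperType {y : Rˣ}
    (hy : y ∈ standardParabolic 𝓡.cs (upperType 𝓡.cs g)) :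
    IsRightMin 𝓡.cs (lowerType 𝓡.cs g) y := by
  obtain ⟨x, z, hx, hz, rfl⟩ := exists_isRightMin_mul 𝓡.cs (lowerType 𝓡.cs g) y
  have hz' := (mem_standardParabolic_of_length_add 𝓡.cs hy (hx.length_mul hz)).2
  by_cases h : z = 1
  · simpa [h] using hx
  obtain ⟨i, hi, hl⟩ := exists_rightDescent_of_mem_standardParabolic hz h
  have h1 : z * 𝓡.cs.simple i * 𝓡.cs.simple i = z := by simp
  have h2 : 𝓡.cs.simple i ∈ standardParabolic 𝓡.cs (upperType 𝓡.cs g) :=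
    (mem_standardParabolic_of_length_add 𝓡.cs (h1.symm ▸ hz') (by
      rw [h1, length_simple, hl])).2
  obtain ⟨ω, hω, hI, hω'⟩ := exists_isReduced_of_mem_standardParabolic 𝓡.cs h2
  have h3 := hω.eq
  rw [hω', length_simple] at h3
  obtain ⟨k, rfl⟩ := List.length_eq_one_iff.1 h3.symm
  rw [wordProd_singleton] at hω'
  refine absurd ?_ (𝓡.simple_notMem_of_mem_upperType (hI k (by simp)))
  rw [hω']
  exact hi

/-- Write $u=xd$ with $x$ minimal modulo $W(g)$ and $d\in W(g)$. Minimality of $u$ forces $d\in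
W_{\lambda^\star(g)}$, and then $dy$ lies there too. -/
theorem isRightMin_mul_of_mem_upperType (hg : g ∈ 𝓡.Λ) {u y : Rˣ}
    (hu : IsRightMin 𝓡.cs (lowerType 𝓡.cs g) u)
    (hy : y ∈ standardParabolic 𝓡.cs (upperType 𝓡.cs g)) :
    IsRightMin 𝓡.cs (lowerType 𝓡.cs g) (u * y) := by
  obtain ⟨x, d, hx, hd, rfl⟩ := exists_isRightMin_mul 𝓡.cs (typeMap 𝓡.cs g) u
  have hmin : ∀ z ∈ standardParabolic 𝓡.cs (typeMap 𝓡.cs g),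
      IsRightMin 𝓡.cs (lowerType 𝓡.cs g) z ↔ IsRightMin 𝓡.cs (lowerType 𝓡.cs g) (x * z) := by
    intro z hz
    refine forall₂_congr fun i hi => ?_
    rw [mul_assoc, hx.length_mul hz, hx.length_mul (MulMemClass.mul_mem hz
      (simple_mem_standardParabolic _ (𝓡.lowerType_subset_typeMap g hi)))]
    omega
  have hd' := (hmin d hd).2 hu
  have hsub := standardParabolic_mono 𝓡.cs (𝓡.upperType_subset_typeMap g)
  obtain ⟨c₁, h₁, c₂, h₂, hc⟩ := 𝓡.exists_mul_of_mem_unitCentralizer hg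
    (𝓡.unitCentralizer_eq hg ▸ hd)
  rw [(𝓡.commute_of_mem hg h₁ h₂).eq] at hc
  have : c₂ = d := (𝓡.isRightMin_of_mem_upperType h₂).eq_of_mul_mem hd' (by
    rw [hc, inv_mul_cancel_left]; exact h₁)
  subst this
  rw [mul_assoc, ← hmin _ (MulMemClass.mul_mem hd (hsub hy))]
  exact 𝓡.isRightMin_of_mem_upperType (MulMemClass.mul_mem h₂ hy)

theorem simple_mul_trichotomy (i : B) (r : R) :
    𝓡.length (𝓡.cs.simple i * r) = 𝓡.length r + 1 ∨ (𝓡.cs.simple i : R) * r = r ∨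
      𝓡.length (𝓡.cs.simple i * r) + 1 = 𝓡.length r := by
  obtain ⟨u, g, v, h, rfl⟩ := 𝓡.exists_isNormal r
  rcases h.simple_mul i with h1 | h1
  · have h2 := h1.length_eq
    rw [Units.val_mul, mul_assoc, mul_assoc, ← mul_assoc (u : R)] at h2
    rw [h2, h.length_eq]
    have := 𝓡.cs.length_simple_mul u i
    omega
  · exact Or.inr (Or.inl h1)

/-- If `s r` and `r t` have the same length, different from that of `r`, and `s r t` has the length
of `r`, then `s r = r t`. -/
theorem simple_mul_eq_mul_simple {i j : B} {r : R}
    (h₁ : 𝓡.length (𝓡.cs.simple i * r) ≠ 𝓡.length r)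
    (h₂ : 𝓡.length (𝓡.cs.simple i * r) = 𝓡.length (r * 𝓡.cs.simple j))
    (h₃ : 𝓡.length (𝓡.cs.simple i * r * 𝓡.cs.simple j) = 𝓡.length r) :
    (𝓡.cs.simple i : R) * r = r * 𝓡.cs.simple j := by
  obtain ⟨u, g, v, h, rfl⟩ := 𝓡.exists_isNormal r
  rcases h.simple_mul i with hs | hs
  swap
  · rw [hs] at h₁; exact absurd rfl h₁
  have ls := hs.length_eq
  rw [Units.val_mul, mul_assoc, mul_assoc, ← mul_assoc (u : R)] at ls
  have l := h.length_eq
  rcases h.mul_simple j with ht | ⟨t, ht, hvt⟩ | ht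
  -- Here $s$ changes only $u$ and $t$ only $v$, so `h₂` and `h₃` would add up to
  -- $\ell(su)=\ell(u)$.
  · exfalso
    have lt := ht.length_eq
    rw [Units.val_mul, ← mul_assoc] at lt
    have lst := (IsNormal.mk (𝓡 := 𝓡) h.mem hs.right ht.left).length_eq
    have e1 : (𝓡.cs.simple i : R) * (u * g * v) * 𝓡.cs.simple j =
      ((𝓡.cs.simple i * u : Rˣ) : R) * g * ((v * 𝓡.cs.simple j : Rˣ) : R) := by
      simp [mul_assoc]
    rw [e1] at h₃
    have := 𝓡.cs.length_simple_mul u i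
    omega
  -- The letter passes $v$ and $g$ and arrives at $u$, where the corresponding fact in $W$ applies.
  · have hut : 𝓡.IsNormal (u * 𝓡.cs.simple t) g v := ⟨h.mem,
      𝓡.isRightMin_mul_of_mem_upperType h.mem h.right (simple_mem_standardParabolic _ ht), h.left⟩
    have hvt' : (v : R) * 𝓡.cs.simple j = 𝓡.cs.simple t * v := by
      exact_mod_cast congrArg Units.val hvt
    have e1 : (u * g * v : R) * 𝓡.cs.simple j = ((u * 𝓡.cs.simple t : Rˣ) : R) * g * v := by
      have h3 : (𝓡.cs.simple t : R) * g = g * 𝓡.cs.simple t := ht.1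
      rw [mul_assoc, hvt', Units.val_mul, mul_assoc (u : R) _ g, h3]
      simp only [mul_assoc]
    have lt := hut.length_eq
    rw [mul_assoc, e1] at h₃
    rw [e1] at h₂ ⊢
    rcases hut.simple_mul i with hsut | hsut
    · have lsut := hsut.length_eq
      rw [Units.val_mul, mul_assoc, mul_assoc, ← mul_assoc ((u * 𝓡.cs.simple t : Rˣ) : R)] at lsut
      rw [h₃, l] at lsut
      rw [ls, lt] at h₂
      have := 𝓡.cs.simple_mul_eq_mul_simple (w := u) (i := i) (j := t) (by omega)
        (by rw [mul_assoc]; omega)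
      rw [← this]
      simp [mul_assoc]
    · rw [hsut] at h₃
      omega
  · rw [ht] at h₂
    exact absurd h₂ h₁

/-- Right multiplication by an idempotent of `Λ` does not reverse the order of `r` and `s r`. -/
theorem length_mul_lambda_le_of_length_lt (he : e ∈ 𝓡.Λ) {i : B} {r : R}
    (hr : 𝓡.length (𝓡.cs.simple i * r) = 𝓡.length r + 1) :
    𝓡.length (r * e) ≤ 𝓡.length (𝓡.cs.simple i * r * e) := by
  obtain ⟨u, g, v, h, rfl⟩ := 𝓡.exists_isNormal r
  have l := h.length_eq
  rcases h.simple_mul i with hs | hs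
  swap
  · rw [hs] at hr; omega
  have ls := hs.length_eq
  rw [Units.val_mul, mul_assoc, mul_assoc, ← mul_assoc (u : R)] at ls
  have hsu : 𝓡.cs.length (𝓡.cs.simple i * u) = 𝓡.cs.length u + 1 := by omega
  obtain ⟨a, ha, w, hw, b, hb, hv, hlv⟩ :=
    exists_isDoubleReduced 𝓡.cs (typeMap 𝓡.cs g) (typeMap 𝓡.cs e) v
  have ha1 : a = 1 := by
    have h1 := h.left.length_mul (inv_mem ha)
    rw [𝓡.cs.length_inv] at h1
    have h2 : a⁻¹ * v = w * b := by rw [hv]; group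
    have h3 := 𝓡.cs.length_mul_le w b
    rw [← h2] at h3
    exact 𝓡.cs.length_eq_zero_iff.1 (by omega)
  subst ha1
  rw [one_mul] at hv
  rw [𝓡.cs.length_one] at hlv
  rw [← 𝓡.unitCentralizer_eq he, mem_unitCentralizer_iff] at hb
  obtain ⟨hh, hwh, hhg, hhe⟩ := 𝓡.wedge_spec h.mem he hw
  set k := g * w * e with hk
  have e1 : (u * g * v : R) * e = u * k * b := by
    rw [hv, Units.val_mul, mul_assoc, mul_assoc (w : R), hb, hk]
    simp only [mul_assoc]
  -- $\lambda^\star(k)\subseteq\lambda^\star(g)$, and $w\in W_\star(k)$ commutes with these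
  -- reflections, so such a descent of $b$ would be one of $v=wb$.
  have hbmin : IsLeftMin 𝓡.cs (upperType 𝓡.cs k) b := by
    intro t ht
    have h1 := h.left t (𝓡.upperType_subset_typeMap g (𝓡.upperType_mono _ hh _ h.mem hhg ht))
    have h2 : 𝓡.cs.simple t * v = w * (𝓡.cs.simple t * b) := by
      have := 𝓡.commute_of_mem hh (𝓡.unitStabilizer_eq hh ▸ hwh)
        (simple_mem_standardParabolic 𝓡.cs ht)
      rw [hv, ← mul_assoc, ← this.eq, mul_assoc]
    have h3 := 𝓡.cs.length_mul_le w (𝓡.cs.simple t * b)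
    rw [← h2] at h3
    have h4 := 𝓡.cs.length_simple_mul b t
    omega
  obtain ⟨d, y, hd, hy, hyd⟩ := exists_mul_isLeftMin 𝓡.cs (typeMap 𝓡.cs k) b
  obtain ⟨c₁, h₁, c₂, h₂, hc⟩ := 𝓡.exists_mul_of_mem_unitCentralizer hh
    (𝓡.unitCentralizer_eq hh ▸ hy)
  have hcomm := (𝓡.commute_of_mem hh h₁ h₂).eq
  -- Hence the $W(k)$-part of $b$ lies in $W_\star(k)$ and is absorbed by $k$: nothing crosses to
  -- the left, and the normal form of $re$ is $xkd$ with $u=xz$.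
  have hc₂ : c₂ = 1 := by
    have l1 := hbmin.length_mul (inv_mem h₂)
    have l2 := hd.length_mul hy
    have l3 := (𝓡.isRightMin_of_mem_upperType h₂).length_mul h₁
    have l4 : c₂⁻¹ * b = c₁ * d := by rw [hyd, hc, hcomm]; group
    have l5 := 𝓡.cs.length_mul_le c₁ d
    rw [𝓡.cs.length_inv, l4] at l1
    rw [← hyd, hc, hcomm] at l2
    exact 𝓡.cs.length_eq_zero_iff.1 (by omega)
  rw [hc₂, mul_one] at hc
  subst hc
  have hkb : k * (b : R) = k * d := by
    have : k * (y : R) = k := ((𝓡.unitStabilizer_eq hh).symm ▸ h₁ : y ∈ unitStabilizer k).2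
    rw [hyd, Units.val_mul, ← mul_assoc, this]
  obtain ⟨x, z, hx, hz, hu⟩ := exists_isRightMin_mul 𝓡.cs (lowerType 𝓡.cs k) u
  have huk : (u : R) * k = x * k := by
    have : (z : R) * k = k := ((𝓡.unitStabilizer_eq hh).symm ▸ hz : z ∈ unitStabilizer k).1
    rw [hu, Units.val_mul, mul_assoc, this]
  have hN : 𝓡.IsNormal x k d := ⟨hh, hx, hd⟩
  rw [mul_assoc (𝓡.cs.simple i : R), e1, mul_assoc (u : R), hkb, ← mul_assoc (u : R), huk]
  -- If $s$ shortened $x$, it would shorten $u=xz$, because $\ell(u)=\ell(x)+\ell(z)$.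
  rcases hN.simple_mul i with h1 | h1
  · have l1 := h1.length_eq
    rw [Units.val_mul, mul_assoc, mul_assoc, ← mul_assoc (x : R)] at l1
    rw [l1, hN.length_eq]
    have l2 := hx.length_mul hz
    have l3 := 𝓡.cs.length_mul_le (𝓡.cs.simple i * x) z
    rw [mul_assoc, ← hu] at l3
    rw [← hu] at l2
    omega
  · rw [h1]

end NormalForm

/-! ### Passage from left to right multiplication -/

section Involution

/-- The inverse `u⁻¹ e` of `e u`, for `e` idempotent and `u` a unit. -/
noncomputable def involution (r : R) : R :=
  (((𝓡.factorisable.exists_idempotent_mul_unit r).choose_spec.choose⁻¹ : Rˣ) : R) *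
    (𝓡.factorisable.exists_idempotent_mul_unit r).choose

/-- The choice does not matter: $eu$ determines $e$, and $u$ up to left multiplication by
$W_\star(e)$. -/
theorem involution_idempotent_mul_unit (he : IsIdempotentElem e) (u : Rˣ) :
    𝓡.involution (e * u) = ((u⁻¹ : Rˣ) : R) * e := by
  obtain ⟨hf, h⟩ := (𝓡.factorisable.exists_idempotent_mul_unit (e * u)).choose_spec.choose_spec
  rw [involution]
  generalize (𝓡.factorisable.exists_idempotent_mul_unit (e * u)).choose_spec.choose = v at *
  generalize (𝓡.factorisable.exists_idempotent_mul_unit (e * u)).choose = f at *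
  obtain rfl : e = f := 𝓡.factorisable.eq_of_mul_unit_eq he hf h
  have h1 : v * u⁻¹ ∈ unitStabilizer e := 𝓡.factorisable.mem_unitStabilizer he (by
    rw [Units.val_mul, ← mul_assoc, ← h, mul_assoc, Units.mul_inv, mul_one])
  have h2 : ((v * u⁻¹ : Rˣ) : R) * e = e := h1.1
  rw [Units.inv_mul_eq_iff_eq_mul, ← mul_assoc, ← Units.val_mul, h2]

theorem involution_units_mul (u : Rˣ) (r : R) :
    𝓡.involution (u * r) = 𝓡.involution r * ((u⁻¹ : Rˣ) : R) := by
  obtain ⟨e, v, he, rfl⟩ := 𝓡.factorisable.exists_idempotent_mul_unit r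
  have h : (u : R) * (e * v) = u * e * ((u⁻¹ : Rˣ) : R) * ((u * v : Rˣ) : R) := by
    simp [mul_assoc]
  rw [h, 𝓡.involution_idempotent_mul_unit (he.units_conj u),
    𝓡.involution_idempotent_mul_unit he]
  simp [mul_assoc]

theorem involution_mul_units (r : R) (u : Rˣ) :
    𝓡.involution (r * u) = ((u⁻¹ : Rˣ) : R) * 𝓡.involution r := by
  obtain ⟨e, v, he, rfl⟩ := 𝓡.factorisable.exists_idempotent_mul_unit r
  rw [mul_assoc, ← Units.val_mul, 𝓡.involution_idempotent_mul_unit he,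
    𝓡.involution_idempotent_mul_unit he, mul_inv_rev, Units.val_mul, mul_assoc]

theorem involution_idempotent_mul (he : IsIdempotentElem e) (r : R) :
    𝓡.involution (e * r) = 𝓡.involution r * e := by
  obtain ⟨f, v, hf, rfl⟩ := 𝓡.factorisable.exists_idempotent_mul_unit r
  rw [← mul_assoc, 𝓡.involution_idempotent_mul_unit hf,
    𝓡.involution_idempotent_mul_unit (𝓡.factorisable.isIdempotentElem_mul he hf),
    𝓡.factorisable.idempotents_commute e f he hf, mul_assoc]

theorem involution_idempotent (he : IsIdempotentElem e) : 𝓡.involution e = e := by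
  simpa using 𝓡.involution_idempotent_mul_unit he 1

theorem involution_involution (r : R) : 𝓡.involution (𝓡.involution r) = r := by
  obtain ⟨e, v, he, rfl⟩ := 𝓡.factorisable.exists_idempotent_mul_unit r
  rw [𝓡.involution_idempotent_mul_unit he, involution_units_mul, 𝓡.involution_idempotent he,
    inv_inv]

theorem length_involution (r : R) : 𝓡.length (𝓡.involution r) = 𝓡.length r := by
  have key : ∀ r, 𝓡.length (𝓡.involution r) ≤ 𝓡.length r := by
    intro r
    obtain ⟨u, g, v, hg, rfl, hl⟩ := 𝓡.exists_triple_length_eq r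
    rw [involution_mul_units, involution_units_mul,
      𝓡.involution_idempotent (𝓡.isIdempotentElem g hg), ← mul_assoc, ← hl, add_comm]
    simpa using 𝓡.length_triple_le v⁻¹ hg u⁻¹
  refine le_antisymm (key r) ?_
  simpa only [involution_involution] using key (𝓡.involution r)

theorem length_simple_mul_involution (i : B) (r : R) :
    𝓡.length (𝓡.cs.simple i * 𝓡.involution r) = 𝓡.length (r * 𝓡.cs.simple i) := by
  rw [← length_involution, involution_units_mul, involution_involution, inv_simple]

theorem mul_simple_trichotomy (i : B) (r : R) :
    𝓡.length (r * 𝓡.cs.simple i) = 𝓡.length r + 1 ∨ r * (𝓡.cs.simple i : R) = r ∨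
      𝓡.length (r * 𝓡.cs.simple i) + 1 = 𝓡.length r := by
  have h := 𝓡.simple_mul_trichotomy i (𝓡.involution r)
  rw [length_simple_mul_involution, length_involution] at h
  refine h.imp_right (Or.imp_left fun h => ?_)
  have := congrArg 𝓡.involution h
  rwa [involution_units_mul, involution_involution, inv_simple] at this

theorem length_lambda_mul_le_of_length_lt (he : e ∈ 𝓡.Λ) {i : B} {r : R}
    (hr : 𝓡.length (r * 𝓡.cs.simple i) = 𝓡.length r + 1) :
    𝓡.length (e * r) ≤ 𝓡.length (e * r * 𝓡.cs.simple i) := by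
  rw [← length_simple_mul_involution, ← 𝓡.length_involution r] at hr
  have := 𝓡.length_mul_lambda_le_of_length_lt he hr
  have hei := 𝓡.isIdempotentElem e he
  rwa [← 𝓡.involution_idempotent_mul hei, length_involution, mul_assoc,
    ← 𝓡.involution_idempotent_mul hei, length_simple_mul_involution] at this

end Involution

end RennerCoxeterSystem

/-! ### Alternating words that are reduced -/

namespace CoxeterSystem

variable {B W : Type*} [Group W] {M : CoxeterMatrix B} (cs : CoxeterSystem M W)

/-- If the next letter did not lengthen, both letters would be left descents, and an element of
length below $m_{i,j}$ would have a reduced word containing a whole braid side. -/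
theorem isReduced_altWord {i j : B} (hij : i ≠ j) {m : ℕ} (hm : m ≤ M i j) :
    cs.IsReduced (altWord i j m) := by
  induction m generalizing i j with
  | zero => simp [altWord, IsReduced]
  | succ m ih =>
    have h := ih hij.symm (by rw [M.symmetric]; omega)
    rw [altWord, isReduced_cons_iff _ h]
    refine (cs.length_simple_mul _ i).resolve_right fun hi => ?_
    rcases m with _ | m
    · simp [altWord] at hi
    · have hj : cs.length (cs.simple j * cs.wordProd (altWord j i (m + 1))) + 1 =
          cs.length (cs.wordProd (altWord j i (m + 1))) := by
        rw [h.eq, altWord, wordProd_cons, simple_mul_simple_cancel_left, List.length_cons]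
        rw [altWord] at h
        rw [h.tail.eq]
      obtain ⟨-, ν, hν, hν'⟩ := cs.exists_braid_of_descents hij hi hj
      have h1 := hν'.eq
      rw [hν, h.eq, List.length_append, length_altWord, length_altWord] at h1
      omega

end CoxeterSystem

/-! ### Commuting left and right multiplication operators on $V$ -/

namespace RennerCoxeterSystem

variable {B R : Type*} [Monoid R] {M : CoxeterMatrix B} (𝓡 : RennerCoxeterSystem M R)
variable {e f g : R}

section Lengths

theorem isNormal_unit (u : Rˣ) : 𝓡.IsNormal u 1 1 := by
  refine ⟨𝓡.one_mem_Λ, fun i hi => ?_, isLeftMin_one⟩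
  have h1 : (𝓡.cs.simple i : R) * 1 = 1 := hi.1
  rw [mul_one, Units.val_eq_one] at h1
  have := 𝓡.cs.length_simple i
  rw [h1, CoxeterSystem.length_one] at this
  omega

theorem length_unit (u : Rˣ) : 𝓡.length (u : R) = 𝓡.cs.length u := by
  simpa using (𝓡.isNormal_unit u).length_eq

theorem length_simple (i : B) : 𝓡.length (𝓡.cs.simple i : R) = 1 := by
  rw [length_unit, CoxeterSystem.length_simple]

theorem length_mul_of_isRightMin (hg : g ∈ 𝓡.Λ) {u : Rˣ}
    (hu : IsRightMin 𝓡.cs (lowerType 𝓡.cs g) u) : 𝓡.length (u * g) = 𝓡.cs.length u := by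
  simpa using (IsNormal.mk (𝓡 := 𝓡) (v := 1) hg hu isLeftMin_one).length_eq

theorem length_lambda_mul_le' (he : e ∈ 𝓡.Λ) (r : R) : 𝓡.length (e * r) ≤ 𝓡.length r := by
  simpa [𝓡.length_of_mem_Λ he] using 𝓡.length_mul_le e r

theorem length_mul_lambda_le (he : e ∈ 𝓡.Λ) (r : R) : 𝓡.length (r * e) ≤ 𝓡.length r := by
  simpa [𝓡.length_of_mem_Λ he] using 𝓡.length_mul_le r e

end Lengths

section Operators

theorem end_ext {R : Type*} {F G : Module.End ℤ[X] (R →₀ ℤ[X])}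
    (h : ∀ r : R, F (basisT r) = G (basisT r)) : F = G :=
  Finsupp.lhom_ext' fun r => LinearMap.ext_ring (h r)

/-- Left multiplication by `T_s`. -/
noncomputable def leftS (i : B) : Module.End ℤ[X] (R →₀ ℤ[X]) :=
  Finsupp.linearCombination ℤ[X] fun r =>
    if 𝓡.length (𝓡.cs.simple i * r) = 𝓡.length r + 1 then basisT (𝓡.cs.simple i * r)
    else if 𝓡.length (𝓡.cs.simple i * r) = 𝓡.length r then (X : ℤ[X]) • basisT r
    else (X - 1 : ℤ[X]) • basisT r + (X : ℤ[X]) • basisT (𝓡.cs.simple i * r)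

/-- Right multiplication by `T_s`. -/
noncomputable def rightS (i : B) : Module.End ℤ[X] (R →₀ ℤ[X]) :=
  Finsupp.linearCombination ℤ[X] fun r =>
    if 𝓡.length (r * 𝓡.cs.simple i) = 𝓡.length r + 1 then basisT (r * 𝓡.cs.simple i)
    else if 𝓡.length (r * 𝓡.cs.simple i) = 𝓡.length r then (X : ℤ[X]) • basisT r
    else (X - 1 : ℤ[X]) • basisT r + (X : ℤ[X]) • basisT (r * 𝓡.cs.simple i)

/-- Left multiplication by `T_e`, `e ∈ Λ`. -/
noncomputable def leftΛ (e : R) : Module.End ℤ[X] (R →₀ ℤ[X]) :=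
  Finsupp.linearCombination ℤ[X] fun r =>
    (X ^ (𝓡.length r - 𝓡.length (e * r)) : ℤ[X]) • basisT (e * r)

/-- Right multiplication by `T_e`, `e ∈ Λ`. -/
noncomputable def rightΛ (e : R) : Module.End ℤ[X] (R →₀ ℤ[X]) :=
  Finsupp.linearCombination ℤ[X] fun r =>
    (X ^ (𝓡.length r - 𝓡.length (r * e)) : ℤ[X]) • basisT (r * e)

variable {𝓡} {i j : B} {r : R}

theorem leftS_up (h : 𝓡.length (𝓡.cs.simple i * r) = 𝓡.length r + 1) :
    𝓡.leftS i (basisT r) = basisT (𝓡.cs.simple i * r) := by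
  rw [leftS, basisT, Finsupp.linearCombination_single, one_smul, if_pos h]

theorem leftS_eq (h : 𝓡.length (𝓡.cs.simple i * r) = 𝓡.length r) :
    𝓡.leftS i (basisT r) = (X : ℤ[X]) • basisT r := by
  rw [leftS, basisT, Finsupp.linearCombination_single, one_smul, if_neg (by omega), if_pos h]
  rfl

theorem leftS_down (h : 𝓡.length (𝓡.cs.simple i * r) + 1 = 𝓡.length r) :
    𝓡.leftS i (basisT r) =
      (X - 1 : ℤ[X]) • basisT r + (X : ℤ[X]) • basisT (𝓡.cs.simple i * r) := by
  rw [leftS, basisT, Finsupp.linearCombination_single, one_smul, if_neg (by omega),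
    if_neg (by omega)]
  rfl

theorem rightS_up (h : 𝓡.length (r * 𝓡.cs.simple i) = 𝓡.length r + 1) :
    𝓡.rightS i (basisT r) = basisT (r * 𝓡.cs.simple i) := by
  rw [rightS, basisT, Finsupp.linearCombination_single, one_smul, if_pos h]

theorem rightS_eq (h : 𝓡.length (r * 𝓡.cs.simple i) = 𝓡.length r) :
    𝓡.rightS i (basisT r) = (X : ℤ[X]) • basisT r := by
  rw [rightS, basisT, Finsupp.linearCombination_single, one_smul, if_neg (by omega), if_pos h]
  rfl

theorem rightS_down (h : 𝓡.length (r * 𝓡.cs.simple i) + 1 = 𝓡.length r) :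
    𝓡.rightS i (basisT r) =
      (X - 1 : ℤ[X]) • basisT r + (X : ℤ[X]) • basisT (r * 𝓡.cs.simple i) := by
  rw [rightS, basisT, Finsupp.linearCombination_single, one_smul, if_neg (by omega),
    if_neg (by omega)]
  rfl

theorem leftΛ_basisT (e r : R) : 𝓡.leftΛ e (basisT r) =
    (X ^ (𝓡.length r - 𝓡.length (e * r)) : ℤ[X]) • basisT (e * r) := by
  rw [leftΛ, basisT, Finsupp.linearCombination_single, one_smul]

theorem rightΛ_basisT (e r : R) : 𝓡.rightΛ e (basisT r) =
    (X ^ (𝓡.length r - 𝓡.length (r * e)) : ℤ[X]) • basisT (r * e) := by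
  rw [rightΛ, basisT, Finsupp.linearCombination_single, one_smul]

theorem leftS_fix (h : (𝓡.cs.simple i : R) * r = r) :
    𝓡.leftS i (basisT r) = (X : ℤ[X]) • basisT r := leftS_eq (by rw [h])

theorem rightS_fix (h : r * (𝓡.cs.simple i : R) = r) :
    𝓡.rightS i (basisT r) = (X : ℤ[X]) • basisT r := rightS_eq (by rw [h])

variable (𝓡)

/-- Away from fixed points all lengths change by one and the expansions match, except when
$\ell(sr)=\ell(rt)$ and $\ell(srt)=\ell(r)$; there $sr=rt$ is needed. -/
theorem commute_leftS_rightS (i j : B) : Commute (𝓡.leftS i) (𝓡.rightS j) := by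
  refine end_ext fun r => ?_
  change 𝓡.leftS i (𝓡.rightS j (basisT r)) = 𝓡.rightS j (𝓡.leftS i (basisT r))
  by_cases hs : (𝓡.cs.simple i : R) * r = r
  · have hs' : (𝓡.cs.simple i : R) * (r * 𝓡.cs.simple j) = r * 𝓡.cs.simple j := by
      rw [← mul_assoc, hs]
    rw [leftS_fix hs, map_smul]
    rcases 𝓡.mul_simple_trichotomy j r with ht | ht | ht
    · rw [rightS_up ht, leftS_fix hs']
    · rw [rightS_fix ht, map_smul, leftS_fix hs]
    · rw [rightS_down ht, map_add, map_smul, map_smul, leftS_fix hs, leftS_fix hs']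
      module
  by_cases ht : r * (𝓡.cs.simple j : R) = r
  · have ht' : (𝓡.cs.simple i : R) * r * 𝓡.cs.simple j = 𝓡.cs.simple i * r := by
      rw [mul_assoc, ht]
    rw [rightS_fix ht, map_smul]
    rcases 𝓡.simple_mul_trichotomy i r with h | h | h
    · rw [leftS_up h, rightS_fix ht']
    · exact absurd h hs
    · rw [leftS_down h, map_add, map_smul, map_smul, rightS_fix ht, rightS_fix ht']
      module
  have hst₁ : 𝓡.length (𝓡.cs.simple i * r * 𝓡.cs.simple j) = 𝓡.length (𝓡.cs.simple i * r) + 1 ∨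
      𝓡.length (𝓡.cs.simple i * r * 𝓡.cs.simple j) + 1 = 𝓡.length (𝓡.cs.simple i * r) := by
    refine (𝓡.mul_simple_trichotomy j (𝓡.cs.simple i * r)).imp_right
      (Or.resolve_left · fun h => ht ?_)
    rwa [mul_assoc, Units.mul_right_inj] at h
  have hst₂ : 𝓡.length (𝓡.cs.simple i * r * 𝓡.cs.simple j) = 𝓡.length (r * 𝓡.cs.simple j) + 1 ∨
      𝓡.length (𝓡.cs.simple i * r * 𝓡.cs.simple j) + 1 = 𝓡.length (r * 𝓡.cs.simple j) := by
    rw [mul_assoc]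
    refine (𝓡.simple_mul_trichotomy i (r * 𝓡.cs.simple j)).imp_right
      (Or.resolve_left · fun h => hs ?_)
    rwa [← mul_assoc, Units.mul_left_inj] at h
  have hassoc := mul_assoc (𝓡.cs.simple i : R) r (𝓡.cs.simple j)
  have hF : 𝓡.length (𝓡.cs.simple i * r) ≠ 𝓡.length r →
      𝓡.length (𝓡.cs.simple i * r) = 𝓡.length (r * 𝓡.cs.simple j) →
      𝓡.length (𝓡.cs.simple i * r * 𝓡.cs.simple j) = 𝓡.length r →
      (𝓡.cs.simple i : R) * r = r * 𝓡.cs.simple j := 𝓡.simple_mul_eq_mul_simple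
  rcases (𝓡.simple_mul_trichotomy i r).imp_right (Or.resolve_left · hs) with h₁ | h₁ <;>
  rcases (𝓡.mul_simple_trichotomy j r).imp_right (Or.resolve_left · ht) with h₂ | h₂
  · rw [leftS_up h₁, rightS_up h₂]
    rcases hst₁ with h₃ | h₃
    · rw [leftS_up (by rw [← hassoc]; omega), rightS_up h₃, hassoc]
    · have := hF (by omega) (by omega) (by omega)
      rw [leftS_down (by rw [← hassoc]; omega), rightS_down h₃, hassoc, this]
  · rw [leftS_up h₁, rightS_down h₂, map_add, map_smul, map_smul, leftS_up h₁,
      leftS_up (by rw [← hassoc]; omega), rightS_down (by omega), hassoc]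
  · rw [leftS_down h₁, rightS_up h₂, map_add, map_smul, map_smul, rightS_up h₂,
      leftS_down (by rw [← hassoc]; omega), rightS_up (by omega), hassoc]
  · rw [leftS_down h₁, rightS_down h₂, map_add, map_smul, map_smul, map_add, map_smul, map_smul,
      leftS_down h₁, rightS_down h₂]
    rcases hst₁ with h₃ | h₃
    · have := hF (by omega) (by omega) (by omega)
      rw [leftS_up (by rw [← hassoc]; omega), rightS_up h₃, hassoc, this]
    · rw [leftS_down (by rw [← hassoc]; omega), rightS_down h₃, hassoc]
      module

/-- `length_mul_lambda_le_of_length_lt` rules out that $s$ moves $r$ and $re$ in opposite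
directions; if $s$ fixes $re$ only, the power of $q$ compensates. -/
theorem commute_leftS_rightΛ (i : B) (he : e ∈ 𝓡.Λ) : Commute (𝓡.leftS i) (𝓡.rightΛ e) := by
  refine end_ext fun r => ?_
  change 𝓡.leftS i (𝓡.rightΛ e (basisT r)) = 𝓡.rightΛ e (𝓡.leftS i (basisT r))
  have hassoc := mul_assoc (𝓡.cs.simple i : R) r e
  have hle := 𝓡.length_mul_lambda_le he r
  have hle' := 𝓡.length_mul_lambda_le he (𝓡.cs.simple i * r)
  rw [rightΛ_basisT, map_smul]
  rcases 𝓡.simple_mul_trichotomy i r with h | h | h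
  · have hK := 𝓡.length_mul_lambda_le_of_length_lt he h
    rw [leftS_up h, rightΛ_basisT]
    rcases 𝓡.simple_mul_trichotomy i (r * e) with h' | h' | h'
    · rw [leftS_up h', ← hassoc]
      rw [← hassoc] at h'
      congr 2
      omega
    · rw [leftS_fix h', hassoc, h', h, smul_smul, ← pow_succ]
      congr 2
      omega
    · rw [← hassoc] at h'
      omega
  · rw [leftS_fix h, leftS_fix (by rw [← hassoc, h]), map_smul, rightΛ_basisT, smul_comm]
  · have hK := 𝓡.length_mul_lambda_le_of_length_lt he (i := i) (r := 𝓡.cs.simple i * r) (by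
      rw [← mul_assoc, ← Units.val_mul, simple_mul_simple_self, Units.val_one, one_mul, h])
    rw [← mul_assoc (𝓡.cs.simple i : R) (𝓡.cs.simple i), ← Units.val_mul, simple_mul_simple_self,
      Units.val_one, one_mul] at hK
    rw [leftS_down h, map_add, map_smul, map_smul, rightΛ_basisT, rightΛ_basisT]
    rcases 𝓡.simple_mul_trichotomy i (r * e) with h' | h' | h'
    · rw [← hassoc] at h'
      omega
    · rw [leftS_fix h', hassoc, h']
      rw [hassoc, h'] at hle'
      -- The coefficients agree by $(q-1)q^{n+1}+q\cdot q^n=q\cdot q^{n+1}$.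
      obtain ⟨n, hn⟩ : ∃ n, 𝓡.length (𝓡.cs.simple i * r) - 𝓡.length (r * e) = n := ⟨_, rfl⟩
      rw [hn, show 𝓡.length r - 𝓡.length (r * e) = n + 1 by omega]
      module
    · rw [leftS_down h', ← hassoc]
      rw [← hassoc] at h'
      rw [show 𝓡.length (𝓡.cs.simple i * r) - 𝓡.length (𝓡.cs.simple i * r * e) =
        𝓡.length r - 𝓡.length (r * e) by omega]
      module

theorem commute_leftΛ_rightS (he : e ∈ 𝓡.Λ) (i : B) : Commute (𝓡.leftΛ e) (𝓡.rightS i) := by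
  refine end_ext fun r => ?_
  change 𝓡.leftΛ e (𝓡.rightS i (basisT r)) = 𝓡.rightS i (𝓡.leftΛ e (basisT r))
  have hassoc := mul_assoc e r (𝓡.cs.simple i : R)
  have hle := 𝓡.length_lambda_mul_le' he r
  have hle' := 𝓡.length_lambda_mul_le' he (r * 𝓡.cs.simple i)
  rw [leftΛ_basisT, map_smul]
  rcases 𝓡.mul_simple_trichotomy i r with h | h | h
  · have hK := 𝓡.length_lambda_mul_le_of_length_lt he h
    rw [rightS_up h, leftΛ_basisT]
    rcases 𝓡.mul_simple_trichotomy i (e * r) with h' | h' | h'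
    · rw [rightS_up h', hassoc]
      rw [hassoc] at h'
      congr 2
      omega
    · rw [rightS_fix h', ← hassoc, h', h, smul_smul, ← pow_succ]
      congr 2
      omega
    · omega
  · rw [rightS_fix h, rightS_fix (by rw [hassoc, h]), map_smul, leftΛ_basisT, smul_comm]
  · have hK := 𝓡.length_lambda_mul_le_of_length_lt he (i := i) (r := r * 𝓡.cs.simple i) (by
      rw [mul_assoc, ← Units.val_mul, simple_mul_simple_self, Units.val_one, mul_one, h])
    rw [mul_assoc e, mul_assoc r, ← Units.val_mul, simple_mul_simple_self, Units.val_one,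
      mul_one] at hK
    rw [rightS_down h, map_add, map_smul, map_smul, leftΛ_basisT, leftΛ_basisT]
    rcases 𝓡.mul_simple_trichotomy i (e * r) with h' | h' | h'
    · rw [hassoc] at h'
      omega
    · rw [rightS_fix h', ← hassoc, h']
      rw [← hassoc, h'] at hle'
      obtain ⟨n, hn⟩ : ∃ n, 𝓡.length (r * 𝓡.cs.simple i) - 𝓡.length (e * r) = n := ⟨_, rfl⟩
      rw [hn, show 𝓡.length r - 𝓡.length (e * r) = n + 1 by omega]
      module
    · rw [rightS_down h', hassoc]
      rw [hassoc] at h'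
      rw [show 𝓡.length (r * 𝓡.cs.simple i) - 𝓡.length (e * (r * 𝓡.cs.simple i)) =
        𝓡.length r - 𝓡.length (e * r) by omega]
      module

/-- Both exponents telescope to $\ell(r)-\ell(erf)$; truncated subtraction is harmless as the
lengths only decrease. -/
theorem commute_leftΛ_rightΛ (he : e ∈ 𝓡.Λ) (hf : f ∈ 𝓡.Λ) :
    Commute (𝓡.leftΛ e) (𝓡.rightΛ f) := by
  refine end_ext fun r => ?_
  change 𝓡.leftΛ e (𝓡.rightΛ f (basisT r)) = 𝓡.rightΛ f (𝓡.leftΛ e (basisT r))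
  have h1 := 𝓡.length_lambda_mul_le' he r
  have h2 := 𝓡.length_lambda_mul_le' he (r * f)
  have h3 := 𝓡.length_mul_lambda_le hf r
  have h4 := 𝓡.length_mul_lambda_le hf (e * r)
  simp only [leftΛ_basisT, rightΛ_basisT, map_smul, smul_smul, ← pow_add, mul_assoc] at *
  congr 2
  omega

/-- Left multiplication by `T_x`, `x ∈ S ∪ Λ∘`. -/
noncomputable def leftOp : 𝓡.Letter → Module.End ℤ[X] (R →₀ ℤ[X])
  | Sum.inl i => 𝓡.leftS i
  | Sum.inr e => 𝓡.leftΛ e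

/-- Right multiplication by `T_x`, `x ∈ S ∪ Λ∘`. -/
noncomputable def rightOp : 𝓡.Letter → Module.End ℤ[X] (R →₀ ℤ[X])
  | Sum.inl i => 𝓡.rightS i
  | Sum.inr e => 𝓡.rightΛ e

theorem commute_leftOp_rightOp : ∀ x y : 𝓡.Letter, Commute (𝓡.leftOp x) (𝓡.rightOp y)
  | Sum.inl i, Sum.inl j => 𝓡.commute_leftS_rightS i j
  | Sum.inl i, Sum.inr f => 𝓡.commute_leftS_rightΛ i f.2.1
  | Sum.inr e, Sum.inl j => 𝓡.commute_leftΛ_rightS e.2.1 j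
  | Sum.inr e, Sum.inr f => 𝓡.commute_leftΛ_rightΛ e.2.1 f.2.1

variable {𝓡}

theorem leftOp_basisT {x : 𝓡.Letter}
    (h : 𝓡.length (𝓡.letterVal x * r) = 𝓡.letterLength x + 𝓡.length r) :
    𝓡.leftOp x (basisT r) = basisT (𝓡.letterVal x * r) := by
  rcases x with i | e
  · exact leftS_up (by rw [add_comm]; exact h)
  · refine (leftΛ_basisT _ _).trans ?_
    have h' : 𝓡.length (e * r) = 0 + 𝓡.length r := h
    rw [h', Nat.zero_add, Nat.sub_self, pow_zero, one_smul]
    rfl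

theorem rightOp_basisT {x : 𝓡.Letter}
    (h : 𝓡.length (r * 𝓡.letterVal x) = 𝓡.length r + 𝓡.letterLength x) :
    𝓡.rightOp x (basisT r) = basisT (r * 𝓡.letterVal x) := by
  rcases x with i | e
  · exact rightS_up h
  · refine (rightΛ_basisT _ _).trans ?_
    have h' : 𝓡.length (r * e) = 𝓡.length r + 0 := h
    rw [h', Nat.add_zero, Nat.sub_self, pow_zero, one_smul]
    rfl

/-- Suffixes of a minimal word are minimal, so no letter produces a coefficient. -/
theorem prod_leftOp_basisT_one {ω : List 𝓡.Letter}
    (h : (ω.map 𝓡.letterLength).sum = 𝓡.length (ω.map 𝓡.letterVal).prod) :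
    (ω.map 𝓡.leftOp).prod (basisT 1) = basisT (ω.map 𝓡.letterVal).prod := by
  induction ω with
  | nil => simp
  | cons x ω ih =>
    simp only [List.map_cons, List.prod_cons, List.sum_cons] at h ⊢
    have h1 := 𝓡.length_mul_le (𝓡.letterVal x) (ω.map 𝓡.letterVal).prod
    have h2 := 𝓡.length_letterVal_le x
    have h3 := 𝓡.length_le ω
    rw [Module.End.mul_apply, ih (by omega), leftOp_basisT (by omega)]

theorem prod_rightOp_basisT_one {ω : List 𝓡.Letter}
    (h : (ω.map 𝓡.letterLength).sum = 𝓡.length (ω.reverse.map 𝓡.letterVal).prod) :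
    (ω.map 𝓡.rightOp).prod (basisT 1) = basisT (ω.reverse.map 𝓡.letterVal).prod := by
  induction ω with
  | nil => simp
  | cons x ω ih =>
    simp only [List.map_cons, List.prod_cons, List.sum_cons, List.reverse_cons, List.map_append,
      List.prod_append, List.map_nil, List.prod_nil, mul_one] at h ⊢
    have h1 := 𝓡.length_mul_le (ω.reverse.map 𝓡.letterVal).prod (𝓡.letterVal x)
    have h2 := 𝓡.length_letterVal_le x
    have h3 := 𝓡.length_le ω.reverse
    rw [List.map_reverse (f := 𝓡.letterLength), List.sum_reverse] at h3
    rw [Module.End.mul_apply, ih (by omega), rightOp_basisT (by omega)]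

variable (𝓡)

theorem exists_prod_leftOp (r : R) :
    ∃ ω : List 𝓡.Letter, (ω.map 𝓡.leftOp).prod (basisT 1) = basisT r := by
  obtain ⟨ω, rfl, h⟩ := 𝓡.exists_minimal_word r
  exact ⟨ω, prod_leftOp_basisT_one h⟩

theorem exists_prod_rightOp (r : R) :
    ∃ ω : List 𝓡.Letter, (ω.map 𝓡.rightOp).prod (basisT 1) = basisT r := by
  obtain ⟨ω, rfl, h⟩ := 𝓡.exists_minimal_word r
  refine ⟨ω.reverse, ?_⟩
  rw [prod_rightOp_basisT_one, List.reverse_reverse]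
  rw [List.reverse_reverse, ← h, List.map_reverse, List.sum_reverse]

variable {𝓡}

/-- An endomorphism that commutes with the right multiplications is determined by its value at
`T_1`. -/
theorem eq_of_commute_rightOp {F G : Module.End ℤ[X] (R →₀ ℤ[X])}
    (hF : ∀ x, Commute F (𝓡.rightOp x)) (hG : ∀ x, Commute G (𝓡.rightOp x))
    (h : F (basisT 1) = G (basisT 1)) : F = G := by
  refine end_ext fun r => ?_
  obtain ⟨ω, hω⟩ := 𝓡.exists_prod_rightOp r
  have key : ∀ {F : Module.End ℤ[X] (R →₀ ℤ[X])}, (∀ x, Commute F (𝓡.rightOp x)) →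
      F * (ω.map 𝓡.rightOp).prod = (ω.map 𝓡.rightOp).prod * F := fun {F} hF =>
    Commute.list_prod_right _ _ fun y hy => by
      obtain ⟨x, -, rfl⟩ := List.mem_map.1 hy
      exact hF x
  rw [← hω, ← Module.End.mul_apply, ← Module.End.mul_apply, key hF, key hG, Module.End.mul_apply, h,
    Module.End.mul_apply]

theorem prod_leftS_basisT {ω : List B}
    (h : 𝓡.length (𝓡.cs.wordProd ω * r) = ω.length + 𝓡.length r) :
    (ω.map 𝓡.leftS).prod (basisT r) = basisT (𝓡.cs.wordProd ω * r) := by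
  induction ω with
  | nil => simp
  | cons i ω ih =>
    rw [wordProd_cons, Units.val_mul, mul_assoc, List.length_cons] at h
    have h1 := 𝓡.length_mul_le (𝓡.cs.simple i) (𝓡.cs.wordProd ω * r)
    have h2 := 𝓡.length_mul_le (𝓡.cs.wordProd ω) r
    have h3 := 𝓡.length_units_le (𝓡.cs.wordProd ω)
    have h4 := 𝓡.cs.length_wordProd_le ω
    rw [𝓡.length_simple] at h1
    rw [List.map_cons, List.prod_cons, Module.End.mul_apply, ih (by omega),
      leftS_up (by omega), wordProd_cons, Units.val_mul, mul_assoc]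

theorem prod_leftS_basisT_one {ω : List B} (h : 𝓡.cs.IsReduced ω) :
    (ω.map 𝓡.leftS).prod (basisT 1) = basisT (𝓡.cs.wordProd ω : R) := by
  rw [prod_leftS_basisT, mul_one]
  rw [mul_one, length_unit, h.eq, 𝓡.length_one, add_zero]

end Operators

/-! ### The action of the presented algebra on $V$ -/

section Representation

theorem map_altProd {A A' F : Type*} [Monoid A] [Monoid A'] [FunLike F A A'] [MonoidHomClass F A A']
    (φ : F) (a b : A) (m : ℕ) : φ (altProd a b m) = altProd (φ a) (φ b) m := by
  induction m generalizing a b with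
  | zero => exact map_one φ
  | succ m ih => rw [altProd, map_mul, ih, altProd]

/-- The action of the free algebra on the free module by left multiplications. -/
noncomputable def freeAction : FreeAlgebra ℤ[X] 𝓡.Letter →ₐ[ℤ[X]] Module.End ℤ[X] (R →₀ ℤ[X]) :=
  FreeAlgebra.lift ℤ[X] 𝓡.leftOp

theorem freeAction_genS (i : B) : 𝓡.freeAction (𝓡.genS i) = 𝓡.leftS i :=
  FreeAlgebra.lift_ι_apply _ _

theorem freeAction_genΛ (e : 𝓡.LambdaCirc) : 𝓡.freeAction (𝓡.genΛ e) = 𝓡.leftΛ e :=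
  FreeAlgebra.lift_ι_apply _ _

theorem freeAction_genWord (ω : List B) :
    𝓡.freeAction (𝓡.genWord ω) = (ω.map 𝓡.leftS).prod := by
  rw [genWord, map_list_prod, List.map_map]
  congr 2
  funext i
  exact 𝓡.freeAction_genS i

theorem commute_freeAction_rightOp (a : FreeAlgebra ℤ[X] 𝓡.Letter) (x : 𝓡.Letter) :
    Commute (𝓡.freeAction a) (𝓡.rightOp x) := by
  induction a using FreeAlgebra.induction with
  | grade0 c =>
    rw [AlgHom.commutes]
    exact Algebra.commutes c _
  | grade1 y =>
    rw [freeAction, FreeAlgebra.lift_ι_apply]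
    exact 𝓡.commute_leftOp_rightOp y x
  | mul a b ha hb => rw [map_mul]; exact ha.mul_left hb
  | add a b ha hb => rw [map_add]; exact ha.add_left hb

theorem leftS_basisT_one (i : B) : 𝓡.leftS i (basisT 1) = basisT (𝓡.cs.simple i : R) := by
  rw [leftS_up, mul_one]
  rw [mul_one, 𝓡.length_simple, 𝓡.length_one]

theorem leftΛ_basisT_one (e : R) : 𝓡.leftΛ e (basisT 1) = basisT e := by
  rw [leftΛ_basisT, 𝓡.length_one, Nat.zero_sub, pow_zero, one_smul, mul_one]

/-- Both sides commute with the right operators, so they need only be compared on $T_1$, where all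
lengths that occur are known. -/
theorem freeAction_eq_of_rel {word : Rˣ → List B}
    (hword : ∀ w : Rˣ, 𝓡.cs.IsReduced (word w) ∧ 𝓡.cs.wordProd (word w) = w)
    {a b : FreeAlgebra ℤ[X] 𝓡.Letter} (h : 𝓡.HeckeRel word a b) :
    𝓡.freeAction a = 𝓡.freeAction b := by
  refine eq_of_commute_rightOp (𝓡.commute_freeAction_rightOp a) (𝓡.commute_freeAction_rightOp b) ?_
  cases h with
  | quadratic i =>
    rw [map_mul, map_add, map_smul, map_smul, map_one, freeAction_genS, Module.End.mul_apply,
      LinearMap.add_apply, LinearMap.smul_apply, LinearMap.smul_apply, leftS_basisT_one]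
    have h : (𝓡.cs.simple i : R) * 𝓡.cs.simple i = 1 := by
      rw [← Units.val_mul, simple_mul_simple_self, Units.val_one]
    rw [leftS_down, h, Module.End.one_apply]
    rw [h, 𝓡.length_one, 𝓡.length_simple]
  | braid i j hij hM =>
    have key : ∀ {i j : B}, i ≠ j → altProd (𝓡.leftS i) (𝓡.leftS j) (M i j) (basisT 1) =
        basisT (𝓡.cs.wordProd (altWord i j (M i j)) : R) := by
      intro i j hij
      rw [← prod_map_altWord, prod_leftS_basisT_one (𝓡.cs.isReduced_altWord hij le_rfl)]
    rw [map_altProd, map_altProd, freeAction_genS, freeAction_genS, key hij,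
      wordProd_altWord_braid, M.symmetric i j, key hij.symm]
  | upper i e hi =>
    have h := 𝓡.length_mul_of_isRightMin e.2.1 (𝓡.isRightMin_of_mem_upperType
      (simple_mem_standardParabolic 𝓡.cs hi))
    rw [CoxeterSystem.length_simple] at h
    rw [map_mul, map_mul, freeAction_genS, freeAction_genΛ, Module.End.mul_apply,
      Module.End.mul_apply, leftΛ_basisT_one, leftS_basisT_one,
      leftS_up (by rw [h, 𝓡.length_of_mem_Λ e.2.1]), leftΛ_basisT, ← hi.1, h, 𝓡.length_simple,
      Nat.sub_self, pow_zero, one_smul]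
  | lower_left i e hi =>
    rw [map_mul, map_smul, freeAction_genS, freeAction_genΛ, Module.End.mul_apply,
      LinearMap.smul_apply, leftΛ_basisT_one, leftS_fix hi.1]
  | lower_right i e hi =>
    rw [map_mul, map_smul, freeAction_genS, freeAction_genΛ, Module.End.mul_apply,
      LinearMap.smul_apply, leftΛ_basisT_one, leftS_basisT_one, leftΛ_basisT, hi.2,
      𝓡.length_simple, 𝓡.length_of_mem_Λ e.2.1, Nat.sub_zero, pow_one]
  | wedge e f h w hw hh =>
    have h1 : 𝓡.length (w * (f : R)) = 𝓡.cs.length w :=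
      𝓡.length_mul_of_isRightMin f.2.1 ((IsDoubleReduced.isRightMin hw).mono
        (𝓡.lowerType_subset_typeMap _))
    have h2 := (𝓡.isWedge_iff e.2.1 f.2.1 hw).1 hh
    have h3 := (hword w).1.eq
    rw [(hword w).2] at h3
    rw [map_mul, map_mul, map_smul, freeAction_genΛ, freeAction_genΛ, freeAction_genΛ,
      freeAction_genWord, Module.End.mul_apply, Module.End.mul_apply, LinearMap.smul_apply,
      leftΛ_basisT_one, leftΛ_basisT_one, prod_leftS_basisT, leftΛ_basisT, (hword w).2, h1,
      ← mul_assoc, ← h2, 𝓡.length_of_mem_Λ h.2.1, Nat.sub_zero]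
    rw [(hword w).2, h1, h3, 𝓡.length_of_mem_Λ f.2.1, add_zero]

/-- The action of the presented algebra on the free module by left multiplications. -/
noncomputable def presentedAction {word : Rˣ → List B}
    (hword : ∀ w : Rˣ, 𝓡.cs.IsReduced (word w) ∧ 𝓡.cs.wordProd (word w) = w) :
    𝓡.PresentedHecke word →ₐ[ℤ[X]] Module.End ℤ[X] (R →₀ ℤ[X]) :=
  RingQuot.liftAlgHom ℤ[X] ⟨𝓡.freeAction, fun _ _ h => 𝓡.freeAction_eq_of_rel hword h⟩

theorem presentedAction_mkAlgHom {word : Rˣ → List B}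
    (hword : ∀ w : Rˣ, 𝓡.cs.IsReduced (word w) ∧ 𝓡.cs.wordProd (word w) = w)
    (a : FreeAlgebra ℤ[X] 𝓡.Letter) :
    𝓡.presentedAction hword (RingQuot.mkAlgHom ℤ[X] (𝓡.HeckeRel word) a) = 𝓡.freeAction a :=
  RingQuot.liftAlgHom_mkAlgHom_apply _ _ _ _

theorem presentedAction_presentedGen {word : Rˣ → List B}
    (hword : ∀ w : Rˣ, 𝓡.cs.IsReduced (word w) ∧ 𝓡.cs.wordProd (word w) = w) (x : 𝓡.Letter) :
    𝓡.presentedAction hword (𝓡.presentedGen word x) = 𝓡.leftOp x := by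
  rw [presentedGen, presentedAction_mkAlgHom, freeAction, FreeAlgebra.lift_ι_apply]

end Representation

end RennerCoxeterSystem

/-! ### Normal forms span the presented algebra -/

namespace RennerCoxeterSystem

variable {B R : Type*} [Monoid R] {M : CoxeterMatrix B} (𝓡 : RennerCoxeterSystem M R)
variable {e f g : R}

section Presented

variable (word : Rˣ → List B)

/-- The generator `T_s` of the presented algebra. -/
noncomputable def presentedS (i : B) : 𝓡.PresentedHecke word := 𝓡.presentedGen word (Sum.inl i)

open Classical in
/-- The generator `T_g` of the presented algebra for `g ∈ Λ∘`, and the unit for `g = 1`. -/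
noncomputable def presentedΛ (g : R) : 𝓡.PresentedHecke word :=
  if h : g ∈ 𝓡.LambdaCirc then 𝓡.presentedGen word (Sum.inr ⟨g, h⟩) else 1

/-- The element `T_w` of the presented algebra, for a unit `w`. -/
noncomputable def presentedW (w : Rˣ) : 𝓡.PresentedHecke word :=
  ((word w).map (𝓡.presentedS word)).prod

variable {word} {i : B}

theorem presentedΛ_eq (h : g ∈ 𝓡.LambdaCirc) :
    𝓡.presentedΛ word g = 𝓡.presentedGen word (Sum.inr ⟨g, h⟩) := dif_pos h

theorem presentedΛ_one : 𝓡.presentedΛ word 1 = 1 := dif_neg fun h => h.2 rfl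

theorem mkAlgHom_genS (i : B) :
    RingQuot.mkAlgHom ℤ[X] (𝓡.HeckeRel word) (𝓡.genS i) = 𝓡.presentedS word i := rfl

theorem mkAlgHom_genΛ (h : g ∈ 𝓡.LambdaCirc) :
    RingQuot.mkAlgHom ℤ[X] (𝓡.HeckeRel word) (𝓡.genΛ ⟨g, h⟩) = 𝓡.presentedΛ word g :=
  (𝓡.presentedΛ_eq h).symm

theorem presentedS_mul_self (i : B) : 𝓡.presentedS word i * 𝓡.presentedS word i =
    (X - 1 : ℤ[X]) • 𝓡.presentedS word i + (X : ℤ[X]) • 1 := by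
  have h := RingQuot.mkAlgHom_rel ℤ[X] (HeckeRel.quadratic (𝓡 := 𝓡) (word := word) i)
  simpa only [map_mul, map_add, map_smul, map_one, mkAlgHom_genS] using h

theorem presentedS_braid (i j : B) (hij : i ≠ j) (hM : M i j ≠ 0) :
    altProd (𝓡.presentedS word i) (𝓡.presentedS word j) (M i j) =
      altProd (𝓡.presentedS word j) (𝓡.presentedS word i) (M i j) := by
  have h := RingQuot.mkAlgHom_rel ℤ[X] (HeckeRel.braid (𝓡 := 𝓡) (word := word) i j hij hM)
  simpa only [map_altProd, mkAlgHom_genS] using h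

theorem presentedS_mul_presentedΛ_upper (hg : g ∈ 𝓡.Λ) (hi : i ∈ upperType 𝓡.cs g) :
    𝓡.presentedS word i * 𝓡.presentedΛ word g = 𝓡.presentedΛ word g * 𝓡.presentedS word i := by
  by_cases h1 : g = 1
  · simp [h1, presentedΛ_one]
  have hg' : g ∈ 𝓡.LambdaCirc := ⟨hg, h1⟩
  have h := RingQuot.mkAlgHom_rel ℤ[X] (HeckeRel.upper (𝓡 := 𝓡) (word := word) i ⟨g, hg'⟩ hi)
  simpa only [map_mul, mkAlgHom_genS, mkAlgHom_genΛ] using h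

theorem ne_one_of_mem_lowerType (hi : i ∈ lowerType 𝓡.cs g) : g ≠ 1 := by
  rintro rfl
  have h1 : (𝓡.cs.simple i : R) * 1 = 1 := hi.1
  rw [mul_one, Units.val_eq_one] at h1
  have := 𝓡.cs.length_simple i
  rw [h1, CoxeterSystem.length_one] at this
  omega

theorem presentedS_mul_presentedΛ_lower (hg : g ∈ 𝓡.Λ) (hi : i ∈ lowerType 𝓡.cs g) :
    𝓡.presentedS word i * 𝓡.presentedΛ word g = (X : ℤ[X]) • 𝓡.presentedΛ word g := by
  have hg' : g ∈ 𝓡.LambdaCirc := ⟨hg, 𝓡.ne_one_of_mem_lowerType hi⟩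
  have h := RingQuot.mkAlgHom_rel ℤ[X] (HeckeRel.lower_left (𝓡 := 𝓡) (word := word) i ⟨g, hg'⟩ hi)
  simpa only [map_mul, map_smul, mkAlgHom_genS, mkAlgHom_genΛ] using h

theorem presentedΛ_mul_presentedS_lower (hg : g ∈ 𝓡.Λ) (hi : i ∈ lowerType 𝓡.cs g) :
    𝓡.presentedΛ word g * 𝓡.presentedS word i = (X : ℤ[X]) • 𝓡.presentedΛ word g := by
  have hg' : g ∈ 𝓡.LambdaCirc := ⟨hg, 𝓡.ne_one_of_mem_lowerType hi⟩
  have h := RingQuot.mkAlgHom_rel ℤ[X] (HeckeRel.lower_right (𝓡 := 𝓡) (word := word) i ⟨g, hg'⟩ hi)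
  simpa only [map_mul, map_smul, mkAlgHom_genS, mkAlgHom_genΛ] using h

theorem presentedW_eq_mkAlgHom (w : Rˣ) :
    𝓡.presentedW word w = RingQuot.mkAlgHom ℤ[X] (𝓡.HeckeRel word) (𝓡.genWord (word w)) := by
  rw [genWord, map_list_prod, List.map_map]
  rfl

variable (hword : ∀ w : Rˣ, 𝓡.cs.IsReduced (word w) ∧ 𝓡.cs.wordProd (word w) = w)
include hword

/-- Matsumoto's theorem removes the dependence on the chosen words. -/
theorem presentedW_wordProd {ω : List B} (hω : 𝓡.cs.IsReduced ω) :
    𝓡.presentedW word (𝓡.cs.wordProd ω) = (ω.map (𝓡.presentedS word)).prod :=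
  𝓡.cs.prod_map_eq_of_isReduced 𝓡.presentedS_braid (hword _).1 hω (hword _).2

theorem presentedW_one : 𝓡.presentedW word 1 = 1 := by
  have := 𝓡.presentedW_wordProd hword (ω := []) (by simp [CoxeterSystem.IsReduced])
  simpa using this

theorem presentedW_mul {u v : Rˣ} (h : 𝓡.cs.length (u * v) = 𝓡.cs.length u + 𝓡.cs.length v) :
    𝓡.presentedW word (u * v) = 𝓡.presentedW word u * 𝓡.presentedW word v := by
  obtain ⟨ω, hω, rfl⟩ := 𝓡.cs.exists_isReduced u
  obtain ⟨ν, hν, rfl⟩ := 𝓡.cs.exists_isReduced v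
  rw [← wordProd_append, 𝓡.presentedW_wordProd hword (hω.append hν h),
    𝓡.presentedW_wordProd hword hω, 𝓡.presentedW_wordProd hword hν, List.map_append,
    List.prod_append]

theorem presentedW_simple (i : B) : 𝓡.presentedW word (𝓡.cs.simple i) = 𝓡.presentedS word i := by
  have := 𝓡.presentedW_wordProd hword (ω := [i]) (by simp [CoxeterSystem.IsReduced])
  simpa using this

/-- If $s$ shortens $w$, write $T_w=T_sT_{sw}$ and use the quadratic relation. -/
theorem presentedS_mul_presentedW_mem_span (i : B) (w : Rˣ) :
    𝓡.presentedS word i * 𝓡.presentedW word w ∈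
      Submodule.span ℤ[X] (Set.range (𝓡.presentedW word)) := by
  rcases 𝓡.cs.length_simple_mul w i with h | h
  · rw [← 𝓡.presentedW_simple hword i, ← 𝓡.presentedW_mul hword (by
      rw [h, CoxeterSystem.length_simple, add_comm])]
    exact Submodule.subset_span ⟨_, rfl⟩
  · have h1 : 𝓡.presentedW word w =
        𝓡.presentedS word i * 𝓡.presentedW word (𝓡.cs.simple i * w) := by
      rw [← 𝓡.presentedW_simple hword i, ← 𝓡.presentedW_mul hword (by
        rw [simple_mul_simple_cancel_left, CoxeterSystem.length_simple]; omega),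
        simple_mul_simple_cancel_left]
    rw [h1, ← mul_assoc, presentedS_mul_self, add_mul, smul_mul_assoc, ← h1, smul_mul_assoc,
      one_mul]
    exact add_mem (Submodule.smul_mem _ _ (Submodule.subset_span ⟨_, rfl⟩))
      (Submodule.smul_mem _ _ (Submodule.subset_span ⟨_, rfl⟩))

omit hword in
variable (word) in
/-- The subalgebra generated by the `T_s`, `s ∈ S`. -/
noncomputable def presentedUnits : Subalgebra ℤ[X] (𝓡.PresentedHecke word) :=
  Algebra.adjoin ℤ[X] (Set.range (𝓡.presentedS word))

omit hword in
theorem presentedS_mem (i : B) : 𝓡.presentedS word i ∈ 𝓡.presentedUnits word :=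
  Algebra.subset_adjoin ⟨i, rfl⟩

omit hword in
theorem presentedW_mem (w : Rˣ) : 𝓡.presentedW word w ∈ 𝓡.presentedUnits word := by
  refine Subalgebra.list_prod_mem _ fun x hx => ?_
  obtain ⟨i, -, rfl⟩ := List.mem_map.1 hx
  exact 𝓡.presentedS_mem i

theorem mem_span_of_mem_presentedUnits {a : 𝓡.PresentedHecke word}
    (ha : a ∈ 𝓡.presentedUnits word) :
    a ∈ Submodule.span ℤ[X] (Set.range (𝓡.presentedW word)) := by
  rw [presentedUnits, ← Subalgebra.mem_toSubmodule, Algebra.adjoin_eq_span] at ha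
  refine Submodule.span_le.2 (fun x hx => ?_) ha
  induction hx using Submonoid.closure_induction_left with
  | one => exact Submodule.subset_span ⟨1, 𝓡.presentedW_one hword⟩
  | mul_left x hx y hy ih =>
    clear hy
    obtain ⟨i, rfl⟩ := hx
    rw [SetLike.mem_coe] at ih ⊢
    induction ih using Submodule.span_induction with
    | mem y hy =>
      obtain ⟨w, rfl⟩ := hy
      exact 𝓡.presentedS_mul_presentedW_mem_span hword i w
    | zero => rw [mul_zero]; exact zero_mem _
    | add y z _ _ hy hz => rw [mul_add]; exact add_mem hy hz
    | smul c y _ hy => rw [mul_smul_comm]; exact Submodule.smul_mem _ _ hy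

/-- Letters of $\lambda^\star(g)$ commute with $T_g$, and those of $\lambda_\star(g)$ turn into
factors $q$. -/
theorem exists_presentedΛ_mul (hg : g ∈ 𝓡.Λ) {c : Rˣ}
    (hc : c ∈ standardParabolic 𝓡.cs (typeMap 𝓡.cs g)) :
    ∃ a ∈ 𝓡.presentedUnits word,
      𝓡.presentedΛ word g * 𝓡.presentedW word c = a * 𝓡.presentedΛ word g := by
  obtain ⟨ω, hω, hI, rfl⟩ := exists_isReduced_of_mem_standardParabolic 𝓡.cs hc
  rw [𝓡.presentedW_wordProd hword hω]
  clear hc hω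
  induction ω with
  | nil => exact ⟨1, one_mem _, by simp⟩
  | cons i ω ih =>
    obtain ⟨a, ha, h⟩ := ih fun j hj => hI j (List.mem_cons_of_mem _ hj)
    rw [List.map_cons, List.prod_cons, ← mul_assoc]
    rcases 𝓡.mem_upperType_or_mem_lowerType (hI i List.mem_cons_self) with hi | hi
    · refine ⟨𝓡.presentedS word i * a, MulMemClass.mul_mem (𝓡.presentedS_mem i) ha, ?_⟩
      rw [← 𝓡.presentedS_mul_presentedΛ_upper hg hi, mul_assoc, h, mul_assoc]
    · refine ⟨(X : ℤ[X]) • a, Subalgebra.smul_mem _ ha _, ?_⟩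
      rw [𝓡.presentedΛ_mul_presentedS_lower hg hi, smul_mul_assoc, h, smul_mul_assoc]

theorem exists_mul_presentedΛ (hg : g ∈ 𝓡.Λ) {c : Rˣ}
    (hc : c ∈ standardParabolic 𝓡.cs (typeMap 𝓡.cs g)) :
    ∃ a ∈ 𝓡.presentedUnits word,
      𝓡.presentedW word c * 𝓡.presentedΛ word g = 𝓡.presentedΛ word g * a := by
  obtain ⟨ω, hω, hI, rfl⟩ := exists_isReduced_of_mem_standardParabolic 𝓡.cs hc
  rw [𝓡.presentedW_wordProd hword hω]
  clear hc hω
  induction ω with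
  | nil => exact ⟨1, one_mem _, by simp⟩
  | cons i ω ih =>
    obtain ⟨a, ha, h⟩ := ih fun j hj => hI j (List.mem_cons_of_mem _ hj)
    rw [List.map_cons, List.prod_cons, mul_assoc, h, ← mul_assoc]
    rcases 𝓡.mem_upperType_or_mem_lowerType (hI i List.mem_cons_self) with hi | hi
    · refine ⟨𝓡.presentedS word i * a, MulMemClass.mul_mem (𝓡.presentedS_mem i) ha, ?_⟩
      rw [𝓡.presentedS_mul_presentedΛ_upper hg hi, mul_assoc]
    · refine ⟨(X : ℤ[X]) • a, Subalgebra.smul_mem _ ha _, ?_⟩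
      rw [𝓡.presentedS_mul_presentedΛ_lower hg hi, smul_mul_assoc, mul_smul_comm]

theorem presentedW_mul_presentedΛ_of_mem_unitStabilizer (hg : g ∈ 𝓡.Λ) {y : Rˣ}
    (hy : y ∈ standardParabolic 𝓡.cs (lowerType 𝓡.cs g)) :
    𝓡.presentedW word y * 𝓡.presentedΛ word g =
      (X ^ 𝓡.cs.length y : ℤ[X]) • 𝓡.presentedΛ word g := by
  obtain ⟨ω, hω, hI, rfl⟩ := exists_isReduced_of_mem_standardParabolic 𝓡.cs hy
  rw [𝓡.presentedW_wordProd hword hω, hω.eq]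
  clear hy hω
  induction ω with
  | nil => simp
  | cons i ω ih =>
    rw [List.map_cons, List.prod_cons, mul_assoc, ih fun j hj => hI j (List.mem_cons_of_mem _ hj),
      mul_smul_comm, 𝓡.presentedS_mul_presentedΛ_lower hg (hI i List.mem_cons_self), smul_smul,
      ← pow_succ, List.length_cons]

theorem presentedΛ_wedge (he : e ∈ 𝓡.LambdaCirc) (hg : g ∈ 𝓡.Λ) {w : Rˣ} (hw : w ∈ 𝓡.Red e g) :
    𝓡.presentedΛ word e * 𝓡.presentedW word w * 𝓡.presentedΛ word g =
      (X ^ 𝓡.cs.length w : ℤ[X]) • 𝓡.presentedΛ word (e * w * g) := by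
  -- The wedge relation is imposed only for $g\in\Lambda_\circ$. For $g=1$ the group $W(g)$ is all
  -- of $W$, so $w=1$.
  by_cases h1 : g = 1
  · subst h1
    have : w = 1 := (IsDoubleReduced.isRightMin hw).eq_one (by
      rw [← 𝓡.unitCentralizer_eq hg, mem_unitCentralizer_iff, mul_one, one_mul])
    subst this
    simp [𝓡.presentedΛ_one, 𝓡.presentedW_one hword]
  · have hc := 𝓡.wedge_mem_LambdaCirc he hg hw
    have hg' : g ∈ 𝓡.LambdaCirc := ⟨hg, h1⟩
    have h := RingQuot.mkAlgHom_rel ℤ[X] (HeckeRel.wedge (𝓡 := 𝓡) (word := word)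
      ⟨e, he⟩ ⟨g, hg'⟩ ⟨_, hc⟩ w hw ((𝓡.isWedge_iff he.1 hg hw).2 rfl))
    simpa only [map_mul, map_smul, mkAlgHom_genΛ, ← presentedW_eq_mkAlgHom] using h

omit hword in
variable (word) in
/-- The element of the presented algebra attached to the normal form of `r`. -/
noncomputable def presentedNormal (r : R) : 𝓡.PresentedHecke word :=
  𝓡.presentedW word (𝓡.exists_isNormal r).choose *
    𝓡.presentedΛ word (𝓡.exists_isNormal r).choose_spec.choose *
    𝓡.presentedW word (𝓡.exists_isNormal r).choose_spec.choose_spec.choose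

omit hword in
theorem presentedNormal_eq {u v : Rˣ} (h : 𝓡.IsNormal u g v) :
    𝓡.presentedNormal word (u * g * v) =
      𝓡.presentedW word u * 𝓡.presentedΛ word g * 𝓡.presentedW word v := by
  have key : ∀ r : R, ∃ u g v, 𝓡.IsNormal u g v ∧ r = u * g * v ∧ 𝓡.presentedNormal word r =
      𝓡.presentedW word u * 𝓡.presentedΛ word g * 𝓡.presentedW word v := fun r =>
    have h := (𝓡.exists_isNormal r).choose_spec.choose_spec.choose_spec
    ⟨_, _, _, h.1, h.2, rfl⟩
  obtain ⟨u', g', v', h1, h2, h3⟩ := key (u * g * v)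
  obtain ⟨rfl, rfl, rfl⟩ := h.unique h1 h2
  exact h3

/-- As for normal forms in $R$: the $W(g)$-part of the right factor moves left across $T_g$, then
the $W_\star(g)$-part of the left factor becomes a power of $q$. -/
theorem mul_presentedΛ_mul_mem {a b : 𝓡.PresentedHecke word} (ha : a ∈ 𝓡.presentedUnits word)
    (hg : g ∈ 𝓡.Λ) (hb : b ∈ 𝓡.presentedUnits word) :
    a * 𝓡.presentedΛ word g * b ∈ Submodule.span ℤ[X] (Set.range (𝓡.presentedNormal word)) := by
  have step : ∀ v, IsLeftMin 𝓡.cs (typeMap 𝓡.cs g) v → ∀ a ∈ 𝓡.presentedUnits word,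
      a * 𝓡.presentedΛ word g * 𝓡.presentedW word v ∈
        Submodule.span ℤ[X] (Set.range (𝓡.presentedNormal word)) := by
    intro v hv a ha
    replace ha := 𝓡.mem_span_of_mem_presentedUnits hword ha
    induction ha using Submodule.span_induction with
    | mem y hy =>
      obtain ⟨u, rfl⟩ := hy
      obtain ⟨x, y, hx, hy, rfl⟩ := exists_isRightMin_mul 𝓡.cs (lowerType 𝓡.cs g) u
      rw [𝓡.presentedW_mul hword (hx.length_mul hy), mul_assoc (𝓡.presentedW word x),
        𝓡.presentedW_mul_presentedΛ_of_mem_unitStabilizer hword hg hy, mul_smul_comm,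
        smul_mul_assoc, ← 𝓡.presentedNormal_eq ⟨hg, hx, hv⟩]
      exact Submodule.smul_mem _ _ (Submodule.subset_span ⟨_, rfl⟩)
    | zero => rw [zero_mul, zero_mul]; exact zero_mem _
    | add y z _ _ hy hz => rw [add_mul, add_mul]; exact add_mem hy hz
    | smul c y _ hy => rw [smul_mul_assoc, smul_mul_assoc]; exact Submodule.smul_mem _ _ hy
  replace hb := 𝓡.mem_span_of_mem_presentedUnits hword hb
  induction hb using Submodule.span_induction with
  | mem y hy =>
    obtain ⟨v, rfl⟩ := hy
    obtain ⟨d, c, hd, hc, rfl⟩ := exists_mul_isLeftMin 𝓡.cs (typeMap 𝓡.cs g) v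
    obtain ⟨a', ha', h⟩ := 𝓡.exists_presentedΛ_mul hword hg hc
    rw [𝓡.presentedW_mul hword (hd.length_mul hc), ← mul_assoc, mul_assoc a, h, ← mul_assoc]
    exact step d hd _ (MulMemClass.mul_mem ha ha')
  | zero => rw [mul_zero]; exact zero_mem _
  | add y z _ _ hy hz => rw [mul_add]; exact add_mem hy hz
  | smul c y _ hy => rw [mul_smul_comm]; exact Submodule.smul_mem _ _ hy

/-- For $x=e\in\Lambda_\circ$ write $u=awb$ with $w\in\mathrm{Red}(e,g)$: $T_a$ escapes to the left,
$T_b$ to the right, and the wedge relation collapses $T_eT_wT_g$. -/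
theorem presentedGen_mul_mem (x : 𝓡.Letter) {q : 𝓡.PresentedHecke word}
    (hq : q ∈ Submodule.span ℤ[X] (Set.range (𝓡.presentedNormal word))) :
    𝓡.presentedGen word x * q ∈ Submodule.span ℤ[X] (Set.range (𝓡.presentedNormal word)) := by
  induction hq using Submodule.span_induction with
  | mem y hy =>
    obtain ⟨r, rfl⟩ := hy
    obtain ⟨u, g, v, h, rfl⟩ := 𝓡.exists_isNormal r
    rw [𝓡.presentedNormal_eq h]
    rcases x with i | e
    · rw [← mul_assoc, ← mul_assoc]
      exact 𝓡.mul_presentedΛ_mul_mem hword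
        (MulMemClass.mul_mem (𝓡.presentedS_mem i) (𝓡.presentedW_mem u)) h.mem (𝓡.presentedW_mem v)
    · rw [← 𝓡.presentedΛ_eq e.2]
      obtain ⟨a, ha, w, hw, b, hb, rfl, hl⟩ :=
        exists_isDoubleReduced 𝓡.cs (typeMap 𝓡.cs (e : R)) (typeMap 𝓡.cs g) u
      have h1 := 𝓡.cs.length_mul_le (a * w) b
      have h2 := 𝓡.cs.length_mul_le a w
      obtain ⟨α, hα, hα'⟩ := 𝓡.exists_presentedΛ_mul hword e.2.1 ha
      obtain ⟨β, hβ, hβ'⟩ := 𝓡.exists_mul_presentedΛ hword h.mem hb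
      have key : 𝓡.presentedΛ word (e : R) * (𝓡.presentedW word (a * w * b) *
          𝓡.presentedΛ word g * 𝓡.presentedW word v) = (X ^ 𝓡.cs.length w : ℤ[X]) •
          (α * 𝓡.presentedΛ word (e * w * g) * (β * 𝓡.presentedW word v)) := by
        rw [𝓡.presentedW_mul hword (by omega), 𝓡.presentedW_mul hword (by omega)]
        calc _ = (𝓡.presentedΛ word (e : R) * 𝓡.presentedW word a) * 𝓡.presentedW word w *
              (𝓡.presentedW word b * 𝓡.presentedΛ word g) * 𝓡.presentedW word v := by
              simp only [mul_assoc]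
          _ = α * (𝓡.presentedΛ word (e : R) * 𝓡.presentedW word w * 𝓡.presentedΛ word g) *
              (β * 𝓡.presentedW word v) := by
              rw [hα', hβ']; simp only [mul_assoc]
          _ = _ := by
              rw [𝓡.presentedΛ_wedge hword e.2 h.mem hw, mul_smul_comm, smul_mul_assoc]
      rw [key]
      exact Submodule.smul_mem _ _ (𝓡.mul_presentedΛ_mul_mem hword hα
        (𝓡.wedge_spec e.2.1 h.mem hw).1 (MulMemClass.mul_mem hβ (𝓡.presentedW_mem v)))
  | zero => rw [mul_zero]; exact zero_mem _
  | add y z _ _ hy hz => rw [mul_add]; exact add_mem hy hz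
  | smul c y _ hy => rw [mul_smul_comm]; exact Submodule.smul_mem _ _ hy

theorem span_presentedNormal :
    Submodule.span ℤ[X] (Set.range (𝓡.presentedNormal word)) = ⊤ := by
  have key : ∀ x : FreeAlgebra ℤ[X] 𝓡.Letter,
      ∀ q ∈ Submodule.span ℤ[X] (Set.range (𝓡.presentedNormal word)),
      RingQuot.mkAlgHom ℤ[X] (𝓡.HeckeRel word) x * q ∈
        Submodule.span ℤ[X] (Set.range (𝓡.presentedNormal word)) := by
    intro x
    induction x using FreeAlgebra.induction with
    | grade0 c =>
      intro q hq
      rw [AlgHom.commutes, ← Algebra.smul_def]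
      exact Submodule.smul_mem _ _ hq
    | grade1 x => exact fun q hq => 𝓡.presentedGen_mul_mem hword x hq
    | mul a b ha hb =>
      intro q hq
      rw [map_mul, mul_assoc]
      exact ha _ (hb _ hq)
    | add a b ha hb =>
      intro q hq
      rw [map_add, add_mul]
      exact add_mem (ha _ hq) (hb _ hq)
  have h1 : (1 : 𝓡.PresentedHecke word) ∈
      Submodule.span ℤ[X] (Set.range (𝓡.presentedNormal word)) := by
    have := 𝓡.mul_presentedΛ_mul_mem hword (one_mem _) 𝓡.one_mem_Λ (one_mem _)
    rwa [presentedΛ_one, one_mul, mul_one] at this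
  rw [eq_top_iff]
  rintro a -
  obtain ⟨x, rfl⟩ := RingQuot.mkAlgHom_surjective ℤ[X] (𝓡.HeckeRel word) a
  simpa using key x 1 h1

theorem presentedAction_presentedW (w : Rˣ) :
    𝓡.presentedAction hword (𝓡.presentedW word w) = ((word w).map 𝓡.leftS).prod := by
  rw [presentedW_eq_mkAlgHom, presentedAction_mkAlgHom, freeAction_genWord]

theorem presentedAction_presentedΛ (hg : g ∈ 𝓡.Λ) :
    𝓡.presentedAction hword (𝓡.presentedΛ word g) = 𝓡.leftΛ g := by
  by_cases h : g = 1
  · subst h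
    rw [presentedΛ_one, map_one]
    refine end_ext fun r => ?_
    simp [leftΛ_basisT]
  · rw [𝓡.presentedΛ_eq ⟨hg, h⟩, presentedAction_presentedGen]
    rfl

/-- Lengths add up in a normal form, so neither quadratic terms nor powers of $q$ arise. -/
theorem presentedAction_presentedNormal (r : R) :
    𝓡.presentedAction hword (𝓡.presentedNormal word r) (basisT 1) = basisT r := by
  obtain ⟨u, g, v, h, rfl⟩ := 𝓡.exists_isNormal r
  have h1 : 𝓡.length (g * v) = 𝓡.cs.length v := by
    simpa using (IsNormal.mk (𝓡 := 𝓡) (u := 1) h.mem isRightMin_one h.left).length_eq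
  have hu := (hword u).1.eq
  rw [(hword u).2] at hu
  rw [𝓡.presentedNormal_eq h, map_mul, map_mul, 𝓡.presentedAction_presentedΛ hword h.mem,
    presentedAction_presentedW, presentedAction_presentedW, Module.End.mul_apply,
    Module.End.mul_apply, prod_leftS_basisT_one (hword v).1, (hword v).2, leftΛ_basisT, length_unit,
    h1, Nat.sub_self, pow_zero, one_smul, prod_leftS_basisT, (hword u).2, mul_assoc]
  rw [(hword u).2, ← mul_assoc, h.length_eq, h1, hu]

/-- The presented algebra is a free module with a basis indexed by `R`; an element corresponds to
its value on `T_1`. -/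
noncomputable def presentedEquiv : 𝓡.PresentedHecke word ≃ₗ[ℤ[X]] (R →₀ ℤ[X]) :=
  -- Evaluation at $T_1$ is a left inverse of $T_r\mapsto$ normal form; as the normal forms span, it
  -- is a two-sided inverse.
  have h : (LinearMap.applyₗ (basisT 1)).comp (𝓡.presentedAction hword).toLinearMap ∘ₗ
      Finsupp.linearCombination ℤ[X] (𝓡.presentedNormal word) = LinearMap.id :=
    end_ext fun r => by
      simpa [basisT] using 𝓡.presentedAction_presentedNormal hword r
  have h' : Function.Surjective (Finsupp.linearCombination ℤ[X] (𝓡.presentedNormal word)) := by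
    rw [← LinearMap.range_eq_top, Finsupp.range_linearCombination, 𝓡.span_presentedNormal hword]
  LinearEquiv.ofLinearMap ((LinearMap.applyₗ (basisT 1)).comp (𝓡.presentedAction hword).toLinearMap)
    (Finsupp.linearCombination ℤ[X] (𝓡.presentedNormal word)) h (by
      refine LinearMap.ext fun a => ?_
      obtain ⟨c, rfl⟩ := h' a
      exact congrArg (Finsupp.linearCombination ℤ[X] (𝓡.presentedNormal word))
        (LinearMap.congr_fun h c))

theorem presentedEquiv_apply (a : 𝓡.PresentedHecke word) :
    𝓡.presentedEquiv hword a = 𝓡.presentedAction hword a (basisT 1) := rfl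

theorem presentedEquiv_presentedGen (x : 𝓡.Letter) :
    𝓡.presentedEquiv hword (𝓡.presentedGen word x) = basisT (𝓡.letterVal x) := by
  rw [presentedEquiv_apply, presentedAction_presentedGen]
  rcases x with i | e
  · exact 𝓡.leftS_basisT_one i
  · exact 𝓡.leftΛ_basisT_one e

end Presented

/-! ### Uniqueness and existence of the product on $V$ -/

section Hecke

variable {𝓡}
variable {μ : (R →₀ ℤ[X]) →ₗ[ℤ[X]] (R →₀ ℤ[X]) →ₗ[ℤ[X]] (R →₀ ℤ[X])}

theorem IsHeckeMul.letterVal (hμ : 𝓡.IsHeckeMul μ) (x : 𝓡.Letter) :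
    μ (basisT (𝓡.letterVal x)) = 𝓡.leftOp x := by
  refine end_ext fun r => ?_
  rcases x with i | e
  · change _ = 𝓡.leftS i (basisT r)
    rcases 𝓡.simple_mul_trichotomy i r with h | h | h
    · rw [leftS_up h]
      exact hμ.simple_up i r h
    · rw [leftS_fix h]
      exact hμ.simple_eq i r (by rw [h])
    · rw [leftS_down h]
      exact hμ.simple_down i r h
  · change _ = 𝓡.leftΛ e (basisT r)
    rw [leftΛ_basisT]
    exact hμ.lambda_mul e e.2 r

/-- By associativity a product of letters multiplies by the product of their prescribed operators,
and every $T_r$ is a product of letters. -/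
theorem IsHeckeMul.unique {ν : (R →₀ ℤ[X]) →ₗ[ℤ[X]] (R →₀ ℤ[X]) →ₗ[ℤ[X]] (R →₀ ℤ[X])}
    (hμ : 𝓡.IsHeckeMul μ) (hν : 𝓡.IsHeckeMul ν) : μ = ν := by
  have key : ∀ {μ : (R →₀ ℤ[X]) →ₗ[ℤ[X]] (R →₀ ℤ[X]) →ₗ[ℤ[X]] (R →₀ ℤ[X])}, 𝓡.IsHeckeMul μ →
      ∀ ω : List 𝓡.Letter, μ ((ω.map 𝓡.leftOp).prod (basisT 1)) = (ω.map 𝓡.leftOp).prod := by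
    intro μ hμ ω
    induction ω with
    | nil => exact LinearMap.ext hμ.one_left
    | cons x ω ih =>
      rw [List.map_cons, List.prod_cons, Module.End.mul_apply, ← hμ.letterVal]
      refine LinearMap.ext fun a => ?_
      rw [hμ.assoc, ih, Module.End.mul_apply]
  refine Finsupp.lhom_ext' fun r => LinearMap.ext_ring ?_
  change μ (basisT r) = ν (basisT r)
  obtain ⟨ω, hω⟩ := 𝓡.exists_prod_leftOp r
  rw [← hω, key hμ, key hν]

variable (𝓡)
variable {word : Rˣ → List B}
variable (hword : ∀ w : Rˣ, 𝓡.cs.IsReduced (word w) ∧ 𝓡.cs.wordProd (word w) = w)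

/-- The product of the generic Hecke algebra. -/
noncomputable def heckeMul : (R →₀ ℤ[X]) →ₗ[ℤ[X]] (R →₀ ℤ[X]) →ₗ[ℤ[X]] (R →₀ ℤ[X]) :=
  (𝓡.presentedAction hword).toLinearMap ∘ₗ (𝓡.presentedEquiv hword).symm.toLinearMap

theorem heckeMul_presentedEquiv (a : 𝓡.PresentedHecke word) :
    𝓡.heckeMul hword (𝓡.presentedEquiv hword a) = 𝓡.presentedAction hword a := by
  simp [heckeMul]

theorem heckeMul_mul (a b : 𝓡.PresentedHecke word) :
    𝓡.heckeMul hword (𝓡.presentedEquiv hword a) (𝓡.presentedEquiv hword b) =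
      𝓡.presentedEquiv hword (a * b) := by
  rw [heckeMul_presentedEquiv, presentedEquiv_apply, presentedEquiv_apply, map_mul,
    Module.End.mul_apply]

theorem presentedEquiv_one : 𝓡.presentedEquiv hword 1 = basisT 1 := by
  rw [presentedEquiv_apply, map_one, Module.End.one_apply]

theorem heckeMul_letterVal (x : 𝓡.Letter) :
    𝓡.heckeMul hword (basisT (𝓡.letterVal x)) = 𝓡.leftOp x := by
  rw [← 𝓡.presentedEquiv_presentedGen hword, heckeMul_presentedEquiv, presentedAction_presentedGen]

/-- The ring axioms are transported along `presentedEquiv`; the defining formulas hold since a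
letter multiplies by its operator `leftOp`. -/
theorem isHeckeMul_heckeMul : 𝓡.IsHeckeMul (𝓡.heckeMul hword) where
  assoc a b c := by
    obtain ⟨a, rfl⟩ := (𝓡.presentedEquiv hword).surjective a
    obtain ⟨b, rfl⟩ := (𝓡.presentedEquiv hword).surjective b
    obtain ⟨c, rfl⟩ := (𝓡.presentedEquiv hword).surjective c
    rw [heckeMul_mul, heckeMul_mul, heckeMul_mul, heckeMul_mul, mul_assoc]
  one_left a := by
    obtain ⟨a, rfl⟩ := (𝓡.presentedEquiv hword).surjective a
    rw [← 𝓡.presentedEquiv_one hword, heckeMul_mul, one_mul]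
  one_right a := by
    obtain ⟨a, rfl⟩ := (𝓡.presentedEquiv hword).surjective a
    rw [← 𝓡.presentedEquiv_one hword, heckeMul_mul, mul_one]
  simple_up i r h :=
    (LinearMap.congr_fun (𝓡.heckeMul_letterVal hword (Sum.inl i)) _).trans (leftS_up h)
  simple_eq i r h :=
    (LinearMap.congr_fun (𝓡.heckeMul_letterVal hword (Sum.inl i)) _).trans (leftS_eq h)
  simple_down i r h :=
    (LinearMap.congr_fun (𝓡.heckeMul_letterVal hword (Sum.inl i)) _).trans (leftS_down h)
  lambda_mul e he r :=
    (LinearMap.congr_fun (𝓡.heckeMul_letterVal hword (Sum.inr ⟨e, he⟩)) _).trans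
      (leftΛ_basisT e r)

variable {𝓡}

/-- The isomorphism of the presented algebra with the generic Hecke algebra. -/
noncomputable def presentedAlgEquiv (hμ : 𝓡.IsHeckeMul μ) :
    𝓡.PresentedHecke word ≃ₐ[ℤ[X]] HeckeAlgebra hμ :=
  AlgEquiv.ofLinearEquiv (A₂ := HeckeAlgebra hμ) (𝓡.presentedEquiv hword)
    (𝓡.presentedEquiv_one hword) fun a b => (𝓡.heckeMul_mul hword a b).symm.trans
      (congrArg (fun ν => ν (𝓡.presentedEquiv hword a) (𝓡.presentedEquiv hword b))
        ((𝓡.isHeckeMul_heckeMul hword).unique hμ))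

end Hecke

end RennerCoxeterSystem

theorem mainTheorem6 {B R : Type*} [Monoid R] {M : CoxeterMatrix B}
    (𝓡 : RennerCoxeterSystem M R)
    (word : Rˣ → List B)
    (hword : ∀ w : Rˣ, 𝓡.cs.IsReduced (word w) ∧ 𝓡.cs.wordProd (word w) = w) :
    (∃! μ : (R →₀ ℤ[X]) →ₗ[ℤ[X]] (R →₀ ℤ[X]) →ₗ[ℤ[X]] (R →₀ ℤ[X]), 𝓡.IsHeckeMul μ) ∧
    (∀ e ∈ 𝓡.LambdaCirc, ∀ f ∈ 𝓡.LambdaCirc, ∀ w ∈ 𝓡.Red e f,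
      ∃! h : R, h ∈ 𝓡.LambdaCirc ∧ 𝓡.IsWedge e w f h) ∧
    ∀ (μ : (R →₀ ℤ[X]) →ₗ[ℤ[X]] (R →₀ ℤ[X]) →ₗ[ℤ[X]] (R →₀ ℤ[X])) (hμ : 𝓡.IsHeckeMul μ),
      ∃ φ : 𝓡.PresentedHecke word ≃ₐ[ℤ[X]] RennerCoxeterSystem.HeckeAlgebra hμ,
        ∀ x : 𝓡.Letter, φ (𝓡.presentedGen word x) =
          RennerCoxeterSystem.HeckeAlgebra.T hμ (𝓡.letterVal x) :=
  ⟨⟨𝓡.heckeMul hword, 𝓡.isHeckeMul_heckeMul hword,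
      fun _ hμ => hμ.unique (𝓡.isHeckeMul_heckeMul hword)⟩,
    fun _ he _ hf _ hw => 𝓡.existsUnique_wedge he hf hw,
    fun _ hμ => ⟨RennerCoxeterSystem.presentedAlgEquiv hword hμ,
      𝓡.presentedEquiv_presentedGen hword⟩⟩
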